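/- **Third order Wronskians HK basis for the discrete Kirchhoff system.** Let $a_1,a_3,b_1,b_3,\epsilon\in\mathbb R$ with $a_1\neq 0$, $b_1\neq b_3$, $\epsilon\neq 0$. For $x=(m,p)=(m_1,m_2,m_3,p_1,p_2,p_3)\in\mathbb R^6$ let $$f(m,p)=\begin{pmatrix}(a_3-a_1)m_2m_3+(b_3-b_1)p_2p_3\\ (a_1-a_3)m_1m_3+(b_1-b_3)p_1p_3\\ 0\\ a_3p_2m_3-a_1p_3m_2\\ a_1p_3m_1-a_3p_1m_3\\ a_1(p_1m_2-p_2m_1)\end{pmatrix}$$ be the Kirchhoff vector field, $\Delta(x;\epsilon)=\det(I-\epsilon f'(x))$, and let $\Phi(x)=\Phi(x;\epsilon)=x+2\epsilon\,(I-\epsilon f'(x))^{-1}f(x)$ (defined where $\Delta(x;\epsilon)\ne0$) be its Kahan–Hirota–Kimura discretization, a birational map with inverse $\Phi(\cdot\,;-\epsilon)$. Write $\widetilde x=\Phi(x)$ and $(m^{(\ell)},p^{(\ell)})=\Phi^\ell(m,p)$. Let $U$ be the set of $x$ whose whole orbit $\Phi^i(x)$, $i\in\mathbb Z$, is defined, with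 $\Delta(\Phi^i(x);\pm\epsilon)\ne 0$ for all $i$. Real functions $\varphi_1,\dots,\varphi_n$ form an *HK basis* if they are linearly independent on $U$ and the null-space $K(x)=\{c\in\mathbb R^n:\sum_j c_j\varphi_j(\Phi^i(x))=0\ \forall i\in\mathbb Z\}$ is non-zero for all $x\in U$. A function $F$ is an *integral of motion* if $F(\Phi(x))=F(x)$ wherever $\Phi(x)$, $F(x)$ and $F(\Phi(x))$ are defined. A property holds *generically* if it holds outside the zero set of a non-zero polynomial on $\mathbb R^6$. Functions are *functionally independent* if generically they are differentiable with linearly independent differentials. Put $$I_0=\frac{\frac{2a_3}{a_1}-1+\epsilon^2a_1(a_3-a_1)(m_1^2+m_2^2)+\epsilon^2a_3(b_3-b_1)(p_1^2+p_2^2)}{1+\epsilon^2a_3(a_1-a_3)m_3^2+\epsilon^2a_1(b_1-b_3)p_3^2},$$ $$J_0=\frac{\frac{2a_3}{a_1}-1-\epsilon^2a_1(a_3-a_1)(m_1\widetilde m_1+m_2\widetilde m_2)-\epsilon^2a_3(b_3-b_1)(p_1\widetilde p_1+p_2\widetilde p_2)}{1-\epsilon^2a_3(a_1-a_3)m_3^2-\epsilon^2a_1(b_1-b_3)p_3\widetilde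 p_3}.$$ Then $U$ is dense in $\mathbb R^6$; the functions $W_i^{(3)}=m_i^{(3)}p_i-m_ip_i^{(3)}$, $i=1,2,3$, form an HK basis for $\Phi$; and there is a rational function $J_1=N/D$ on $\mathbb R^6$ ($N,D$ real polynomials, $D\ne0$) such that 1. for generic $x$, $D(x)\neq0$ and, if $x\in U$, the null-space $K(x)$ of $(W^{(3)}_1,W^{(3)}_2,W^{(3)}_3)$ is one-dimensional, spanned by $(1,1,J_1(x))$; 2. $W^{(3)}_1(x)+W^{(3)}_2(x)+J_1(x)W^{(3)}_3(x)=0$ for every $x$ with $D(x)\neq 0$ such that $\Delta(\Phi^i(x);\epsilon)\ne0$ for $i=0,1,2$; 3. $I_0$, $J_0$, $J_1$ and $m_3$ are integrals of motion of $\Phi$; 4. if moreover $a_1\neq 2a_3$, then $I_0,J_0,J_1,m_3$ are functionally independent. Thus $\Phi$ has as many independent integrals as the Kirchhoff flow, and is integrable in this sense. -/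

import Mathlib

/-! ## Hirota–Kimura bases -/

section HirotaKimura

/-- The null-space `K(x)` at `x` of the functions `φ₁, …, φₘ` along the orbit `i ↦ T i x`, `i ∈ ℤ`:
all `c ∈ ℝᵐ` with `c₁ φ₁(T i x) + … + cₘ φₘ(T i x) = 0` for all `i ∈ ℤ`. -/
def hkNullSpace {X : Type*} (T : ℤ → X → X) {m : ℕ} (φ : Fin m → X → ℝ) (x : X) :
    Submodule ℝ (Fin m → ℝ) where
  carrier := {c | ∀ i : ℤ, ∑ j, c j * φ j (T i x) = 0}
  add_mem' := by
    intro c d hc hd i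
    simp only [Pi.add_apply, add_mul, Finset.sum_add_distrib]
    rw [hc i, hd i, add_zero]
  zero_mem' := by
    intro i
    simp
  smul_mem' := by
    intro r c hc i
    simp only [Pi.smul_apply, smul_eq_mul, mul_assoc, ← Finset.mul_sum]
    rw [hc i, mul_zero]

/-- `φ₁, …, φₘ` is a Hirota–Kimura basis for a birational map with iterates `T i`, `i ∈ ℤ`, where
`U` is the set of points all of whose iterates are defined: the functions are linearly independent
on `U`, and the null-space at every point of `U` is non-trivial. -/
structure IsHKBasis {X : Type*} (T : ℤ → X → X) (U : Set X) {m : ℕ} (φ : Fin m → X → ℝ) :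
    Prop where
  linearIndependent : LinearIndependent ℝ (fun j => U.domRestrict (φ j))
  nontrivial : ∀ x ∈ U, hkNullSpace T φ x ≠ ⊥

end HirotaKimura

/-! ## The Kirchhoff system and its Kahan–Hirota–Kimura discretization -/

/-- The parameters of the Kirchhoff system (with `a₂ = a₁` and `b₂ = b₁`). -/
structure KirchhoffParams where
  a₁ : ℝ
  a₃ : ℝ
  b₁ : ℝ
  b₃ : ℝ

/-- Points `(m₁, m₂, m₃, p₁, p₂, p₃)` of the phase space `ℝ⁶`. -/
abbrev KState : Type := Fin 6 → ℝ

namespace Kirchhoff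

noncomputable section

/-- The right-hand side `f` of the Kirchhoff equations. -/
def field (k : KirchhoffParams) (x : KState) : KState :=
  ![(k.a₃ - k.a₁) * x 1 * x 2 + (k.b₃ - k.b₁) * x 4 * x 5,
    (k.a₁ - k.a₃) * x 0 * x 2 + (k.b₁ - k.b₃) * x 3 * x 5,
    0,
    k.a₃ * x 4 * x 2 - k.a₁ * x 5 * x 1,
    k.a₁ * x 5 * x 0 - k.a₃ * x 3 * x 2,
    k.a₁ * (x 3 * x 1 - x 4 * x 0)]

/-- The Jacobi matrix `f'(x)`. -/
def jacobian (k : KirchhoffParams) (x : KState) : Matrix (Fin 6) (Fin 6) ℝ :=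
  !![0, (k.a₃ - k.a₁) * x 2, (k.a₃ - k.a₁) * x 1, 0, (k.b₃ - k.b₁) * x 5, (k.b₃ - k.b₁) * x 4;
    (k.a₁ - k.a₃) * x 2, 0, (k.a₁ - k.a₃) * x 0, (k.b₁ - k.b₃) * x 5, 0, (k.b₁ - k.b₃) * x 3;
    0, 0, 0, 0, 0, 0;
    0, -k.a₁ * x 5, k.a₃ * x 4, 0, k.a₃ * x 2, -k.a₁ * x 1;
    k.a₁ * x 5, 0, -k.a₃ * x 3, -k.a₃ * x 2, 0, k.a₁ * x 0;
    -k.a₁ * x 4, k.a₁ * x 3, 0, k.a₁ * x 1, -k.a₁ * x 0, 0]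

/-- `Δ(x; ε) = det (I - ε f'(x))`. -/
def delta (k : KirchhoffParams) (ε : ℝ) (x : KState) : ℝ :=
  (1 - ε • jacobian k x).det

/-- The map `Φ(x; ε) = x + 2ε (I - ε f'(x))⁻¹ f(x)`, meaningful where `Δ(x; ε) ≠ 0`. -/
def kahanMap (k : KirchhoffParams) (ε : ℝ) (x : KState) : KState :=
  x + (2 * ε) • Matrix.mulVec (1 - ε • jacobian k x)⁻¹ (field k x)

/-- The discrete Kirchhoff equations relating `x = (m, p)` and `y = (m̃, p̃)`. -/
def IsStep (k : KirchhoffParams) (ε : ℝ) (x y : KState) : Prop :=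
  y 0 - x 0 = ε * (k.a₃ - k.a₁) * (y 1 * x 2 + x 1 * y 2)
      + ε * (k.b₃ - k.b₁) * (y 4 * x 5 + x 4 * y 5) ∧
  y 1 - x 1 = ε * (k.a₁ - k.a₃) * (y 2 * x 0 + x 2 * y 0)
      + ε * (k.b₁ - k.b₃) * (y 5 * x 3 + x 5 * y 3) ∧
  y 2 - x 2 = 0 ∧
  y 3 - x 3 = ε * k.a₃ * (y 2 * x 4 + x 2 * y 4) - ε * k.a₁ * (y 1 * x 5 + x 1 * y 5) ∧
  y 4 - x 4 = ε * k.a₁ * (y 0 * x 5 + x 0 * y 5) - ε * k.a₃ * (y 2 * x 3 + x 2 * y 3) ∧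
  y 5 - x 5 = ε * k.a₁ * (y 1 * x 3 + x 1 * y 3 - y 0 * x 4 - x 0 * y 4)

theorem isStep_iff_mulVec (k : KirchhoffParams) (ε : ℝ) (x y : KState) :
    IsStep k ε x y ↔
      Matrix.mulVec (1 - ε • jacobian k x) (y - x) = (2 * ε) • field k x := by
  rw [Matrix.sub_mulVec, Matrix.one_mulVec, Matrix.smul_mulVec]
  constructor
  · rintro ⟨h0, h1, h2, h3, h4, h5⟩
    funext i
    fin_cases i <;>
      simp [jacobian, field, dotProduct, Fin.sum_univ_succ] <;> linarith
  · intro h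
    have g := fun i => congrFun h i
    have g0 := g 0
    have g1 := g 1
    have g2 := g 2
    have g3 := g 3
    have g4 := g 4
    have g5 := g 5
    clear g h
    simp [jacobian, field, dotProduct, Fin.sum_univ_succ] at g0 g1 g2 g3 g4 g5
    refine ⟨?_, ?_, ?_, ?_, ?_, ?_⟩ <;> linarith

/-- Where `Δ(x; ε) ≠ 0`, the discrete Kirchhoff equations have the unique solution `Φ(x; ε)`. -/
theorem isStep_iff (k : KirchhoffParams) (ε : ℝ) (x y : KState) (h : delta k ε x ≠ 0) :
    IsStep k ε x y ↔ y = kahanMap k ε x := by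
  have hu : IsUnit (1 - ε • jacobian k x).det := isUnit_iff_ne_zero.mpr h
  rw [isStep_iff_mulVec]
  constructor
  · intro e
    have e' := congrArg (Matrix.mulVec (1 - ε • jacobian k x)⁻¹) e
    rw [Matrix.mulVec_mulVec, Matrix.nonsing_inv_mul _ hu, Matrix.one_mulVec,
      Matrix.mulVec_smul] at e'
    rw [kahanMap, ← e']
    abel
  · rintro rfl
    rw [kahanMap, add_sub_cancel_left, Matrix.mulVec_smul, Matrix.mulVec_mulVec,
      Matrix.mul_nonsing_inv _ hu, Matrix.one_mulVec]

/-- The iterates `Φⁱ`, `i ∈ ℤ`, the inverse of `Φ(·; ε)` being `Φ(·; -ε)`. -/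
def iter (k : KirchhoffParams) (ε : ℝ) : ℤ → KState → KState
  | Int.ofNat n => (kahanMap k ε)^[n]
  | Int.negSucc n => (kahanMap k (-ε))^[n + 1]

/-- The points whose whole forward and backward orbit is defined: no point of the orbit is singular
for `Φ(·; ε)` or for its inverse `Φ(·; -ε)`. -/
def orbitDomain (k : KirchhoffParams) (ε : ℝ) : Set KState :=
  {x | ∀ i : ℤ, delta k ε (iter k ε i x) ≠ 0 ∧ delta k (-ε) (iter k ε i x) ≠ 0}

/-- The discrete Wronskians `W⁽ˡ⁾ᵢ = mᵢ⁽ˡ⁾ pᵢ - mᵢ pᵢ⁽ˡ⁾` of order `l`, with `(m⁽ˡ⁾, p⁽ˡ⁾) = Φˡ(m, p)`.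
The index `i : Fin 3` embeds as `i` (component `mᵢ`) and as `i + 3` (component `pᵢ`). -/
def wronskian (k : KirchhoffParams) (ε : ℝ) (l : ℕ) (i : Fin 3) (x : KState) : ℝ :=
  ((kahanMap k ε)^[l] x) (Fin.castAdd 3 i) * x (Fin.natAdd 3 i)
    - x (Fin.castAdd 3 i) * ((kahanMap k ε)^[l] x) (Fin.natAdd 3 i)

/-- The denominator `c₁` of `I₀`. -/
def c₁ (k : KirchhoffParams) (ε : ℝ) (x : KState) : ℝ :=
  1 + ε ^ 2 * k.a₃ * (k.a₁ - k.a₃) * x 2 ^ 2 + ε ^ 2 * k.a₁ * (k.b₁ - k.b₃) * x 5 ^ 2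

/-- The numerator `c₃` of `I₀`. -/
def c₃ (k : KirchhoffParams) (ε : ℝ) (x : KState) : ℝ :=
  2 * k.a₃ / k.a₁ - 1 + ε ^ 2 * k.a₁ * (k.a₃ - k.a₁) * (x 0 ^ 2 + x 1 ^ 2)
    + ε ^ 2 * k.a₃ * (k.b₃ - k.b₁) * (x 3 ^ 2 + x 4 ^ 2)

/-- The quadratic-fractional integral `I₀`. -/
def I₀ (k : KirchhoffParams) (ε : ℝ) (x : KState) : ℝ := c₃ k ε x / c₁ k ε x

/-- The denominator `C₁` of `J₀`. -/
def C₁ (k : KirchhoffParams) (ε : ℝ) (x : KState) : ℝ :=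
  1 - ε ^ 2 * k.a₃ * (k.a₁ - k.a₃) * x 2 ^ 2
    - ε ^ 2 * k.a₁ * (k.b₁ - k.b₃) * (x 5 * kahanMap k ε x 5)

/-- The numerator `C₃` of `J₀`. -/
def C₃ (k : KirchhoffParams) (ε : ℝ) (x : KState) : ℝ :=
  2 * k.a₃ / k.a₁ - 1
    - ε ^ 2 * k.a₁ * (k.a₃ - k.a₁) * (x 0 * kahanMap k ε x 0 + x 1 * kahanMap k ε x 1)
    - ε ^ 2 * k.a₃ * (k.b₃ - k.b₁) * (x 3 * kahanMap k ε x 3 + x 4 * kahanMap k ε x 4)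

/-- The bilinear-fractional integral `J₀`. -/
def J₀ (k : KirchhoffParams) (ε : ℝ) (x : KState) : ℝ := C₃ k ε x / C₁ k ε x

/-- The coordinate function `m₃`. -/
def m₃ (x : KState) : ℝ := x 2

/-- The rational function `N / D`. -/
def ratFun (N D : MvPolynomial (Fin 6) ℝ) (x : KState) : ℝ :=
  MvPolynomial.eval x N / MvPolynomial.eval x D

/-- The function `F`, whose domain of definition is `dom`, is an integral of motion of `Φ(·; ε)`:
`F (Φ x) = F x` wherever `Φ x`, `F x` and `F (Φ x)` are defined. -/
def IsIntegral (k : KirchhoffParams) (ε : ℝ) (dom : Set KState) (F : KState → ℝ) : Prop :=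
  ∀ x ∈ dom, delta k ε x ≠ 0 → kahanMap k ε x ∈ dom → F (kahanMap k ε x) = F x

/-- `P` holds at generic points, that is, outside the zero set of some non-zero polynomial. -/
def Generically (P : KState → Prop) : Prop :=
  ∃ q : MvPolynomial (Fin 6) ℝ, q ≠ 0 ∧ ∀ x, MvPolynomial.eval x q ≠ 0 → P x

/-- Functional independence of (almost everywhere defined, smooth) functions: at generic points
they are differentiable with linearly independent differentials. -/
def FunctionallyIndependent {n : ℕ} (F : Fin n → KState → ℝ) : Prop :=
  Generically fun x =>
    (∀ j, DifferentiableAt ℝ (F j) x) ∧ LinearIndependent ℝ (fun j => fderiv ℝ (F j) x)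

end

end Kirchhoff

/-! ## The algebra of the discrete equations -/

/-! Since m₃ is conserved, W₃⁽³⁾ = m₃ (p₃ - p₃⁽³⁾). In the rotating coordinates M = m₁ + i m₂, P =
p₁ + i p₂, rescaled by ε a₁, the sum W₁⁽³⁾ + W₂⁽³⁾ is the real part of the skew-hermitian `pairing`
of a point with its third iterate. So the relation to be proved says that `pairing x₀ x₃` is a
multiple of the increment ζ₃ - ζ₀ of ζ = i p₃, by a factor whose imaginary part is conserved.

For given values of ζ one step is linear in (M, P), with a 2 × 2 matrix of determinant `reDet` +
`imDet`. Cramer's rule gives `pairing x y` = (y.ζ - x.ζ)(1 - ν I) with I = I₀ (`Step.pairing_eq`).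
Further elimination produces a second factor J in `Step.imPart_add_eq`, with (2a - 1) J = I₀ + J₀,
and a third quantity N, where `tau` converts `imPart` of a point into the difference of the
neighbouring values of ζ. The reversal symmetry `Step.reverse` makes I, J and N invariant. They give
the constant of order two (`Step.pairing_two`). For order three, x₀ and x₃ are expanded in the basis
x₁, x₂ of the (M, P)-plane (`pairing_three`); the constant is an expression in ν, I, J, N, and its
imaginary part yields J₁.

All this is done at points where no denominator vanishes. Each such condition is generic, because a
rational function that is non-zero at one point of continuity is generically non-zero, and generic
conditions pull back along Φ. Baire's theorem then gives a dense set of entire good orbits, and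
continuity extends the identities to all points where they make sense.

The null-space is generically a line because `wronskianDet` is not identically zero; this is tested
on orbits symmetric under a reversing reflection, through points near the fixed point 0. A linear
relation between the Wronskians would make J₁ constant, which two explicit values refute. For
functional independence, the differentials of I, J, N, m₃ are computed at one point; the passage to
I₀, J₀, J₁, m₃ is triangular, with J₀ = (2a - 1) J - I₀ and J₁ depending effectively on N. -/

namespace KirchhoffAlgebra

/-- A phase point in rotating coordinates: `M = m₁ + i m₂`, `P = p₁ + i p₂`, their conjugates `M'`
and `P'` (treated as independent variables), and `ζ = i p₃`. -/
structure Point (K : Type*) where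
  M : K
  P : K
  M' : K
  P' : K
  ζ : K

variable {K : Type*}

/-- The point with the two conjugate pairs of coordinates interchanged. -/
def Point.swap (x : Point K) : Point K := ⟨x.M', x.P', x.M, x.P, x.ζ⟩

@[simp] theorem Point.swap_ζ (x : Point K) : x.swap.ζ = x.ζ := rfl

variable [Field K]

/-- The discrete equations in rotating coordinates, with `ν = i m₃`. -/
structure Step (a β ν : K) (x y : Point K) : Prop where
  eM : (1 + (a - 1) * ν) * y.M + β * x.ζ * y.P = (1 - (a - 1) * ν) * x.M - β * y.ζ * x.P
  eP : (1 + a * ν) * y.P - x.ζ * y.M = (1 - a * ν) * x.P + y.ζ * x.M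
  eM' : (1 - (a - 1) * ν) * y.M' - β * x.ζ * y.P' = (1 + (a - 1) * ν) * x.M' + β * y.ζ * x.P'
  eP' : (1 - a * ν) * y.P' + x.ζ * y.M' = (1 + a * ν) * x.P' - y.ζ * x.M'
  eζ : 2 * (y.ζ - x.ζ) = (y.M * x.P' - y.P * x.M') - (y.M' * x.P - y.P' * x.M)

/-- Changing the signs of m₂ and p₂ reverses time. Hence an identity read at the initial point of a
step has a mirror image at its final point; comparing the two produces conserved quantities. -/
theorem Step.reverse {a β ν : K} {x y : Point K} (s : Step a β ν x y) :
    Step a β ν y.swap x.swap := by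
  obtain ⟨h1, h2, h3, h4, h5⟩ := s
  constructor <;> simp only [Point.swap]
  · linear_combination -h3
  · linear_combination -h4
  · linear_combination -h1
  · linear_combination -h2
  · linear_combination -h5

/-- The pairing `ω(v, v'₀)` of two points. -/
def pairing (x y : Point K) : K := y.M * x.P' - y.P * x.M'

/-- `Im (M · conj P)`, up to the factor `i`. -/
def imPart (x : Point K) : K := (x.M * x.P' - x.M' * x.P) / 2

/-- `Re (M · conj P)`. -/
def rePart (x : Point K) : K := (x.M * x.P' + x.M' * x.P) / 2

/-- `|M|² + β |P|²`. -/
def normH (β : K) (x : Point K) : K := x.M * x.M' + β * (x.P * x.P')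

/-- `(a - 1) |M|² + a β |P|²`. -/
def normE (a β : K) (x : Point K) : K := (a - 1) * (x.M * x.M') + a * β * (x.P * x.P')

/-- The real part of `det L`. -/
def reDet (a β ν : K) (x : Point K) : K := 1 + a * (a - 1) * ν ^ 2 + β * x.ζ ^ 2

/-- The polarization of `reDet`. -/
def polDet (a β ν : K) (x y : Point K) : K := 1 - a * (a - 1) * ν ^ 2 - β * (x.ζ * y.ζ)

/-- The imaginary part of `det L`, up to the factor `i`. -/
def imDet (a ν : K) : K := (2 * a - 1) * ν

@[simp] theorem imPart_swap (x : Point K) : imPart x.swap = -imPart x := by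
  simp only [imPart, Point.swap]; ring
@[simp] theorem rePart_swap (x : Point K) : rePart x.swap = rePart x := by
  simp only [rePart, Point.swap]; ring
@[simp] theorem normH_swap (β : K) (x : Point K) : normH β x.swap = normH β x := by
  simp only [normH, Point.swap]; ring
@[simp] theorem normE_swap (a β : K) (x : Point K) : normE a β x.swap = normE a β x := by
  simp only [normE, Point.swap]; ring
@[simp] theorem reDet_swap (a β ν : K) (x : Point K) : reDet a β ν x.swap = reDet a β ν x := rfl
@[simp] theorem polDet_swap (a β ν : K) (x y : Point K) :
    polDet a β ν x.swap y.swap = polDet a β ν x y := rfl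
@[simp] theorem pairing_swap_swap (x y : Point K) :
    pairing y.swap x.swap = -pairing x y := by
  simp only [pairing, Point.swap]; ring

theorem polDet_comm (a β ν : K) (x y : Point K) : polDet a β ν x y = polDet a β ν y x := by
  simp only [polDet]; ring

/-! ### Polynomial identities for a single step. -/

variable {a β ν : K} {x y : Point K}

theorem Step.pairing_sub (s : Step a β ν x y) :
    pairing x y - pairing x.swap y.swap = 2 * (y.ζ - x.ζ) := by
  have := s.eζ
  simp only [pairing, Point.swap]
  linear_combination -this

/-- By Cramer's rule, (`reDet` + `imDet`) times the pairing plus (`reDet` - `imDet`) times its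
mirror is free of the new M and P. This is `reDet` times the sum plus `imDet` times the difference,
and the latter is known from `eζ`. -/
theorem Step.pairing_add (s : Step a β ν x y) :
    (pairing x y + pairing x.swap y.swap) * reDet a β ν x
      = -2 * ν * (y.ζ - x.ζ) * (2 * a - 1 + normE a β x) := by
  obtain ⟨h1, h2, h3, h4, h5⟩ := s
  simp only [pairing, Point.swap, reDet, normE]
  linear_combination
    h1 * ((1 + a * ν) * x.P' - x.ζ * x.M') - h2 * ((1 + (a - 1) * ν) * x.M' + β * x.ζ * x.P')
    + h3 * ((1 - a * ν) * x.P + x.ζ * x.M) - h4 * ((1 - (a - 1) * ν) * x.M - β * x.ζ * x.P)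
    + (2 * a - 1) * ν * h5

variable [CharZero K]

/-- The combination of `pairing_add` with the opposite sign: now the difference is multiplied by
`reDet` and the sum by `imDet`. Once the sum is expressed through I, the next ζ solves a linear
equation with coefficients taken at x. -/
theorem Step.linear_ζ (s : Step a β ν x y) {I : K}
    (hA : pairing x y + pairing x.swap y.swap = -2 * ν * (y.ζ - x.ζ) * I) :
    (y.ζ - x.ζ) * (reDet a β ν x + normH β x - imDet a ν * ν * I + 2 * β * x.ζ * imPart x)
      = 2 * (ν * rePart x - x.ζ * normH β x
        + imPart x * (1 - a * (a - 1) * ν ^ 2 - β * x.ζ ^ 2)) := by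
  obtain ⟨h1, h2, h3, h4, h5⟩ := s
  simp only [pairing, Point.swap, reDet, normH, imDet, imPart, rePart] at *
  linear_combination
    (1/2) * (h1 * ((1 + a * ν) * x.P' - x.ζ * x.M')
      - h2 * ((1 + (a - 1) * ν) * x.M' + β * x.ζ * x.P'))
    - (1/2) * (h3 * ((1 - a * ν) * x.P + x.ζ * x.M)
      - h4 * ((1 - (a - 1) * ν) * x.M - β * x.ζ * x.P))
    - (2 * a - 1) * ν / 2 * hA
    + (1/2) * (1 + a * (a - 1) * ν ^ 2 + β * x.ζ ^ 2) * h5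

/-- An energy computation: the equations for M, P are multiplied by the conjugates of the sums x +
y, so that the squared moduli telescope. -/
theorem Step.normH_sub (s : Step a β ν x y) :
    normH β x - normH β y
      = -2 * β * (x.ζ * imPart y + y.ζ * imPart x) - β * (y.ζ ^ 2 - x.ζ ^ 2) := by
  obtain ⟨h1, h2, h3, h4, h5⟩ := s
  simp only [normH, imPart]
  linear_combination
    -(1/2) * (h1 * (y.M' + x.M') + h3 * (y.M + x.M) + β * h2 * (y.P' + x.P')
      + β * h4 * (y.P + x.P)) + β * (x.ζ + y.ζ) / 2 * h5

/-- The product of the two conjugate determinants clears the denominators of the new M, P, M', P'.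
The linear equation for the increment of ζ then removes `rePart` and lets that increment be factored
out. -/
theorem Step.imPart_add (s : Step a β ν x y) {I : K}
    (hI : I * reDet a β ν x = 2 * a - 1 + normE a β x)
    (hζ : (y.ζ - x.ζ) * (reDet a β ν x + normH β x - imDet a ν * ν * I + 2 * β * x.ζ * imPart x)
      = 2 * (ν * rePart x - x.ζ * normH β x
        + imPart x * (1 - a * (a - 1) * ν ^ 2 - β * x.ζ ^ 2))) :
    (imPart x + imPart y + (y.ζ - x.ζ)) * (reDet a β ν x ^ 2 - imDet a ν ^ 2)
      = (y.ζ - x.ζ) * (polDet a β ν x y * (2 * reDet a β ν x - 2 * I * ν * imDet a ν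
            - 2 * β * (x.ζ + y.ζ) * imPart x)
          + (reDet a β ν x + normH β x - imDet a ν * ν * I - 2 * β * x.ζ * imPart x)
            * (4 * a * (a - 1) * ν ^ 2 + β * (x.ζ + y.ζ) ^ 2) / 2) := by
  obtain ⟨h1, h2, h3, h4, h5⟩ := s
  -- Cramer's rule, the determinant being `reDet` + `imDet`, and `reDet` - `imDet` for the conjugate
  -- system.
  have hM : (reDet a β ν x + imDet a ν) * y.M
      = (1 + a * ν) * ((1 - (a - 1) * ν) * x.M - β * y.ζ * x.P)
        - β * x.ζ * ((1 - a * ν) * x.P + y.ζ * x.M) := by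
    simp only [reDet, imDet]; linear_combination (1 + a * ν) * h1 - β * x.ζ * h2
  have hP : (reDet a β ν x + imDet a ν) * y.P
      = (1 + (a - 1) * ν) * ((1 - a * ν) * x.P + y.ζ * x.M)
        + x.ζ * ((1 - (a - 1) * ν) * x.M - β * y.ζ * x.P) := by
    simp only [reDet, imDet]; linear_combination (1 + (a - 1) * ν) * h2 + x.ζ * h1
  have hM' : (reDet a β ν x - imDet a ν) * y.M'
      = (1 - a * ν) * ((1 + (a - 1) * ν) * x.M' + β * y.ζ * x.P')
        + β * x.ζ * ((1 + a * ν) * x.P' - y.ζ * x.M') := by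
    simp only [reDet, imDet]; linear_combination (1 - a * ν) * h3 + β * x.ζ * h4
  have hP' : (reDet a β ν x - imDet a ν) * y.P'
      = (1 - (a - 1) * ν) * ((1 + a * ν) * x.P' - y.ζ * x.M')
        - x.ζ * ((1 + (a - 1) * ν) * x.M' + β * y.ζ * x.P') := by
    simp only [reDet, imDet]; linear_combination (1 - (a - 1) * ν) * h4 - x.ζ * h3
  have hT : imPart y * (reDet a β ν x ^ 2 - imDet a ν ^ 2)
      = (((1 + a * ν) * ((1 - (a - 1) * ν) * x.M - β * y.ζ * x.P)
        - β * x.ζ * ((1 - a * ν) * x.P + y.ζ * x.M))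
        * ((1 - (a - 1) * ν) * ((1 + a * ν) * x.P' - y.ζ * x.M')
        - x.ζ * ((1 + (a - 1) * ν) * x.M' + β * y.ζ * x.P'))
        - ((1 - a * ν) * ((1 + (a - 1) * ν) * x.M' + β * y.ζ * x.P')
        + β * x.ζ * ((1 + a * ν) * x.P' - y.ζ * x.M'))
        * ((1 + (a - 1) * ν) * ((1 - a * ν) * x.P + y.ζ * x.M)
        + x.ζ * ((1 - (a - 1) * ν) * x.M - β * y.ζ * x.P))) / 2 := by
    rw [← hM, ← hP, ← hM', ← hP', imPart]; ring
  rw [add_mul, add_mul, hT]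
  simp only [reDet, imDet, normH, normE, imPart, rePart, polDet] at *
  linear_combination (-(1/2) * β * (y.ζ - x.ζ) ^ 2
      + (1 + a * (a - 1) * ν ^ 2 + β * x.ζ ^ 2) - 2) * hζ
    + (2 * a - 1) * ν ^ 2 * (y.ζ - x.ζ) * hI

/-- The factorization that links the two ways of expressing the second integral. -/
theorem reDet_sq_sub_identity {I η : K}
    (hI : I * reDet a β ν x = 2 * a - 1 + normE a β x)
    (hζ : (η - x.ζ) * (reDet a β ν x + normH β x - imDet a ν * ν * I + 2 * β * x.ζ * imPart x)
      = 2 * (ν * rePart x - x.ζ * normH β x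
        + imPart x * (1 - a * (a - 1) * ν ^ 2 - β * x.ζ ^ 2))) :
    ((1 - a * (a - 1) * ν ^ 2 - β * (x.ζ * η)) * (2 * reDet a β ν x - 2 * I * ν * imDet a ν
          - 2 * β * (x.ζ + η) * imPart x)
        + (reDet a β ν x + normH β x - imDet a ν * ν * I - 2 * β * x.ζ * imPart x)
          * (4 * a * (a - 1) * ν ^ 2 + β * (x.ζ + η) ^ 2) / 2)
      * (reDet a β ν x + normH β x - imDet a ν * ν * I + 2 * β * x.ζ * imPart x)
      = 2 * (reDet a β ν x ^ 2 - imDet a ν ^ 2)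
        * (1 - ν ^ 2 * I ^ 2 + normH β x - β * imPart x ^ 2) := by
  simp only [reDet, imDet, normH, normE, imPart, rePart] at *
  generalize hσ : (1 + a * (a - 1) * ν ^ 2 + β * x.ζ ^ 2 + (x.M * x.M' + β * (x.P * x.P'))
    - (2 * a - 1) * ν * ν * I) = σ at *
  generalize hT : (x.M * x.P' - x.M' * x.P) / 2 = T at *
  generalize hW : (ν * ((x.M * x.P' + x.M' * x.P) / 2)
    - x.ζ * (x.M * x.M' + β * (x.P * x.P')) + T * (1 - a * (a - 1) * ν ^ 2 - β * x.ζ ^ 2)) = W at *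
  -- Expansion in powers of η - ζ. The quadratic coefficient is β/2 times the outer factor σ + 2βζT,
  -- so η - ζ enters only through (η - ζ)(σ + 2βζT), which is 2W.
  have key : ((1 - a * (a - 1) * ν ^ 2 - β * (x.ζ * η)) * (2 * (1 + a * (a - 1) * ν ^ 2
          + β * x.ζ ^ 2) - 2 * I * ν * ((2 * a - 1) * ν) - 2 * β * (x.ζ + η) * T)
        + (σ - 2 * β * x.ζ * T) * (4 * a * (a - 1) * ν ^ 2 + β * (x.ζ + η) ^ 2) / 2)
        * (σ + 2 * β * x.ζ * T)
      = ((1 - a * (a - 1) * ν ^ 2 - β * x.ζ ^ 2) * (2 * (1 + a * (a - 1) * ν ^ 2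
          + β * x.ζ ^ 2) - 2 * I * ν * ((2 * a - 1) * ν) - 4 * β * x.ζ * T)
        + (σ - 2 * β * x.ζ * T) * (4 * a * (a - 1) * ν ^ 2 + 4 * β * x.ζ ^ 2) / 2)
        * (σ + 2 * β * x.ζ * T)
        + (-2 * β * T * (1 - a * (a - 1) * ν ^ 2 - β * x.ζ ^ 2)
          - β * x.ζ * (2 * (1 + a * (a - 1) * ν ^ 2 + β * x.ζ ^ 2) - 2 * I * ν * ((2 * a - 1) * ν)
            - 4 * β * x.ζ * T) + 2 * β * x.ζ * (σ - 2 * β * x.ζ * T)) * (2 * W)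
        + 2 * β * W ^ 2 := by
    linear_combination ((-2 * β * T * (1 - a * (a - 1) * ν ^ 2 - β * x.ζ ^ 2)
          - β * x.ζ * (2 * (1 + a * (a - 1) * ν ^ 2 + β * x.ζ ^ 2) - 2 * I * ν * ((2 * a - 1) * ν)
            - 4 * β * x.ζ * T) + 2 * β * x.ζ * (σ - 2 * β * x.ζ * T))
        + β / 2 * ((η - x.ζ) * (σ + 2 * β * x.ζ * T) + 2 * W)) * hζ
  rw [key, ← hσ, ← hW, ← hT]
  linear_combination 2 * ν ^ 2 * (I * (1 + a * (a - 1) * ν ^ 2 + β * x.ζ ^ 2) - (2 * a - 1)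
    - a * (x.M * x.M') - (a - 1) * β * (x.P * x.P')) * hI

/-- The bilinear expression for the second integral. -/
theorem Step.bilinear (s : Step a β ν x y) {I : K}
    (hA : pairing x y + pairing x.swap y.swap = -2 * ν * (y.ζ - x.ζ) * I)
    (hI : I * reDet a β ν x = 2 * a - 1 + normE a β x)
    (hIy : I * reDet a β ν y = 2 * a - 1 + normE a β y) :
    ν * (y.ζ - x.ζ) * (polDet a β ν x y * I + (2 * a - 1)
        - (a - 1) * ((x.M * y.M' + x.M' * y.M) / 2) - a * β * ((x.P * y.P' + x.P' * y.P) / 2))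
      = ν * (2 * a - 1) * (imPart x + imPart y + (y.ζ - x.ζ)) := by
  obtain ⟨h1, h2, h3, h4, h5⟩ := s
  -- In terms of s = x + y, d = y - x and δ = y.ζ - x.ζ, the equations express (1, -βδ/2; δ/2, 1) d
  -- linearly in s. The factor 1 + βδ²/4 is the determinant of that matrix.
  have key : (pairing x y + pairing x.swap y.swap) * (1 + β * (y.ζ - x.ζ) ^ 2 / 4)
      = -(2 * a - 1) * ν * (imPart x + imPart y + (y.ζ - x.ζ)) - ν * (y.ζ - x.ζ) / 2 *
        ((a - 1) * ((x.M + y.M) * (x.M' + y.M')) + a * β * ((x.P + y.P) * (x.P' + y.P'))) := by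
    simp only [pairing, Point.swap, imPart]
    linear_combination
      (1/2) * ((h1 + (y.ζ - x.ζ) / 2 * β * h2) * (x.P' + y.P')
        - (h2 - (y.ζ - x.ζ) / 2 * h1) * (x.M' + y.M')
        + (h3 - (y.ζ - x.ζ) / 2 * β * h4) * (x.P + y.P)
        - (h4 + (y.ζ - x.ζ) / 2 * h3) * (x.M + y.M)) + (2 * a - 1) * ν / 2 * h5
  simp only [normE, polDet, reDet] at *
  linear_combination (-1) * key + (1 + β * (y.ζ - x.ζ) ^ 2 / 4) * hA
    - ν * (y.ζ - x.ζ) / 2 * hI - ν * (y.ζ - x.ζ) / 2 * hIy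

end KirchhoffAlgebra

/-! ## The integrals and the Wronskians along an orbit -/

namespace KirchhoffAlgebra

variable {K : Type*} [Field K]

/-- The integral `I₀`. -/
def intI (a β ν : K) (x : Point K) : K := (2 * a - 1 + normE a β x) / reDet a β ν x

/-- The coefficient `σ` of the linear equation for the next `ζ`. -/
def sigma (a β ν : K) (x : Point K) : K :=
  reDet a β ν x + normH β x - imDet a ν * ν * intI a β ν x

/-- The common denominator of `intJ` and `tau`. -/
def denV (a β ν : K) (x : Point K) : K :=
  (1 - a * (a - 1) * ν ^ 2 - β * x.ζ ^ 2) * sigma a β ν x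
    - 2 * β * x.ζ * (ν * rePart x - x.ζ * normH β x)

/-- The integral `(I₀ + J₀) / (2 a - 1)`. -/
def intJ (a β ν : K) (x : Point K) : K :=
  2 * (1 - ν ^ 2 * intI a β ν x ^ 2 + normH β x - β * imPart x ^ 2) / denV a β ν x

/-- The ratio of `2 imPart` and the difference of the two neighbouring values of `ζ`. -/
def tau (a β ν : K) (x : Point K) : K :=
  (sigma a β ν x ^ 2 - 4 * β ^ 2 * x.ζ ^ 2 * imPart x ^ 2) / (2 * denV a β ν x)

/-- The third integral. -/
def intN (a β ν : K) (x : Point K) : K := tau a β ν x - intJ a β ν x * reDet a β ν x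

section swap
variable (a β ν : K) (x : Point K)
@[simp] theorem intI_swap : intI a β ν x.swap = intI a β ν x := by simp [intI]
@[simp] theorem sigma_swap : sigma a β ν x.swap = sigma a β ν x := by simp [sigma]
@[simp] theorem denV_swap : denV a β ν x.swap = denV a β ν x := by simp [denV]
@[simp] theorem intJ_swap : intJ a β ν x.swap = intJ a β ν x := by simp [intJ]
@[simp] theorem tau_swap : tau a β ν x.swap = tau a β ν x := by simp [tau]
end swap

/-- A point at which no denominator of the theory vanishes. -/
structure Regular (a β ν : K) (x : Point K) : Prop where
  β_ne : β ≠ 0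
  ν_ne : ν ≠ 0
  ζ_ne : x.ζ ≠ 0
  reDet_ne : reDet a β ν x ≠ 0
  add_ne : reDet a β ν x + imDet a ν ≠ 0
  sub_ne : reDet a β ν x - imDet a ν ≠ 0
  denV_ne : denV a β ν x ≠ 0
  sigma_add_ne : sigma a β ν x + 2 * β * x.ζ * imPart x ≠ 0
  sigma_sub_ne : sigma a β ν x - 2 * β * x.ζ * imPart x ≠ 0

variable {a β ν : K} {x y w : Point K}

theorem Regular.swap (h : Regular a β ν x) : Regular a β ν x.swap where
  β_ne := h.β_ne
  ν_ne := h.ν_ne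
  ζ_ne := h.ζ_ne
  reDet_ne := by simpa using h.reDet_ne
  add_ne := by simpa using h.add_ne
  sub_ne := by simpa using h.sub_ne
  denV_ne := by simpa using h.denV_ne
  sigma_add_ne := by simpa [← sub_eq_add_neg] using h.sigma_sub_ne
  sigma_sub_ne := by simpa using h.sigma_add_ne

theorem Regular.intI_mul (h : Regular a β ν x) :
    intI a β ν x * reDet a β ν x = 2 * a - 1 + normE a β x := by
  rw [intI, div_mul_cancel₀ _ h.reDet_ne]

theorem Regular.sq_sub_ne (hx : Regular a β ν x) :
    reDet a β ν x ^ 2 - imDet a ν ^ 2 ≠ 0 := by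
  have := mul_ne_zero hx.add_ne hx.sub_ne
  contrapose! this
  linear_combination this

theorem Step.pairing_add_eq (s : Step a β ν x y) (hx : Regular a β ν x) :
    pairing x y + pairing x.swap y.swap = -2 * ν * (y.ζ - x.ζ) * intI a β ν x := by
  have := s.pairing_add
  rw [intI]
  have h0 := hx.reDet_ne
  field_simp
  linear_combination this

/-! ### Conservation of I, J and N. -/

variable [CharZero K]

/-- The sum of the pairings is the increment of ζ times a multiple of I at x; by reversal it is the
same multiple of I at y. -/
theorem Step.intI_eq (s : Step a β ν x y) (hx : Regular a β ν x) (hy : Regular a β ν y)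
    (hne : y.ζ ≠ x.ζ) : intI a β ν y = intI a β ν x := by
  have h1 := s.pairing_add_eq hx
  have h2 := s.reverse.pairing_add_eq hy.swap
  have e1 : pairing y.swap x.swap = -pairing x y := pairing_swap_swap x y
  have e2 : pairing y.swap.swap x.swap.swap = -pairing x.swap y.swap :=
    pairing_swap_swap x.swap y.swap
  rw [e1, e2, intI_swap, Point.swap_ζ, Point.swap_ζ] at h2
  have h3 : (2 * ν * (y.ζ - x.ζ)) * intI a β ν y = (2 * ν * (y.ζ - x.ζ)) * intI a β ν x := by
    linear_combination -h1 - h2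
  exact mul_left_cancel₀ (mul_ne_zero (mul_ne_zero two_ne_zero hx.ν_ne) (sub_ne_zero.mpr hne)) h3

theorem Step.linear_sigma (s : Step a β ν x y) (hx : Regular a β ν x) :
    (y.ζ - x.ζ) * (sigma a β ν x + 2 * β * x.ζ * imPart x)
      = 2 * (ν * rePart x - x.ζ * normH β x
        + imPart x * (1 - a * (a - 1) * ν ^ 2 - β * x.ζ ^ 2)) :=
  s.linear_ζ (s.pairing_add_eq hx)

/-- `polDet` is affine in the increment of ζ, and the linear equation for the latter cancels the
terms odd under `swap`. What remains, `denV`, depends on x alone and is even. -/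
theorem Step.polDet_mul (s : Step a β ν x y) (hx : Regular a β ν x) :
    polDet a β ν x y * (sigma a β ν x + 2 * β * x.ζ * imPart x) = denV a β ν x := by
  rw [polDet, denV]
  linear_combination (-β * x.ζ) * s.linear_sigma hx

theorem Step.polDet_ne (s : Step a β ν x y) (hx : Regular a β ν x) : polDet a β ν x y ≠ 0 :=
  left_ne_zero_of_mul (s.polDet_mul hx ▸ hx.denV_ne)

/-- The numerator of `tau` is a difference of squares, one factor of which cancels against `denV`.
The mirror image keeps the other factor, so two consecutive steps can be compared at their common
point. -/
theorem Step.tau_mul (s : Step a β ν x y) (hx : Regular a β ν x) :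
    2 * polDet a β ν x y * tau a β ν x = sigma a β ν x - 2 * β * x.ζ * imPart x := by
  have h0 := s.polDet_ne hx
  have h1 := hx.sigma_add_ne
  rw [tau, ← s.polDet_mul hx]
  field_simp
  ring

theorem Step.tau_mul_left (s : Step a β ν x y) (hy : Regular a β ν y) :
    2 * polDet a β ν x y * tau a β ν y = sigma a β ν y + 2 * β * y.ζ * imPart y := by
  have := s.reverse.tau_mul hy.swap
  simpa [polDet_comm a β ν y x] using this

theorem Step.intJ_mul (s : Step a β ν x y) (hx : Regular a β ν x) :
    intJ a β ν x * polDet a β ν x y * (sigma a β ν x + 2 * β * x.ζ * imPart x)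
      = 2 * (1 - ν ^ 2 * intI a β ν x ^ 2 + normH β x - β * imPart x ^ 2) := by
  rw [mul_assoc, s.polDet_mul hx, intJ, div_mul_cancel₀ _ hx.denV_ne]

theorem Step.intJ_mul_polDet_aux (s : Step a β ν x y) (hx : Regular a β ν x) :
    polDet a β ν x y * (2 * reDet a β ν x - 2 * intI a β ν x * ν * imDet a ν
          - 2 * β * (x.ζ + y.ζ) * imPart x)
        + (sigma a β ν x - 2 * β * x.ζ * imPart x)
          * (4 * a * (a - 1) * ν ^ 2 + β * (x.ζ + y.ζ) ^ 2) / 2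
      = (reDet a β ν x ^ 2 - imDet a ν ^ 2) * intJ a β ν x * polDet a β ν x y := by
  have h1 := reDet_sq_sub_identity hx.intI_mul (s.linear_sigma hx)
  have h2 := s.intJ_mul hx
  apply mul_right_cancel₀ hx.sigma_add_ne
  rw [polDet, ← sigma] at *
  linear_combination h1 - (reDet a β ν x ^ 2 - imDet a ν ^ 2) * h2

/-- The bilinear form of the second integral. -/
theorem Step.imPart_add_eq (s : Step a β ν x y) (hx : Regular a β ν x) :
    imPart x + imPart y + (y.ζ - x.ζ)
      = intJ a β ν x * (y.ζ - x.ζ) * polDet a β ν x y := by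
  have h1 := s.imPart_add hx.intI_mul (s.linear_sigma hx)
  have h2 := s.intJ_mul_polDet_aux hx
  apply mul_right_cancel₀ hx.sq_sub_ne
  rw [← sigma] at h1
  linear_combination h1 + (y.ζ - x.ζ) * h2

/-- Writing σ - 2βζT as 2 `polDet` `tau` makes `polDet` a common factor of `intJ_mul_polDet_aux`,
which is then cancelled. -/
theorem Step.intJ_linear (s : Step a β ν x y) (hx : Regular a β ν x) :
    2 * reDet a β ν x - 2 * intI a β ν x * ν * imDet a ν - 2 * β * (x.ζ + y.ζ) * imPart x
        + tau a β ν x * (4 * a * (a - 1) * ν ^ 2 + β * (x.ζ + y.ζ) ^ 2)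
      = (reDet a β ν x ^ 2 - imDet a ν ^ 2) * intJ a β ν x := by
  have h1 := s.intJ_mul_polDet_aux hx
  have h2 := s.tau_mul hx
  apply mul_right_cancel₀ (s.polDet_ne hx)
  linear_combination h1 + (4 * a * (a - 1) * ν ^ 2 + β * (x.ζ + y.ζ) ^ 2) / 2 * h2

/-- Under reversal both sides of `imPart_add_eq` change sign, `polDet` being symmetric, so the same
number is obtained with J taken at y. -/
theorem Step.intJ_eq (s : Step a β ν x y) (hx : Regular a β ν x) (hy : Regular a β ν y)
    (hne : y.ζ ≠ x.ζ) : intJ a β ν y = intJ a β ν x := by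
  have h1 := s.imPart_add_eq hx
  have h2 := s.reverse.imPart_add_eq hy.swap
  simp only [imPart_swap, intJ_swap, Point.swap_ζ, polDet_swap, polDet_comm a β ν y x] at h2
  have h3 : intJ a β ν y * ((y.ζ - x.ζ) * polDet a β ν x y)
      = intJ a β ν x * ((y.ζ - x.ζ) * polDet a β ν x y) := by
    linear_combination h1 + h2
  exact mul_right_cancel₀ (mul_ne_zero (sub_ne_zero.mpr hne) (s.polDet_ne hx)) h3

/-- The difference of `tau_mul` and its mirror image contains the change of `normH`. By `normH_sub`
it collapses to β (x.ζ + y.ζ) times the left side of `imPart_add_eq`. -/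
theorem Step.tau_sub (s : Step a β ν x y) (hx : Regular a β ν x) (hy : Regular a β ν y)
    (hne : y.ζ ≠ x.ζ) :
    tau a β ν y - tau a β ν x = intJ a β ν x * (reDet a β ν y - reDet a β ν x) := by
  have h1 := s.tau_mul hx
  have h2 := s.tau_mul_left hy
  have h3 := s.normH_sub
  have h4 := s.imPart_add_eq hx
  have h5 := s.intI_eq hx hy hne
  simp only [sigma, h5] at h1 h2
  apply mul_left_cancel₀ (s.polDet_ne hx)
  simp only [reDet] at *
  linear_combination h2 / 2 - h1 / 2 - h3 / 2 + β * (x.ζ + y.ζ) * h4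

theorem Step.intN_eq (s : Step a β ν x y) (hx : Regular a β ν x) (hy : Regular a β ν y)
    (hne : y.ζ ≠ x.ζ) : intN a β ν y = intN a β ν x := by
  have h1 := s.tau_sub hx hy hne
  rw [intN, intN, s.intJ_eq hx hy hne]
  linear_combination h1

/-- Both `bilinear` and `imPart_add_eq` evaluate the same sum of `imPart` values. Equating them
identifies J₀ with (2a - 1) J - I, as `polDet` is the denominator of J₀. -/
theorem Step.bilinear_eq (s : Step a β ν x y) (hx : Regular a β ν x) (hy : Regular a β ν y)
    (hne : y.ζ ≠ x.ζ) :
    2 * a - 1 - (a - 1) * ((x.M * y.M' + x.M' * y.M) / 2)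
        - a * β * ((x.P * y.P' + x.P' * y.P) / 2)
      = ((2 * a - 1) * intJ a β ν x - intI a β ν x) * polDet a β ν x y := by
  have h1 := s.bilinear (s.pairing_add_eq hx) hx.intI_mul
    (by rw [← s.intI_eq hx hy hne]; exact hy.intI_mul)
  have h2 := s.imPart_add_eq hx
  apply mul_left_cancel₀ (mul_ne_zero hx.ν_ne (sub_ne_zero.mpr hne))
  linear_combination h1 + ν * (2 * a - 1) * h2

theorem Step.pairing_eq (s : Step a β ν x y) (hx : Regular a β ν x) :
    pairing x y = (y.ζ - x.ζ) * (1 - ν * intI a β ν x) := by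
  linear_combination (1/2) * s.pairing_add_eq hx + (1/2) * s.pairing_sub

theorem Step.pairing_swap_eq (s : Step a β ν x y) (hx : Regular a β ν x) :
    pairing x.swap y.swap = -(y.ζ - x.ζ) * (1 + ν * intI a β ν x) := by
  linear_combination (1/2) * s.pairing_add_eq hx - (1/2) * s.pairing_sub

/-! ### Pairings of points two and three steps apart. -/

/-- The difference of the two neighbours of `ζ`. -/
theorem Step.sub_mul_tau (s : Step a β ν x y) (t : Step a β ν y w) (hy : Regular a β ν y) :
    (w.ζ - x.ζ) * tau a β ν y = 2 * imPart y := by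
  have h1 := s.tau_mul_left hy
  have h2 := t.tau_mul hy
  apply mul_left_cancel₀ (mul_ne_zero (mul_ne_zero two_ne_zero hy.β_ne) hy.ζ_ne)
  simp only [polDet] at h1 h2
  linear_combination h1 - h2

/-- The order two analogue of `pairing_eq`. Both x and w are expressed through the middle point y;
`sub_mul_tau` turns `imPart y` into a multiple of w.ζ - x.ζ, which thus becomes a common factor. -/
theorem Step.pairing_two (s : Step a β ν x y) (t : Step a β ν y w) (hy : Regular a β ν y) :
    pairing x w = (w.ζ - x.ζ) *
      (-(1 + intN a β ν y) + ν * intI a β ν y - imDet a ν * intJ a β ν y) := by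
  have h1 := s.sub_mul_tau t hy
  have h2 := t.intJ_linear hy
  have h3 := t.tau_mul hy
  have h4 := hy.intI_mul
  apply mul_left_cancel₀ hy.add_ne
  have key : (reDet a β ν y + imDet a ν) * pairing x w
      = 2 * imPart y * (1 + a * (a - 1) * ν ^ 2 - imDet a ν + β * (x.ζ * w.ζ))
        - (w.ζ - x.ζ) * (normH β y - ν * normE a β y) := by
    obtain ⟨-, -, s3, s4, -⟩ := s
    obtain ⟨t1, t2, -, -, -⟩ := t
    simp only [reDet, imDet, pairing, imPart, normH, normE]
    linear_combination
      t1 * ((1 + a * ν) * x.P' - y.ζ * x.M') - t2 * ((1 + (a - 1) * ν) * x.M' + β * y.ζ * x.P')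
      - ((1 - (a - 1) * ν) * y.M - β * w.ζ * y.P) * s4
      + ((1 - a * ν) * y.P + w.ζ * y.M) * s3
  rw [key]
  simp only [sigma, intN] at *
  simp only [reDet, polDet, imDet] at *
  linear_combination
    (-(1 + a * (a - 1) * ν ^ 2 - (2 * a - 1) * ν + β * (x.ζ * w.ζ)) - (w.ζ - x.ζ) * β * w.ζ) * h1
    + (w.ζ - x.ζ) * h2 + (w.ζ - x.ζ) * h3 - (w.ζ - x.ζ) * ν * h4

/-- The squared modulus of a second order Wronskian constant minus that of a first order one. -/
def denW (a β ν : K) (x : Point K) : K :=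
  intN a β ν x ^ 2 + 2 * intN a β ν x - intJ a β ν x ^ 2 * imDet a ν ^ 2
    + 2 * imDet a ν * ν * intI a β ν x * intJ a β ν x

/-- The (numerator of the) complex constant of the third order Wronskians. -/
def numW (a β ν : K) (x : Point K) : K :=
  let θ := 1 - ν * intI a β ν x
  let ψ := -(1 + intN a β ν x) + ν * intI a β ν x - imDet a ν * intJ a β ν x
  ψ ^ 2 * (1 + ν * intI a β ν x) + θ ^ 3
    + θ * ψ * (2 - 4 * intJ a β ν x - 2 * intN a β ν x)

/-- The squared modulus of the `SL₂`-pairing of two consecutive points. -/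
def crossNorm (x y : Point K) : K :=
  (y.M * x.P - y.P * x.M) * (y.M' * x.P' - y.P' * x.M')

/-- The Gram determinant of x, y for `pairing`: its diagonal entries are 2 `imPart`, and the pairing
of the swapped points is minus the pairing of y with x. -/
theorem crossNorm_eq (x y : Point K) :
    crossNorm x y = 4 * imPart x * imPart y + pairing x y * pairing x.swap y.swap := by
  simp only [crossNorm, imPart, pairing, Point.swap]; ring

theorem Regular.tau_ne (hx : Regular a β ν x) : tau a β ν x ≠ 0 := by
  have := mul_ne_zero hx.sigma_add_ne hx.sigma_sub_ne
  refine div_ne_zero ?_ (mul_ne_zero two_ne_zero hx.denV_ne)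
  contrapose! this
  linear_combination this

/-- The constant of order one read at the final point, so that no regularity of the initial point is
required. -/
theorem Step.pairing_eq_left (s : Step a β ν x y) (hy : Regular a β ν y) :
    pairing x y = (y.ζ - x.ζ) * (1 - ν * intI a β ν y) := by
  have := s.reverse.pairing_eq hy.swap
  rw [pairing_swap_swap] at this
  simp at this
  linear_combination -this

theorem Step.denW_link (s : Step a β ν x y) (hx : Regular a β ν x) (hy : Regular a β ν y)
    (hne : y.ζ ≠ x.ζ) :
    2 * imPart x * tau a β ν y + 2 * imPart y * tau a β ν x
      = (y.ζ - x.ζ) * (tau a β ν x * tau a β ν y - denW a β ν x) := by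
  have h1 := s.tau_sub hx hy hne
  have h2 := s.imPart_add_eq hx
  have h3 := s.intJ_linear hx
  rw [denW, intN]
  simp only [reDet, polDet] at *
  linear_combination (2 * imPart x - (y.ζ - x.ζ) * tau a β ν x) * h1 + 2 * tau a β ν x * h2
    - (y.ζ - x.ζ) * intJ a β ν x * h3

/-- The relation expressing that `v` is a vector rather than a general hermitian form. -/
theorem Step.rank_relation (s : Step a β ν x y) (hx : Regular a β ν x) (hy : Regular a β ν y)
    (hne : y.ζ ≠ x.ζ) :
    4 * β * intJ a β ν x * imPart x * imPart y
      = 2 * (intJ a β ν x * polDet a β ν x y - 1) * (tau a β ν x * tau a β ν y - denW a β ν x)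
        - 4 * (intJ a β ν x * (1 - ν ^ 2 * intI a β ν x ^ 2 + imDet a ν * ν * intI a β ν x)
          + intN a β ν x) := by
  have h1 := s.tau_sub hx hy hne
  have h2 := s.imPart_add_eq hx
  have h3 := s.intJ_linear hx
  have h4 := s.intJ_mul hx
  have h5 := s.tau_mul hx
  rw [denW, intN]
  simp only [reDet, polDet, sigma] at *
  linear_combination (4 * β * intJ a β ν x * imPart x) * h2
    - 2 * (intJ a β ν x * (1 - a * (a - 1) * ν ^ 2 - β * (x.ζ * y.ζ)) - 1) * tau a β ν x * h1
    - 2 * (intJ a β ν x * (1 - a * (a - 1) * ν ^ 2 - β * (x.ζ * y.ζ)) - 1) * intJ a β ν x * h3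
    - 2 * intJ a β ν x * (h4
      + (intJ a β ν x * (1 - a * (a - 1) * ν ^ 2 - β * (x.ζ * y.ζ)) - 2) * h5)

/-- ζ₃ - ζ₀ is (ζ₃ - ζ₁) + (ζ₂ - ζ₀) - (ζ₂ - ζ₁). Multiplied by τ₁τ₂, the first two differences
become `imPart` terms, which `denW_link` evaluates. -/
theorem ζ_three {x₀ x₁ x₂ x₃ : Point K} (s₀ : Step a β ν x₀ x₁) (s₁ : Step a β ν x₁ x₂)
    (s₂ : Step a β ν x₂ x₃) (h₁ : Regular a β ν x₁) (h₂ : Regular a β ν x₂)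
    (hne : x₂.ζ ≠ x₁.ζ) :
    (x₃.ζ - x₀.ζ) * (tau a β ν x₁ * tau a β ν x₂) = -(x₂.ζ - x₁.ζ) * denW a β ν x₁ := by
  linear_combination tau a β ν x₂ * s₀.sub_mul_tau s₁ h₁ + tau a β ν x₁ * s₁.sub_mul_tau s₂ h₂
    + s₁.denW_link h₁ h₂ hne

/-- Where the Gram determinant of x₁, x₂ is non-zero, `pairing x₀ x₃` is determined by pairings of
orders zero, one and two. Orders one and two have the constants θ = 1 - νI and ψ; order zero is
`imPart`. The relations between the two middle points reduce the result to a multiple of the Gram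
determinant. -/
theorem pairing_three {x₀ x₁ x₂ x₃ : Point K} (s₀ : Step a β ν x₀ x₁) (s₁ : Step a β ν x₁ x₂)
    (s₂ : Step a β ν x₂ x₃) (h₁ : Regular a β ν x₁) (h₂ : Regular a β ν x₂)
    (hne : x₂.ζ ≠ x₁.ζ) (hγ : crossNorm x₁ x₂ ≠ 0) :
    pairing x₀ x₃ * denW a β ν x₁ = (x₃.ζ - x₀.ζ) * numW a β ν x₁ := by
  have eI := s₁.intI_eq h₁ h₂ hne
  have eJ := s₁.intJ_eq h₁ h₂ hne
  have eN := s₁.intN_eq h₁ h₂ hne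
  have p10 := s₀.pairing_eq_left h₁
  have p21 := s₁.pairing_eq h₁
  have p12 := s₁.pairing_swap_eq h₁
  have p32 := s₂.pairing_eq h₂
  have p20 := s₀.pairing_two s₁ h₁
  have p31 := s₁.pairing_two s₂ h₂
  have z1 := s₀.sub_mul_tau s₁ h₁
  have z2 := s₁.sub_mul_tau s₂ h₂
  have r1 := s₁.denW_link h₁ h₂ hne
  have r2 := s₁.rank_relation h₁ h₂ hne
  have r3 := s₁.imPart_add_eq h₁
  have t1 := h₁.tau_ne
  have t2 := h₂.tau_ne
  -- Accounts for the last factor of `numW`: τ₁ + τ₂ - 2N is J times the sum of the two values of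
  -- `reDet`, and together with 2 `polDet` these leave only the square of ζ₂ - ζ₁.
  have hτ : tau a β ν x₁ + tau a β ν x₂ + 2 * (intJ a β ν x₁ * polDet a β ν x₁ x₂ - 1)
      + (2 - 4 * intJ a β ν x₁ - 2 * intN a β ν x₁)
      = intJ a β ν x₁ * β * (x₂.ζ - x₁.ζ) ^ 2 := by
    have h1 := s₁.tau_sub h₁ h₂ hne
    rw [intN]; simp only [reDet, polDet] at *
    linear_combination h1
  have hg := crossNorm_eq x₁ x₂
  rw [p21, p12] at hg
  -- The expansion of x₀ and x₃ in the basis x₁, x₂, with the inverse Gram matrix cleared of its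
  -- denominator.
  have plucker : pairing x₀ x₃ * crossNorm x₁ x₂
      = 2 * imPart x₁ * pairing x₂ x₃ * pairing x₀ x₂
        - pairing x₂ x₃ * pairing x₀ x₁ * pairing x₁ x₂
        + pairing x₁ x₃ * pairing x₀ x₂ * pairing x₁.swap x₂.swap
        + 2 * imPart x₂ * pairing x₁ x₃ * pairing x₀ x₁ := by
    simp only [pairing, crossNorm, imPart, Point.swap]; ring
  have z30 := ζ_three s₀ s₁ s₂ h₁ h₂ hne
  have a3 : (x₃.ζ - x₂.ζ) * tau a β ν x₂ = 2 * imPart x₂ - (x₂.ζ - x₁.ζ) * tau a β ν x₂ := by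
    linear_combination z2
  have a0 : (x₁.ζ - x₀.ζ) * tau a β ν x₁ = 2 * imPart x₁ - (x₂.ζ - x₁.ζ) * tau a β ν x₁ := by
    linear_combination z1
  rw [p10, p32, p21, p20, p31, p12, eI, eJ, eN] at plucker
  have den_eq : denW a β ν x₁ = (1 + intN a β ν x₁) ^ 2
      - (ν * intI a β ν x₁ - imDet a ν * intJ a β ν x₁) ^ 2 - 1 + ν ^ 2 * intI a β ν x₁ ^ 2 := by
    rw [denW]; ring
  rw [numW]
  generalize intI a β ν x₁ = I at *
  generalize intJ a β ν x₁ = J at *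
  generalize intN a β ν x₁ = N at *
  generalize denW a β ν x₁ = W at *
  generalize tau a β ν x₁ = τ₁ at *
  generalize tau a β ν x₂ = τ₂ at *
  generalize polDet a β ν x₁ x₂ = C at *
  generalize imPart x₁ = T₁ at *
  generalize imPart x₂ = T₂ at *
  generalize imDet a ν = κ at *
  generalize crossNorm x₁ x₂ = G at *
  generalize pairing x₀ x₃ = Ω at *
  have main : Ω * G * (τ₁ * τ₂) = -(x₂.ζ - x₁.ζ) * ((-(1 + N) + ν * I - κ * J) ^ 2 * (1 + ν * I)
      + (1 - ν * I) ^ 3 + (1 - ν * I) * (-(1 + N) + ν * I - κ * J) * (2 - 4 * J - 2 * N)) * G := by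
    generalize hψ : -(1 + N) + ν * I - κ * J = ψ at *
    generalize hθ : 1 - ν * I = θ at *
    generalize hθ' : 1 + ν * I = θ' at *
    generalize hy : x₂.ζ - x₁.ζ = y at *
    -- Each increment of ζ other than the middle one y absorbs the factor τ of its middle point and
    -- becomes 2T or 2T - yτ.
    have e1 : Ω * G * (τ₁ * τ₂) = θ * ψ * ((2 * T₁) ^ 2 * (2 * T₂ - y * τ₂)
        + (2 * T₂) ^ 2 * (2 * T₁ - y * τ₁)) - y * θ ^ 3 * ((2 * T₂ - y * τ₂) * (2 * T₁ - y * τ₁))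
        - y * θ' * ψ ^ 2 * (4 * T₁ * T₂) := by
      linear_combination τ₁ * τ₂ * plucker
        + 2 * T₁ * θ * ψ * ((x₂.ζ - x₀.ζ) * τ₁ * a3 + (2 * T₂ - y * τ₂) * z1)
        - y * θ ^ 3 * ((x₁.ζ - x₀.ζ) * τ₁ * a3 + (2 * T₂ - y * τ₂) * a0)
        - y * θ' * ψ ^ 2 * ((x₂.ζ - x₀.ζ) * τ₁ * z2 + 2 * T₂ * z1)
        + 2 * T₂ * θ * ψ * ((x₁.ζ - x₀.ζ) * τ₁ * z2 + 2 * T₂ * a0)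
    rw [e1, hg]
    subst hψ hθ hθ'
    linear_combination (-y * (1 - ν * I) * (-(1 + N) + ν * I - κ * J) * (2 * T₁ + 2 * T₂)
        + y ^ 2 * (1 - ν * I) ^ 3) * r1
      + (8 * T₁ * T₂ - 2 * y ^ 2 * (τ₁ * τ₂ - W)) * (1 - ν * I) * (-(1 + N) + ν * I - κ * J) * r3
      + y * (1 - ν * I) * (-(1 + N) + ν * I - κ * J) * (4 * T₁ * T₂) * hτ
      + y ^ 3 * (1 - ν * I) * (-(1 + N) + ν * I - κ * J) * r2
      - y ^ 3 * (1 - ν * I) ^ 3 * den_eq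
  apply mul_right_cancel₀ (mul_ne_zero hγ (mul_ne_zero t1 t2))
  linear_combination W * main - ((-(1 + N) + ν * I - κ * J) ^ 2 * (1 + ν * I)
      + (1 - ν * I) ^ 3 + (1 - ν * I) * (-(1 + N) + ν * I - κ * J) * (2 - 4 * J - 2 * N)) * G * z30

end KirchhoffAlgebra

/-! ## Generic properties and rational functions -/

namespace Kirchhoff

open MvPolynomial Filter Topology

theorem Generically.mono {P Q : KState → Prop} (h : Generically P) (hPQ : ∀ x, P x → Q x) :
    Generically Q := by
  obtain ⟨q, hq, h⟩ := h
  exact ⟨q, hq, fun x hx => hPQ x (h x hx)⟩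

theorem Generically.and {P Q : KState → Prop} (hP : Generically P) (hQ : Generically Q) :
    Generically fun x => P x ∧ Q x := by
  obtain ⟨q, hq, hP⟩ := hP
  obtain ⟨r, hr, hQ⟩ := hQ
  refine ⟨q * r, mul_ne_zero hq hr, fun x hx => ?_⟩
  rw [map_mul] at hx
  exact ⟨hP x (left_ne_zero_of_mul hx), hQ x (right_ne_zero_of_mul hx)⟩

theorem isOpen_eval_ne (q : MvPolynomial (Fin 6) ℝ) : IsOpen {x : KState | eval x q ≠ 0} :=
  isOpen_ne_fun (MvPolynomial.continuous_eval q) continuous_const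

/-- A ball in the sup norm is a product of infinite sets, so a polynomial that vanishes on it is
zero. -/
theorem dense_eval_ne {q : MvPolynomial (Fin 6) ℝ} (hq : q ≠ 0) :
    Dense {x : KState | eval x q ≠ 0} := by
  have hcompl : {x : KState | eval x q ≠ 0} = {x : KState | eval x q = 0}ᶜ := rfl
  rw [hcompl, ← interior_eq_empty_iff_dense_compl]
  by_contra hne
  obtain ⟨x, hx⟩ := Set.nonempty_iff_ne_empty.mpr hne
  rw [mem_interior_iff_mem_nhds, Metric.mem_nhds_iff] at hx
  obtain ⟨r, hr, hball⟩ := hx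
  apply hq
  refine funext_set (fun i => Metric.ball (x i) r) (fun i => ?_) fun y hy => ?_
  · rw [Real.ball_eq_Ioo]
    exact Set.Ioo_infinite (by linarith)
  · rw [map_zero]
    apply hball
    rw [ball_pi _ hr]
    exact hy

theorem Generically.dense {P : KState → Prop} (h : Generically P) : Dense {x | P x} := by
  obtain ⟨q, hq, h⟩ := h
  exact (dense_eval_ne hq).mono h

/-- Baire's theorem for countably many dense open sets. -/
theorem dense_forall_of_generically {ι : Type*} [Countable ι] {P : ι → KState → Prop}
    (h : ∀ i, Generically (P i)) : Dense {x | ∀ i, P i x} := by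
  choose q hq h using h
  refine (dense_iInter_of_isOpen (fun i => isOpen_eval_ne (q i))
    (fun i => dense_eval_ne (hq i))).mono fun x hx i => h i x ?_
  exact Set.mem_iInter.mp hx i

/-- Functions that agree on a dense set agree wherever they are both continuous. -/
theorem eq_of_dense {s : Set KState} (hs : Dense s) {f g : KState → ℝ} {x : KState}
    (hf : ContinuousAt f x) (hg : ContinuousAt g x) (h : ∀ y ∈ s, f y = g y) : f x = g x := by
  have : (𝓝[s] x).NeBot := mem_closure_iff_nhdsWithin_neBot.mp (hs x)
  refine tendsto_nhds_unique_of_eventuallyEq (l := 𝓝[s] x) (hf.mono_left nhdsWithin_le_nhds)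
    (hg.mono_left nhdsWithin_le_nhds) ?_
  filter_upwards [self_mem_nhdsWithin] with y hy using h y hy

theorem eq_of_generically {f g : KState → ℝ} {x : KState} (hf : ContinuousAt f x)
    (hg : ContinuousAt g x) (h : Generically fun y => f y = g y) : f x = g x :=
  eq_of_dense h.dense hf hg fun _ hy => hy

/-- A function that coincides generically with a quotient of two polynomials. -/
def IsGenRat (f : KState → ℝ) : Prop :=
  ∃ N D : MvPolynomial (Fin 6) ℝ, D ≠ 0 ∧ ∀ x, eval x D ≠ 0 → f x = eval x N / eval x D

namespace IsGenRat

variable {f g : KState → ℝ}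

theorem of_eval (N : MvPolynomial (Fin 6) ℝ) : IsGenRat fun x => eval x N :=
  ⟨N, 1, one_ne_zero, fun x _ => by simp⟩

theorem const (c : ℝ) : IsGenRat fun _ => c := by
  simpa using of_eval (C c)

theorem coord (i : Fin 6) : IsGenRat fun x => x i := by
  simpa using of_eval (X i)

theorem add (hf : IsGenRat f) (hg : IsGenRat g) : IsGenRat fun x => f x + g x := by
  obtain ⟨N, D, hD, h⟩ := hf
  obtain ⟨N', D', hD', h'⟩ := hg
  refine ⟨N * D' + D * N', D * D', mul_ne_zero hD hD', fun x hx => ?_⟩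
  rw [map_mul] at hx
  beta_reduce
  rw [h x (left_ne_zero_of_mul hx), h' x (right_ne_zero_of_mul hx),
    div_add_div _ _ (left_ne_zero_of_mul hx) (right_ne_zero_of_mul hx)]
  simp

theorem mul (hf : IsGenRat f) (hg : IsGenRat g) : IsGenRat fun x => f x * g x := by
  obtain ⟨N, D, hD, h⟩ := hf
  obtain ⟨N', D', hD', h'⟩ := hg
  refine ⟨N * N', D * D', mul_ne_zero hD hD', fun x hx => ?_⟩
  rw [map_mul] at hx
  beta_reduce
  rw [h x (left_ne_zero_of_mul hx), h' x (right_ne_zero_of_mul hx), div_mul_div_comm]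
  simp

theorem neg (hf : IsGenRat f) : IsGenRat fun x => -f x := by
  simpa using (const (-1)).mul hf

theorem sub (hf : IsGenRat f) (hg : IsGenRat g) : IsGenRat fun x => f x - g x := by
  simpa [sub_eq_add_neg] using hf.add hg.neg

theorem inv (hf : IsGenRat f) : IsGenRat fun x => (f x)⁻¹ := by
  obtain ⟨N, D, hD, h⟩ := hf
  by_cases hN : N = 0
  · subst hN
    exact ⟨0, D, hD, fun x hx => by simp [h x hx]⟩
  -- D stays in the denominator because f is only known to be N / D where D does not vanish.
  · refine ⟨D ^ 2, N * D, mul_ne_zero hN hD, fun x hx => ?_⟩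
    rw [map_mul] at hx
    have h1 := left_ne_zero_of_mul hx
    have h2 := right_ne_zero_of_mul hx
    beta_reduce
    rw [h x h2, map_pow, map_mul]
    field_simp

theorem div (hf : IsGenRat f) (hg : IsGenRat g) : IsGenRat fun x => f x / g x := by
  simpa [div_eq_mul_inv] using hf.mul hg.inv

theorem pow (hf : IsGenRat f) (n : ℕ) : IsGenRat fun x => f x ^ n := by
  induction n with
  | zero => simpa using const 1
  | succ n ih => simpa [pow_succ] using ih.mul hf

theorem sum {ι : Type*} (s : Finset ι) {f : ι → KState → ℝ} (h : ∀ i, IsGenRat (f i)) :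
    IsGenRat fun x => ∑ i ∈ s, f i x := by
  classical
  induction s using Finset.induction_on with
  | empty => simpa using const 0
  | insert a s ha ih => simpa [Finset.sum_insert ha] using (h a).add ih

theorem prod {ι : Type*} (s : Finset ι) {f : ι → KState → ℝ} (h : ∀ i, IsGenRat (f i)) :
    IsGenRat fun x => ∏ i ∈ s, f i x := by
  classical
  induction s using Finset.induction_on with
  | empty => simpa using const 1
  | insert a s ha ih => simpa [Finset.prod_insert ha] using (h a).mul ih

theorem det {n : Type*} [Fintype n] [DecidableEq n] {A : KState → Matrix n n ℝ}
    (h : ∀ i j, IsGenRat fun x => A x i j) : IsGenRat fun x => (A x).det := by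
  simp only [Matrix.det_apply']
  exact sum _ fun σ => (const _).mul (prod _ fun i => h _ _)

theorem congr (hf : IsGenRat f) (h : Generically fun x => g x = f x) : IsGenRat g := by
  obtain ⟨N, D, hD, hf⟩ := hf
  obtain ⟨q, hq, h⟩ := h
  -- The factor q confines the claimed formula to the set where f and g are known to agree.
  refine ⟨N * q, D * q, mul_ne_zero hD hq, fun x hx => ?_⟩
  rw [map_mul] at hx
  rw [h x (right_ne_zero_of_mul hx), hf x (left_ne_zero_of_mul hx), map_mul, map_mul,
    mul_div_mul_right _ _ (right_ne_zero_of_mul hx)]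

/-- A rational function that does not vanish at some point of continuity does not vanish
generically. -/
theorem generically_ne (hf : IsGenRat f) {x : KState} (hc : ContinuousAt f x) (hx : f x ≠ 0) :
    Generically fun x => f x ≠ 0 := by
  obtain ⟨N, D, hD, h⟩ := hf
  have hN : N ≠ 0 := by
    rintro rfl
    exact hx (eq_of_generically hc continuousAt_const ⟨D, hD, fun y hy => by simp [h y hy]⟩)
  refine ⟨N * D, mul_ne_zero hN hD, fun y hy => ?_⟩
  rw [map_mul] at hy
  rw [h y (right_ne_zero_of_mul hy)]
  exact div_ne_zero (left_ne_zero_of_mul hy) (right_ne_zero_of_mul hy)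

/-- The numerator either is the zero polynomial or supplies the exceptional set. No continuity is
needed, which makes the dichotomy suitable for proofs by contradiction. -/
theorem generically_eq_zero_or_ne (hf : IsGenRat f) :
    (Generically fun x => f x = 0) ∨ Generically fun x => f x ≠ 0 := by
  obtain ⟨N, D, hD, h⟩ := hf
  by_cases hN : N = 0
  · subst hN
    exact Or.inl ⟨D, hD, fun y hy => by simp [h y hy]⟩
  · refine Or.inr ⟨N * D, mul_ne_zero hN hD, fun y hy => ?_⟩
    rw [map_mul] at hy
    rw [h y (right_ne_zero_of_mul hy)]
    exact div_ne_zero (left_ne_zero_of_mul hy) (right_ne_zero_of_mul hy)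

theorem eval_comp {Φ : KState → KState} (hΦ : ∀ i, IsGenRat fun x => Φ x i)
    (N : MvPolynomial (Fin 6) ℝ) : IsGenRat fun x => eval (Φ x) N := by
  induction N using MvPolynomial.induction_on with
  | C a => simpa using const a
  | add p q hp hq => simpa using hp.add hq
  | mul_X p i hp => simpa using hp.mul (hΦ i)

/-- The hypothesis `hgen` is dominance of Φ: it prevents a non-zero denominator from vanishing
identically after the substitution. -/
theorem comp (hf : IsGenRat f) {Φ : KState → KState} (hΦ : ∀ i, IsGenRat fun x => Φ x i)
    (hgen : ∀ P : KState → Prop, Generically P → Generically fun x => P (Φ x)) :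
    IsGenRat fun x => f (Φ x) := by
  obtain ⟨N, D, hD, h⟩ := hf
  exact ((eval_comp hΦ N).div (eval_comp hΦ D)).congr (hgen _ ⟨D, hD, h⟩)

end IsGenRat

/-! ### Differentials of rational functions. -/

theorem differentiable_eval (N : MvPolynomial (Fin 6) ℝ) :
    Differentiable ℝ fun x : KState => eval x N := by
  induction N using MvPolynomial.induction_on with
  | C a => simp
  | add p q hp hq => simp only [map_add]; exact hp.add hq
  | mul_X p i hp => simp only [map_mul, eval_X]; exact hp.mul (differentiable_apply i)

theorem exists_fderiv_eval (N : MvPolynomial (Fin 6) ℝ) (v : KState) :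
    ∃ N' : MvPolynomial (Fin 6) ℝ, ∀ x, fderiv ℝ (fun x : KState => eval x N) x v = eval x N' := by
  induction N using MvPolynomial.induction_on with
  | C a => exact ⟨0, fun x => by simp⟩
  | add p q hp hq =>
    obtain ⟨p', hp⟩ := hp
    obtain ⟨q', hq⟩ := hq
    refine ⟨p' + q', fun x => ?_⟩
    simp only [map_add]
    rw [fderiv_fun_add (differentiable_eval p x) (differentiable_eval q x), ← hp, ← hq]
    rfl
  | mul_X p i hp =>
    obtain ⟨p', hp⟩ := hp
    refine ⟨p * C (v i) + X i * p', fun x => ?_⟩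
    simp only [map_mul, map_add, eval_X, eval_C]
    rw [fderiv_fun_mul (differentiable_eval p x) (differentiable_apply i x), ← hp]
    have : fderiv ℝ (fun x : KState => x i) x v = v i := by
      rw [(hasFDerivAt_apply i x).fderiv]; rfl
    simp [this]

theorem hasFDerivAt_eval_div (N D : MvPolynomial (Fin 6) ℝ) {x : KState} (hx : eval x D ≠ 0) :
    HasFDerivAt (fun y : KState => eval y N / eval y D)
      (eval x N • (-(eval x D ^ 2)⁻¹ • fderiv ℝ (fun y : KState => eval y D) x)
        + (eval x D)⁻¹ • fderiv ℝ (fun y : KState => eval y N) x) x := by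
  simp only [div_eq_mul_inv]
  exact (differentiable_eval N x).hasFDerivAt.mul
    ((hasDerivAt_inv hx).comp_hasFDerivAt x (differentiable_eval D x).hasFDerivAt)

namespace IsGenRat

variable {f : KState → ℝ}

theorem generically_differentiableAt (hf : IsGenRat f) :
    Generically fun x => DifferentiableAt ℝ f x := by
  obtain ⟨N, D, hD, h⟩ := hf
  refine ⟨D, hD, fun x hx => ?_⟩
  have : f =ᶠ[𝓝 x] fun y => eval y N / eval y D := by
    filter_upwards [(isOpen_eval_ne D).mem_nhds hx] with y hy using h y hy
  exact (hasFDerivAt_eval_div N D hx).differentiableAt.congr_of_eventuallyEq this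

theorem fderiv (hf : IsGenRat f) (v : KState) : IsGenRat fun x => fderiv ℝ f x v := by
  obtain ⟨N, D, hD, h⟩ := hf
  obtain ⟨N', hN'⟩ := exists_fderiv_eval N v
  obtain ⟨D', hD'⟩ := exists_fderiv_eval D v
  refine ⟨N' * D - N * D', D ^ 2, pow_ne_zero 2 hD, fun x hx => ?_⟩
  replace hx : eval x D ≠ 0 := by
    rw [map_pow] at hx; exact ne_zero_pow two_ne_zero hx
  have : f =ᶠ[𝓝 x] fun y => eval y N / eval y D := by
    filter_upwards [(isOpen_eval_ne D).mem_nhds hx] with y hy using h y hy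
  beta_reduce
  rw [this.fderiv_eq, (hasFDerivAt_eval_div N D hx).fderiv]
  simp [hN', hD']
  field_simp
  ring

end IsGenRat

/-- Rational functions whose differentials are independent at one point of smoothness are
functionally independent. -/
theorem functionallyIndependent_of_point {n : ℕ} {F : Fin n → KState → ℝ}
    (hF : ∀ i, IsGenRat (F i)) {x : KState} (hx : ∀ i, ContDiffAt ℝ 1 (F i) x)
    (V : Fin n → KState)
    (hV : ∀ c : Fin n → ℝ, (∀ j, ∑ i, c i * fderiv ℝ (F i) x (V j) = 0) → c = 0) :
    FunctionallyIndependent F := by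
  -- A minor of the Jacobi matrix in the fixed directions `V j` is again rational, and non-zero at
  -- the given point, hence generically non-zero.
  have hdet : IsGenRat fun y => (Matrix.of fun i j => fderiv ℝ (F i) y (V j)).det :=
    IsGenRat.det fun i j => (hF i).fderiv (V j)
  have key : ∀ y, (Matrix.of fun i j => fderiv ℝ (F i) y (V j)).det = 0 →
      ∃ c : Fin n → ℝ, c ≠ 0 ∧ ∀ j, ∑ i, c i * fderiv ℝ (F i) y (V j) = 0 := by
    intro y hy
    obtain ⟨c, hc, h⟩ := Matrix.exists_vecMul_eq_zero_iff.mpr hy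
    exact ⟨c, hc, fun j => congrFun h j⟩
  have hne : (Matrix.of fun i j => fderiv ℝ (F i) x (V j)).det ≠ 0 := by
    intro h0
    obtain ⟨c, hc, h⟩ := key x h0
    exact hc (hV c h)
  have hcont : ContinuousAt (fun y => (Matrix.of fun i j => fderiv ℝ (F i) y (V j)).det) x := by
    simp only [Matrix.det_apply', Matrix.of_apply]
    refine tendsto_finsetSum _ fun σ _ => tendsto_const_nhds.mul (tendsto_finsetProd _ fun i _ => ?_)
    exact (((hx _).fderiv_right (m := 0) (by simp)).continuousAt).clm_apply continuousAt_const
  have hdiff : ∀ i, Generically fun y => DifferentiableAt ℝ (F i) y :=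
    fun i => (hF i).generically_differentiableAt
  choose q hq hq' using hdiff
  have hall : Generically fun y => ∀ i, DifferentiableAt ℝ (F i) y := by
    refine ⟨∏ i, q i, Finset.prod_ne_zero_iff.mpr fun i _ => hq i, fun y hy i => hq' i y ?_⟩
    rw [map_prod] at hy
    exact Finset.prod_ne_zero_iff.mp hy i (Finset.mem_univ i)
  refine (hall.and (hdet.generically_ne hcont hne)).mono fun y hy => ⟨hy.1, ?_⟩
  rw [Fintype.linearIndependent_iff]
  intro c hc
  by_contra hcon
  push Not at hcon
  refine hy.2 (Matrix.exists_vecMul_eq_zero_iff.mp ⟨c, ?_, ?_⟩)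
  · rintro rfl
    obtain ⟨i, hi⟩ := hcon
    exact hi rfl
  · funext j
    have := congrArg (fun L : KState →L[ℝ] ℝ => L (V j)) hc
    simpa [Matrix.vecMul, dotProduct] using this

end Kirchhoff

/-! ## The Kahan map as a birational map -/

namespace Kirchhoff

open MvPolynomial Filter Topology

variable (k : KirchhoffParams) (ε : ℝ)

theorem isGenRat_entry (i j : Fin 6) : IsGenRat fun x => (1 - ε • jacobian k x) i j := by
  have h : IsGenRat fun x => jacobian k x i j := by
    fin_cases i <;> fin_cases j <;> simp [jacobian] <;>
    repeat' first
      | apply IsGenRat.const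
      | apply IsGenRat.coord
      | apply IsGenRat.neg
      | apply IsGenRat.mul
  simp only [Matrix.sub_apply, Matrix.smul_apply, smul_eq_mul]
  exact (IsGenRat.const _).sub ((IsGenRat.const _).mul h)

theorem isGenRat_field (i : Fin 6) : IsGenRat fun x => field k x i := by
  fin_cases i <;> simp [field] <;>
  repeat' first
    | apply IsGenRat.const
    | apply IsGenRat.coord
    | apply IsGenRat.add
    | apply IsGenRat.sub
    | apply IsGenRat.neg
    | apply IsGenRat.mul

theorem isGenRat_delta : IsGenRat (delta k ε) := IsGenRat.det (isGenRat_entry k ε)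

/-- Adjugate over determinant. With `0⁻¹ = 0` this formula agrees with the total matrix inverse at
singular points too. -/
theorem isGenRat_kahanMap (i : Fin 6) : IsGenRat fun x => kahanMap k ε x i := by
  simp only [kahanMap, Pi.add_apply, Pi.smul_apply, smul_eq_mul, Matrix.inv_def,
    Ring.inverse_eq_inv', Matrix.mulVec, dotProduct, Matrix.smul_apply, Matrix.adjugate_apply]
  refine (IsGenRat.coord i).add ((IsGenRat.const _).mul (IsGenRat.sum _ fun j =>
    ((isGenRat_delta k ε).inv.mul (IsGenRat.det fun l m => ?_)).mul (isGenRat_field k j)))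
  by_cases h : l = j
  · subst h; simpa using IsGenRat.const _
  · simpa [Matrix.updateRow_ne h] using isGenRat_entry k ε l m

theorem continuous_entry : Continuous fun x => 1 - ε • jacobian k x := by
  have h : Continuous (jacobian k) := by
    refine continuous_matrix fun i j => ?_
    fin_cases i <;> fin_cases j <;> simp [jacobian] <;> fun_prop
  exact continuous_const.sub (h.const_smul ε)

theorem continuous_delta : Continuous (delta k ε) := (continuous_entry k ε).matrix_det

theorem continuous_field : Continuous (field k) := by
  refine continuous_pi fun i => ?_
  fin_cases i <;> simp [field] <;> fun_prop

variable {k ε}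

theorem continuousAt_kahanMap {x : KState} (h : delta k ε x ≠ 0) :
    ContinuousAt (kahanMap k ε) x := by
  have : kahanMap k ε = fun x => x + (2 * ε) • (delta k ε x)⁻¹ •
      Matrix.mulVec (1 - ε • jacobian k x).adjugate (field k x) := by
    funext x
    simp only [kahanMap, Matrix.inv_def, Ring.inverse_eq_inv', Matrix.smul_mulVec, delta]
  rw [this]
  have h1 : ContinuousAt (fun x => (delta k ε x)⁻¹) x :=
    (continuous_delta k ε).continuousAt.inv₀ h
  have h2 : ContinuousAt (fun x => Matrix.mulVec (1 - ε • jacobian k x).adjugate (field k x)) x :=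
    ((continuous_entry k ε).matrix_adjugate.matrix_mulVec (continuous_field k)).continuousAt
  exact continuousAt_id.add ((h1.smul h2).const_smul (2 * ε))

variable (k ε)

@[simp] theorem kahanMap_zero : kahanMap k ε 0 = 0 := by
  have : field k 0 = 0 := by
    funext i; fin_cases i <;> simp [field]
  simp [kahanMap, this]

@[simp] theorem delta_zero : delta k ε 0 = 1 := by
  have : jacobian k 0 = 0 := by
    ext i j; fin_cases i <;> fin_cases j <;> simp [jacobian]
  simp [delta, this]

variable {k ε}

theorem isStep_kahanMap {x : KState} (h : delta k ε x ≠ 0) : IsStep k ε x (kahanMap k ε x) :=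
  (isStep_iff k ε x _ h).mpr rfl

theorem IsStep.symm {x y : KState} (h : IsStep k ε x y) : IsStep k (-ε) y x := by
  obtain ⟨h0, h1, h2, h3, h4, h5⟩ := h
  refine ⟨?_, ?_, ?_, ?_, ?_, ?_⟩ <;> linarith

theorem kahanMap_neg_kahanMap {x : KState} (h : delta k ε x ≠ 0)
    (h' : delta k (-ε) (kahanMap k ε x) ≠ 0) : kahanMap k (-ε) (kahanMap k ε x) = x :=
  ((isStep_iff k (-ε) _ x h').mp (isStep_kahanMap h).symm).symm

theorem generically_delta_ne : Generically fun x => delta k ε x ≠ 0 :=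
  (isGenRat_delta k ε).generically_ne (continuous_delta k ε).continuousAt (x := 0) (by simp)

theorem continuousAt_kahanMap_zero : ContinuousAt (kahanMap k ε) 0 :=
  continuousAt_kahanMap (by simp)

/-- Generic properties are preserved by composition with the Kahan map. -/
theorem Generically.comp_kahanMap {P : KState → Prop} (h : Generically P) :
    Generically fun x => P (kahanMap k ε x) := by
  obtain ⟨q, hq, h⟩ := h
  rcases (IsGenRat.eval_comp (isGenRat_kahanMap k ε) q).generically_eq_zero_or_ne with h0 | h0
  · exfalso
    have hzero : ∀ x, delta k ε x ≠ 0 → eval (kahanMap k ε x) q = 0 := fun x hx =>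
      eq_of_generically ((MvPolynomial.continuous_eval q).continuousAt.comp
        (continuousAt_kahanMap hx)) continuousAt_const h0
    -- 0 is a fixed point with Δ = 1 for both ±ε, so every y near 0 is the image under Φ of Φ(y;
    -- -ε). Were q ∘ Φ generically zero, q would vanish near 0.
    have hnear : ∀ᶠ y in 𝓝 (0 : KState), delta k (-ε) y ≠ 0 ∧
        delta k ε (kahanMap k (-ε) y) ≠ 0 := by
      refine ((continuous_delta k (-ε)).continuousAt.eventually_ne (by simp)).and ?_
      have : ContinuousAt (fun y => delta k ε (kahanMap k (-ε) y)) 0 :=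
        (continuous_delta k ε).continuousAt.comp continuousAt_kahanMap_zero
      exact this.eventually_ne (by simp)
    obtain ⟨y, hy, hy1, hy2⟩ := (mem_closure_iff_frequently.mp (dense_eval_ne hq 0)).and_eventually
      hnear |>.exists
    have hback := kahanMap_neg_kahanMap (ε := -ε) hy1 (by rwa [neg_neg])
    rw [neg_neg] at hback
    exact hy (hback ▸ hzero _ hy2)
  · exact h0.mono fun x hx => h _ hx

theorem IsGenRat.comp_kahanMap {f : KState → ℝ} (hf : IsGenRat f) :
    IsGenRat fun x => f (kahanMap k ε x) :=
  hf.comp (isGenRat_kahanMap k ε) fun _ h => h.comp_kahanMap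

theorem Generically.comp_iterate {P : KState → Prop} (h : Generically P) (n : ℕ) :
    Generically fun x => P ((kahanMap k ε)^[n] x) := by
  induction n with
  | zero => simpa using h
  | succ n ih => simpa [Function.iterate_succ_apply] using ih.comp_kahanMap (k := k) (ε := ε)

/-! ### The orbit domain -/

theorem iter_ofNat (n : ℕ) (x : KState) :
    iter k ε (Int.ofNat n) x = (kahanMap k ε)^[n] x := by rw [iter]

theorem iter_negSucc (n : ℕ) (x : KState) :
    iter k ε (Int.negSucc n) x = (kahanMap k (-ε))^[n + 1] x := by rw [iter]

theorem Generically.comp_iter {P : KState → Prop} (h : Generically P) (i : ℤ) :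
    Generically fun x => P (iter k ε i x) := by
  cases i with
  | ofNat n => simpa only [iter_ofNat] using h.comp_iterate n
  | negSucc n => simpa only [iter_negSucc] using h.comp_iterate (n + 1)

@[simp] theorem iter_zero (x : KState) : iter k ε 0 x = x := by
  rw [show (0 : ℤ) = Int.ofNat 0 from rfl, iter_ofNat, Function.iterate_zero, id]

theorem iter_negSucc_eq (n : ℕ) (x : KState) :
    iter k ε (Int.negSucc n) x = kahanMap k (-ε) (iter k ε (Int.negSucc n + 1) x) := by
  cases n with
  | zero =>
    rw [show Int.negSucc 0 + 1 = 0 from rfl, iter_negSucc, iter_zero, zero_add,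
      Function.iterate_one]
  | succ n =>
    rw [show Int.negSucc (n + 1) + 1 = Int.negSucc n from rfl, iter_negSucc, iter_negSucc,
      Function.iterate_succ_apply']

/-- Definitional for i ≥ 0. For i < 0 a step of Φ must undo a step of Φ(·; -ε), which uses the
non-vanishing of Δ for both signs. -/
theorem iter_add_one {x : KState} (hx : x ∈ orbitDomain k ε) (i : ℤ) :
    iter k ε (i + 1) x = kahanMap k ε (iter k ε i x) := by
  cases i with
  | ofNat n =>
    rw [show Int.ofNat n + 1 = Int.ofNat (n + 1) from rfl, iter_ofNat, iter_ofNat,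
      Function.iterate_succ_apply']
  | negSucc n =>
    have h1 := iter_negSucc_eq (k := k) (ε := ε) n x
    have h2 := (hx (Int.negSucc n + 1)).2
    have h3 := (hx (Int.negSucc n)).1
    rw [h1] at h3 ⊢
    have := kahanMap_neg_kahanMap (ε := -ε) h2 (by rwa [neg_neg])
    rw [neg_neg] at this
    exact this.symm

theorem iter_add_natCast {x : KState} (hx : x ∈ orbitDomain k ε) (i : ℤ) (n : ℕ) :
    iter k ε (i + n) x = (kahanMap k ε)^[n] (iter k ε i x) := by
  induction n with
  | zero => simp
  | succ n ih =>
    rw [Function.iterate_succ_apply', ← ih, ← iter_add_one hx]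
    push_cast
    ring_nf

theorem continuousAt_iterate {x : KState} {n : ℕ}
    (h : ∀ i < n, delta k ε ((kahanMap k ε)^[i] x) ≠ 0) :
    ContinuousAt ((kahanMap k ε)^[n]) x := by
  induction n with
  | zero => exact continuousAt_id
  | succ n ih =>
    rw [Function.iterate_succ']
    exact (continuousAt_kahanMap (h n (Nat.lt_succ_self n))).comp
      (ih fun i hi => h i (hi.trans (Nat.lt_succ_self n)))

theorem continuousAt_iter {x : KState} (hx : x ∈ orbitDomain k ε) (i : ℤ) :
    ContinuousAt (iter k ε i) x := by
  cases i with
  | ofNat n =>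
    rw [show iter k ε (Int.ofNat n) = (kahanMap k ε)^[n] from funext (iter_ofNat n)]
    exact continuousAt_iterate fun i _ => iter_ofNat (k := k) (ε := ε) i x ▸ (hx (Int.ofNat i)).1
  | negSucc n =>
    rw [show iter k ε (Int.negSucc n) = (kahanMap k (-ε))^[n + 1] from funext (iter_negSucc n)]
    refine continuousAt_iterate fun i _ => ?_
    cases i with
    | zero =>
      have := (hx 0).2
      rwa [iter_zero] at this
    | succ i => exact iter_negSucc (k := k) (ε := ε) i x ▸ (hx (Int.negSucc i)).2

theorem dense_orbitDomain_inter {P : KState → Prop} (h : Generically P) :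
    Dense {x | x ∈ orbitDomain k ε ∧ ∀ i, P (iter k ε i x)} := by
  have := dense_forall_of_generically (fun i : ℤ =>
    (((generically_delta_ne (k := k) (ε := ε)).and
      (generically_delta_ne (k := k) (ε := -ε))).and h).comp_iter (k := k) (ε := ε) i)
  exact this.mono fun x hx => ⟨fun i => (hx i).1, fun i => (hx i).2⟩

theorem dense_orbitDomain : Dense (orbitDomain k ε) :=
  (dense_orbitDomain_inter (P := fun _ => True) ⟨1, one_ne_zero, fun _ _ => trivial⟩).mono
    fun _ hx => hx.1

theorem iter_iter {x : KState} (hx : x ∈ orbitDomain k ε) (i j : ℤ) :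
    iter k ε j (iter k ε i x) = iter k ε (i + j) x := by
  cases j with
  | ofNat n => rw [iter_ofNat, ← iter_add_natCast hx, Int.ofNat_eq_natCast]
  | negSucc n =>
    have key : ∀ n : ℕ, (kahanMap k (-ε))^[n] (iter k ε i x) = iter k ε (i - n) x := by
      intro n
      induction n with
      | zero => simp
      | succ n ih =>
        have h1 := iter_add_one hx (i - (n + 1 : ℕ))
        rw [show i - ((n + 1 : ℕ) : ℤ) + 1 = i - n by push_cast; ring] at h1
        rw [Function.iterate_succ_apply', ih, h1,
          kahanMap_neg_kahanMap (hx _).1 (h1 ▸ (hx (i - n)).2)]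
    rw [iter_negSucc, key, Int.negSucc_eq]
    push_cast
    rw [← sub_eq_add_neg]

theorem iter_mem_orbitDomain {x : KState} (hx : x ∈ orbitDomain k ε) (i : ℤ) :
    iter k ε i x ∈ orbitDomain k ε := fun j => by
  rw [iter_iter hx]
  exact hx _

end Kirchhoff

/-! ## The integrals in real coordinates -/

namespace Kirchhoff

open KirchhoffAlgebra

noncomputable section

variable (k : KirchhoffParams) (ε : ℝ)

/-- The scaling factor that normalizes the step size. -/
def scale : ℝ := ε * k.a₁

/-- The parameter `a₃ / a₁`. -/
def parA : ℝ := k.a₃ / k.a₁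

/-- The parameter `(b₃ - b₁) / a₁`. -/
def parB : ℝ := (k.b₃ - k.b₁) / k.a₁

/-- The rescaled component `m₃`. -/
def spin (x : KState) : ℝ := scale k ε * x 2

/-- The rescaled component `p₃`. -/
def height (x : KState) : ℝ := scale k ε * x 5

/-- The rescaled `m₁ p₁ + m₂ p₂`. -/
def realPart (x : KState) : ℝ := scale k ε ^ 2 * (x 0 * x 3 + x 1 * x 4)

/-- The rescaled `m₂ p₁ - m₁ p₂`. -/
def areaPart (x : KState) : ℝ := scale k ε ^ 2 * (x 1 * x 3 - x 0 * x 4)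

/-- The real form of `normH`. -/
def formH (x : KState) : ℝ :=
  scale k ε ^ 2 * ((x 0 ^ 2 + x 1 ^ 2) + parB k * (x 3 ^ 2 + x 4 ^ 2))

/-- The real form of `normE`. -/
def formE (x : KState) : ℝ :=
  scale k ε ^ 2 * ((parA k - 1) * (x 0 ^ 2 + x 1 ^ 2)
    + parA k * parB k * (x 3 ^ 2 + x 4 ^ 2))

/-- The real form of `reDet`. -/
def detR (x : KState) : ℝ :=
  1 - parA k * (parA k - 1) * spin k ε x ^ 2 - parB k * height k ε x ^ 2

/-- The real form of `intI`. -/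
def realI (x : KState) : ℝ := (2 * parA k - 1 + formE k ε x) / detR k ε x

/-- The real form of `sigma`. -/
def realσ (x : KState) : ℝ :=
  detR k ε x + formH k ε x + (2 * parA k - 1) * spin k ε x ^ 2 * realI k ε x

/-- The numerator of the increment of `height`. -/
def slope (x : KState) : ℝ :=
  spin k ε x * realPart k ε x - height k ε x * formH k ε x
    + areaPart k ε x * (1 + parA k * (parA k - 1) * spin k ε x ^ 2
      + parB k * height k ε x ^ 2)

/-- The real form of `denV`. -/
def realV (x : KState) : ℝ :=
  (1 + parA k * (parA k - 1) * spin k ε x ^ 2 + parB k * height k ε x ^ 2) * realσ k ε x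
    + 2 * parB k * height k ε x
      * (spin k ε x * realPart k ε x - height k ε x * formH k ε x)

/-- Half the numerator of `realJ`. -/
def numerJ (x : KState) : ℝ :=
  1 + spin k ε x ^ 2 * realI k ε x ^ 2 + formH k ε x + parB k * areaPart k ε x ^ 2

/-- The real form of `intJ`. -/
def realJ (x : KState) : ℝ := 2 * numerJ k ε x / realV k ε x

/-- The real form of `intN`. -/
def realN (x : KState) : ℝ :=
  (realσ k ε x ^ 2 - 4 * parB k ^ 2 * height k ε x ^ 2 * areaPart k ε x ^ 2) / (2 * realV k ε x)
    - realJ k ε x * detR k ε x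

/-- The real form of `denW`. -/
def denJ₁ (x : KState) : ℝ :=
  realN k ε x ^ 2 + 2 * realN k ε x
    + (2 * parA k - 1) ^ 2 * spin k ε x ^ 2 * realJ k ε x ^ 2
    - 2 * (2 * parA k - 1) * spin k ε x ^ 2 * realI k ε x * realJ k ε x

/-- The numerator of the integral `J₁`. -/
def numJ₁ (x : KState) : ℝ :=
  realI k ε x * denJ₁ k ε x + 4 * realJ k ε x * (realI k ε x * (realN k ε x + 2)
    - (2 * parA k - 1) * (realN k ε x + realJ k ε x))

/-- The integral `J₁`. -/
def realJ₁ (x : KState) : ℝ := numJ₁ k ε x / denJ₁ k ε x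

/-- A quantity proportional to `crossNorm x (Φ x)`. -/
def realCross (x : KState) : ℝ :=
  areaPart k ε x ^ 2
      * (realσ k ε x - 2 * parB k * height k ε x * areaPart k ε x) ^ 2
    - 2 * areaPart k ε x * slope k ε x
      * (2 * numerJ k ε x - (realσ k ε x - 2 * parB k * height k ε x * areaPart k ε x))
    + slope k ε x ^ 2 * (1 + spin k ε x ^ 2 * realI k ε x ^ 2)

/-- The point of complex rotating coordinates. -/
def toPoint (x : KState) : Point ℂ where
  M := scale k ε * (x 0 + Complex.I * x 1)
  P := scale k ε * (x 3 + Complex.I * x 4)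
  M' := scale k ε * (x 0 - Complex.I * x 1)
  P' := scale k ε * (x 3 - Complex.I * x 4)
  ζ := Complex.I * height k ε x

/-- The points at which no denominator of the theory vanishes. -/
structure Good (x : KState) : Prop where
  delta_ne : delta k ε x ≠ 0
  m₃_ne : x 2 ≠ 0
  p₃_ne : x 5 ≠ 0
  detR_ne : detR k ε x ≠ 0
  realV_ne : realV k ε x ≠ 0
  sub_ne : realσ k ε x - 2 * parB k * height k ε x * areaPart k ε x ≠ 0
  add_ne : realσ k ε x + 2 * parB k * height k ε x * areaPart k ε x ≠ 0
  slope_ne : slope k ε x ≠ 0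
  cross_ne : realCross k ε x ≠ 0
  den_ne : denJ₁ k ε x ≠ 0

/-! ### Values of the complex quantities at real points. -/

variable (x : KState)

local notation "A" => ((parA k : ℝ) : ℂ)
local notation "B" => ((parB k : ℝ) : ℂ)
local notation "Ν" => (Complex.I * ((spin k ε x : ℝ) : ℂ))

theorem imPart_toPoint : imPart (toPoint k ε x) = Complex.I * areaPart k ε x := by
  simp only [imPart, toPoint, areaPart]; push_cast; ring

theorem rePart_toPoint : rePart (toPoint k ε x) = realPart k ε x := by
  simp only [rePart, toPoint, realPart]; push_cast
  linear_combination (-(scale k ε : ℂ) ^ 2 * x 1 * x 4) * Complex.I_sq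

theorem normH_toPoint : normH B (toPoint k ε x) = formH k ε x := by
  simp only [normH, toPoint, formH]; push_cast
  linear_combination (-(scale k ε : ℂ) ^ 2 * (x 1 ^ 2 + B * x 4 ^ 2)) * Complex.I_sq

theorem normE_toPoint : normE A B (toPoint k ε x) = formE k ε x := by
  simp only [normE, toPoint, formE]; push_cast
  linear_combination (-(scale k ε : ℂ) ^ 2 * ((A - 1) * x 1 ^ 2 + A * B * x 4 ^ 2)) * Complex.I_sq

theorem reDet_toPoint : reDet A B Ν (toPoint k ε x) = detR k ε x := by
  simp only [reDet, toPoint, detR]; push_cast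
  linear_combination (A * (A - 1) * spin k ε x ^ 2 + B * height k ε x ^ 2) * Complex.I_sq

theorem intI_toPoint : intI A B Ν (toPoint k ε x) = realI k ε x := by
  simp only [intI, reDet_toPoint, normE_toPoint, realI]; push_cast; rfl

theorem sigma_toPoint : sigma A B Ν (toPoint k ε x) = realσ k ε x := by
  simp only [sigma, reDet_toPoint, normH_toPoint, intI_toPoint, imDet, realσ]; push_cast
  linear_combination (-(2 * A - 1) * spin k ε x ^ 2 * realI k ε x) * Complex.I_sq

theorem denV_toPoint : denV A B Ν (toPoint k ε x) = realV k ε x := by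
  simp only [denV, sigma_toPoint, rePart_toPoint, normH_toPoint, realV]
  simp only [toPoint]; push_cast
  linear_combination (-(A * (A - 1) * spin k ε x ^ 2 + B * height k ε x ^ 2) * realσ k ε x
    - 2 * B * height k ε x * (spin k ε x * realPart k ε x - height k ε x * formH k ε x))
    * Complex.I_sq

theorem intJ_toPoint : intJ A B Ν (toPoint k ε x) = realJ k ε x := by
  simp only [intJ, denV_toPoint, intI_toPoint, normH_toPoint, imPart_toPoint, realJ, numerJ]
  push_cast
  rw [mul_pow, mul_pow, Complex.I_sq]
  congr 1
  ring

theorem intN_toPoint : intN A B Ν (toPoint k ε x) = realN k ε x := by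
  simp only [intN, tau, denV_toPoint, sigma_toPoint, intJ_toPoint, imPart_toPoint, reDet_toPoint,
    realN]
  simp only [toPoint]
  push_cast
  congr 2
  linear_combination (4 * B ^ 2 * height k ε x ^ 2 * areaPart k ε x ^ 2) *
    (1 - Complex.I ^ 2) * Complex.I_sq

theorem denW_toPoint : denW A B Ν (toPoint k ε x) = denJ₁ k ε x := by
  simp only [denW, intN_toPoint, intJ_toPoint, intI_toPoint, imDet, denJ₁]; push_cast
  linear_combination (-(2 * A - 1) ^ 2 * spin k ε x ^ 2 * realJ k ε x ^ 2
    + 2 * (2 * A - 1) * spin k ε x ^ 2 * realI k ε x * realJ k ε x) * Complex.I_sq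

/-- Only the imaginary part matters: the increment of ζ is imaginary, whereas the Wronskians enter
through the real part of the pairing. -/
theorem numW_toPoint_im : (numW A B Ν (toPoint k ε x)).im = -spin k ε x * numJ₁ k ε x := by
  simp only [numW, intN_toPoint, intJ_toPoint, intI_toPoint, imDet, numJ₁, denJ₁]
  simp [pow_succ]
  ring

variable {k ε x}

theorem Good.regular (h : Good k ε x) (hs : scale k ε ≠ 0) (hB : parB k ≠ 0) :
    Regular A B Ν (toPoint k ε x) where
  β_ne := by exact_mod_cast hB
  ν_ne := mul_ne_zero Complex.I_ne_zero (by exact_mod_cast mul_ne_zero hs h.m₃_ne)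
  ζ_ne := mul_ne_zero Complex.I_ne_zero (by exact_mod_cast mul_ne_zero hs h.p₃_ne)
  reDet_ne := by rw [reDet_toPoint]; exact_mod_cast h.detR_ne
  add_ne := fun e => by
    have := congrArg Complex.re e
    rw [reDet_toPoint] at this
    simp [imDet] at this
    exact h.detR_ne this
  sub_ne := fun e => by
    have := congrArg Complex.re e
    rw [reDet_toPoint] at this
    simp [imDet] at this
    exact h.detR_ne this
  denV_ne := by rw [denV_toPoint]; exact_mod_cast h.realV_ne
  -- Both ζ and `imPart` carry a factor i, and i² = -1 exchanges the two signs.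
  sigma_add_ne := fun e => by
    have := congrArg Complex.re e
    rw [sigma_toPoint, imPart_toPoint] at this
    simp [toPoint] at this
    exact h.sub_ne (by linarith)
  sigma_sub_ne := fun e => by
    have := congrArg Complex.re e
    rw [sigma_toPoint, imPart_toPoint] at this
    simp [toPoint] at this
    exact h.add_ne (by linarith)

theorem IsStep.toPoint (ha : k.a₁ ≠ 0) {y : KState} (h : IsStep k ε x y) :
    Step A B Ν (toPoint k ε x) (toPoint k ε y) := by
  obtain ⟨h0, h1, h2, h3, h4, h5⟩ := h
  have ea : k.a₃ = parA k * k.a₁ := by rw [parA, div_mul_cancel₀ _ ha]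
  have eb : k.b₃ = parB k * k.a₁ + k.b₁ := by rw [parB, div_mul_cancel₀ _ ha]; ring
  replace h2 : y 2 = x 2 := by linarith
  simp only [h2, ea, eb] at h0 h1 h3 h4 h5
  constructor <;> apply Complex.ext <;>
    simp [Kirchhoff.toPoint, height, spin, scale]
  · linear_combination (ε * k.a₁) * h0
  · linear_combination (ε * k.a₁) * h1
  · linear_combination (ε * k.a₁) * h3
  · linear_combination (ε * k.a₁) * h4
  · linear_combination (ε * k.a₁) * h0
  · linear_combination -(ε * k.a₁) * h1
  · linear_combination (ε * k.a₁) * h3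
  · linear_combination -(ε * k.a₁) * h4
  · linear_combination (2 * ε * k.a₁) * h5

end

end Kirchhoff

/-! ## The integrals along an orbit -/

namespace Kirchhoff

open KirchhoffAlgebra

noncomputable section

variable {k : KirchhoffParams} {ε : ℝ} {x : KState}

local notation "A" => ((parA k : ℝ) : ℂ)
local notation "B" => ((parB k : ℝ) : ℂ)
local notation "Ν" => (Complex.I * ((spin k ε x : ℝ) : ℂ))

theorem kahanMap_apply_two (h : delta k ε x ≠ 0) : kahanMap k ε x 2 = x 2 := by
  linarith [(isStep_kahanMap h).2.2.1]

theorem spin_kahanMap (h : delta k ε x ≠ 0) : spin k ε (kahanMap k ε x) = spin k ε x := by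
  rw [spin, spin, kahanMap_apply_two h]

theorem step_toPoint (ha : k.a₁ ≠ 0) (h : delta k ε x ≠ 0) :
    Step A B Ν (toPoint k ε x) (toPoint k ε (kahanMap k ε x)) :=
  (isStep_kahanMap h).toPoint ha

theorem scale_ne (ha : k.a₁ ≠ 0) (hε : ε ≠ 0) : scale k ε ≠ 0 := mul_ne_zero hε ha

theorem parB_ne (ha : k.a₁ ≠ 0) (hb : k.b₁ ≠ k.b₃) : parB k ≠ 0 :=
  div_ne_zero (sub_ne_zero.mpr hb.symm) ha

theorem Good.height_sub (ha : k.a₁ ≠ 0) (hb : k.b₁ ≠ k.b₃) (hε : ε ≠ 0) (h : Good k ε x) :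
    (height k ε (kahanMap k ε x) - height k ε x)
      * (realσ k ε x - 2 * parB k * height k ε x * areaPart k ε x) = 2 * slope k ε x := by
  have e := (step_toPoint ha h.delta_ne).linear_sigma (h.regular (scale_ne ha hε) (parB_ne ha hb))
  rw [sigma_toPoint, imPart_toPoint, rePart_toPoint, normH_toPoint] at e
  have := congrArg Complex.im e
  simp [toPoint, pow_two] at this
  rw [slope]
  linear_combination this

theorem Good.height_ne (ha : k.a₁ ≠ 0) (hb : k.b₁ ≠ k.b₃) (hε : ε ≠ 0) (h : Good k ε x) :
    height k ε (kahanMap k ε x) - height k ε x ≠ 0 := fun e => by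
  have := h.height_sub ha hb hε
  rw [e, zero_mul] at this
  exact h.slope_ne (by linarith)

theorem Good.ζ_ne (ha : k.a₁ ≠ 0) (hb : k.b₁ ≠ k.b₃) (hε : ε ≠ 0) (h : Good k ε x) :
    (toPoint k ε (kahanMap k ε x)).ζ ≠ (toPoint k ε x).ζ := fun e => by
  have := mul_left_cancel₀ Complex.I_ne_zero e
  exact h.height_ne ha hb hε (sub_eq_zero.mpr (by exact_mod_cast this))

theorem Good.crossNorm_ne (ha : k.a₁ ≠ 0) (hb : k.b₁ ≠ k.b₃) (hε : ε ≠ 0) (h : Good k ε x) :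
    crossNorm (toPoint k ε x) (toPoint k ε (kahanMap k ε x)) ≠ 0 := fun e => by
  have s := step_toPoint (ε := ε) ha h.delta_ne
  have hr := h.regular (scale_ne ha hε) (parB_ne ha hb)
  rw [crossNorm_eq, s.pairing_eq hr, s.pairing_swap_eq hr] at e
  have e1 := s.imPart_add_eq hr
  have e2 := s.polDet_mul hr
  have e3 := h.height_sub ha hb hε
  have e4 : realJ k ε x * realV k ε x = 2 * numerJ k ε x := by
    rw [realJ, div_mul_cancel₀ _ h.realV_ne]
  rw [sigma_toPoint, imPart_toPoint, denV_toPoint] at e2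
  rw [imPart_toPoint, imPart_toPoint, intJ_toPoint] at e1
  rw [imPart_toPoint, imPart_toPoint, intI_toPoint] at e
  simp only [polDet, toPoint] at e e1 e2
  have e := congrArg Complex.re e
  have e1 := congrArg Complex.im e1
  have e2 := congrArg Complex.re e2
  simp [pow_two] at e e1 e2
  apply h.cross_ne
  rw [realCross]
  generalize hS : realσ k ε x - 2 * parB k * height k ε x * areaPart k ε x = S at *
  rw [← sub_eq_add_neg, hS] at e2
  -- `realCross` is S²/4 times `crossNorm`, once the increment of p₃ and `areaPart` of the next
  -- point are eliminated through S, J and V.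
  linear_combination S ^ 2 / 4 * e + areaPart k ε x * S ^ 2 * e1
    + areaPart k ε x * S * realJ k ε x * (height k ε (kahanMap k ε x) - height k ε x) * e2
    + areaPart k ε x * realJ k ε x * realV k ε x * e3 + 2 * slope k ε x * areaPart k ε x * e4
    - areaPart k ε x * S * e3 - (1 + spin k ε x ^ 2 * realI k ε x ^ 2) / 4
      * ((height k ε (kahanMap k ε x) - height k ε x) * S + 2 * slope k ε x) * e3

theorem Good.realI_eq (ha : k.a₁ ≠ 0) (hb : k.b₁ ≠ k.b₃) (hε : ε ≠ 0) (h : Good k ε x)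
    (h' : Good k ε (kahanMap k ε x)) : realI k ε (kahanMap k ε x) = realI k ε x := by
  have hr := h.regular (scale_ne ha hε) (parB_ne ha hb)
  have hr' := h'.regular (scale_ne ha hε) (parB_ne ha hb)
  have e := intI_toPoint k ε (kahanMap k ε x)
  rw [spin_kahanMap h.delta_ne] at hr' e
  rw [(step_toPoint ha h.delta_ne).intI_eq hr hr' (h.ζ_ne ha hb hε), intI_toPoint] at e
  exact_mod_cast e.symm

theorem Good.realJ_eq (ha : k.a₁ ≠ 0) (hb : k.b₁ ≠ k.b₃) (hε : ε ≠ 0) (h : Good k ε x)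
    (h' : Good k ε (kahanMap k ε x)) : realJ k ε (kahanMap k ε x) = realJ k ε x := by
  have hr := h.regular (scale_ne ha hε) (parB_ne ha hb)
  have hr' := h'.regular (scale_ne ha hε) (parB_ne ha hb)
  have e := intJ_toPoint k ε (kahanMap k ε x)
  rw [spin_kahanMap h.delta_ne] at hr' e
  rw [(step_toPoint ha h.delta_ne).intJ_eq hr hr' (h.ζ_ne ha hb hε), intJ_toPoint] at e
  exact_mod_cast e.symm

theorem Good.realN_eq (ha : k.a₁ ≠ 0) (hb : k.b₁ ≠ k.b₃) (hε : ε ≠ 0) (h : Good k ε x)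
    (h' : Good k ε (kahanMap k ε x)) : realN k ε (kahanMap k ε x) = realN k ε x := by
  have hr := h.regular (scale_ne ha hε) (parB_ne ha hb)
  have hr' := h'.regular (scale_ne ha hε) (parB_ne ha hb)
  have e := intN_toPoint k ε (kahanMap k ε x)
  rw [spin_kahanMap h.delta_ne] at hr' e
  rw [(step_toPoint ha h.delta_ne).intN_eq hr hr' (h.ζ_ne ha hb hε), intN_toPoint] at e
  exact_mod_cast e.symm

theorem Good.denJ₁_eq (ha : k.a₁ ≠ 0) (hb : k.b₁ ≠ k.b₃) (hε : ε ≠ 0) (h : Good k ε x)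
    (h' : Good k ε (kahanMap k ε x)) : denJ₁ k ε (kahanMap k ε x) = denJ₁ k ε x := by
  rw [denJ₁, denJ₁, h.realI_eq ha hb hε h', h.realJ_eq ha hb hε h', h.realN_eq ha hb hε h',
    spin_kahanMap h.delta_ne]

theorem Good.realJ₁_eq (ha : k.a₁ ≠ 0) (hb : k.b₁ ≠ k.b₃) (hε : ε ≠ 0) (h : Good k ε x)
    (h' : Good k ε (kahanMap k ε x)) : realJ₁ k ε (kahanMap k ε x) = realJ₁ k ε x := by
  rw [realJ₁, realJ₁, numJ₁, numJ₁, h.denJ₁_eq ha hb hε h', h.realI_eq ha hb hε h',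
    h.realJ_eq ha hb hε h', h.realN_eq ha hb hε h']

theorem c₁_eq (ha : k.a₁ ≠ 0) (x : KState) : c₁ k ε x = detR k ε x := by
  rw [c₁, detR, spin, height, scale, parA, parB]
  field_simp
  ring

theorem I₀_eq (ha : k.a₁ ≠ 0) (x : KState) : I₀ k ε x = realI k ε x := by
  rw [I₀, realI, c₁_eq ha, c₃, formE, scale, parA, parB]
  congr 1
  field_simp
  ring

theorem Good.J₀_eq (ha : k.a₁ ≠ 0) (hb : k.b₁ ≠ k.b₃) (hε : ε ≠ 0) (h : Good k ε x)
    (h' : Good k ε (kahanMap k ε x)) :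
    J₀ k ε x = (2 * parA k - 1) * realJ k ε x - realI k ε x := by
  have hr := h.regular (scale_ne ha hε) (parB_ne ha hb)
  have hr' := h'.regular (scale_ne ha hε) (parB_ne ha hb)
  rw [spin_kahanMap h.delta_ne] at hr'
  have s := step_toPoint (ε := ε) ha h.delta_ne
  have e := s.bilinear_eq hr hr' (h.ζ_ne ha hb hε)
  have hp := s.polDet_ne hr
  have e1 : polDet A B Ν (toPoint k ε x) (toPoint k ε (kahanMap k ε x)) = C₁ k ε x := by
    rw [polDet, C₁]
    simp only [toPoint, spin, height, scale, parA, parB]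
    have ha' : (k.a₁ : ℂ) ≠ 0 := by exact_mod_cast ha
    push_cast
    field_simp
    rw [Complex.I_sq]
    ring
  rw [e1] at hp e
  rw [intJ_toPoint, intI_toPoint] at e
  rw [J₀, div_eq_iff (by exact_mod_cast hp)]
  have e := congrArg Complex.re e
  simp [toPoint] at e
  rw [← e, C₃]
  simp only [scale, parA, parB]
  field_simp

theorem wronskian_three_zero (x : KState) : wronskian k ε 3 0 x
    = (kahanMap k ε)^[3] x 0 * x 3 - x 0 * (kahanMap k ε)^[3] x 3 := rfl

theorem wronskian_three_one (x : KState) : wronskian k ε 3 1 x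
    = (kahanMap k ε)^[3] x 1 * x 4 - x 1 * (kahanMap k ε)^[3] x 4 := rfl

theorem wronskian_three_two (x : KState) : wronskian k ε 3 2 x
    = (kahanMap k ε)^[3] x 2 * x 5 - x 2 * (kahanMap k ε)^[3] x 5 := rfl

theorem kahanMap_iterate_three (x : KState) :
    (kahanMap k ε)^[3] x = kahanMap k ε (kahanMap k ε (kahanMap k ε x)) := by
  rw [Function.iterate_succ_apply', Function.iterate_succ_apply', Function.iterate_one]

/-- The first three points of the orbit are good. -/
def Good₃ (k : KirchhoffParams) (ε : ℝ) (x : KState) : Prop :=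
  Good k ε x ∧ Good k ε (kahanMap k ε x) ∧ Good k ε (kahanMap k ε (kahanMap k ε x))

/-- Up to the square of the scale, the real part of the pairing of x with Φ³x is W₁ + W₂, and W₃ is
m₃ times minus the increment of p₃. The constant from `pairing_three` is evaluated at Φx, and
invariance of `realJ₁` brings it back to x. -/
theorem Good₃.relation (ha : k.a₁ ≠ 0) (hb : k.b₁ ≠ k.b₃) (hε : ε ≠ 0) (h : Good₃ k ε x) :
    wronskian k ε 3 0 x + wronskian k ε 3 1 x + realJ₁ k ε x * wronskian k ε 3 2 x = 0 := by
  obtain ⟨h0, h1, h2⟩ := h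
  rw [wronskian_three_zero, wronskian_three_one, wronskian_three_two, kahanMap_iterate_three,
    kahanMap_apply_two h2.delta_ne, kahanMap_apply_two h1.delta_ne, kahanMap_apply_two h0.delta_ne]
  have s0 := step_toPoint (ε := ε) ha h0.delta_ne
  have s1 := step_toPoint (ε := ε) ha h1.delta_ne
  have s2 := step_toPoint (ε := ε) ha h2.delta_ne
  have r1 := h1.regular (scale_ne ha hε) (parB_ne ha hb)
  have r2 := h2.regular (scale_ne ha hε) (parB_ne ha hb)
  have hne := h1.ζ_ne ha hb hε
  have hc := h1.crossNorm_ne ha hb hε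
  have hn := numW_toPoint_im k ε (kahanMap k ε x)
  have hd := denW_toPoint k ε (kahanMap k ε x)
  rw [spin_kahanMap h1.delta_ne, spin_kahanMap h0.delta_ne] at s2 r2
  rw [spin_kahanMap h0.delta_ne] at s1 r1 hn hd
  have e := pairing_three s0 s1 s2 r1 r2 hne hc
  rw [hd] at e
  have e := congrArg Complex.re e
  generalize numW A B Ν (toPoint k ε (kahanMap k ε x)) = w at e hn
  simp only [Complex.mul_re, hn, toPoint, pairing] at e
  simp at e
  rw [← h0.realJ₁_eq ha hb hε h1, realJ₁]
  have hd := h1.den_ne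
  have hs := scale_ne ha hε
  simp only [height, spin] at e
  field_simp
  apply mul_left_cancel₀ (pow_ne_zero 2 hs)
  linear_combination e

/-- By `ζ_three`, equality of p₃ at x and Φ³x would force `denJ₁` or the increment of p₃ after Φx to
vanish. -/
theorem Good₃.wronskian_ne (ha : k.a₁ ≠ 0) (hb : k.b₁ ≠ k.b₃) (hε : ε ≠ 0) (h : Good₃ k ε x) :
    wronskian k ε 3 2 x ≠ 0 := fun e0 => by
  obtain ⟨h0, h1, h2⟩ := h
  rw [wronskian_three_two, kahanMap_iterate_three,
    kahanMap_apply_two h2.delta_ne, kahanMap_apply_two h1.delta_ne, kahanMap_apply_two h0.delta_ne,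
    ← mul_sub] at e0
  have e0 := (mul_eq_zero.mp e0).resolve_left h0.m₃_ne
  have s0 := step_toPoint (ε := ε) ha h0.delta_ne
  have s1 := step_toPoint (ε := ε) ha h1.delta_ne
  have s2 := step_toPoint (ε := ε) ha h2.delta_ne
  have r1 := h1.regular (scale_ne ha hε) (parB_ne ha hb)
  have r2 := h2.regular (scale_ne ha hε) (parB_ne ha hb)
  have hne := h1.ζ_ne ha hb hε
  have hd := denW_toPoint k ε (kahanMap k ε x)
  rw [spin_kahanMap h1.delta_ne, spin_kahanMap h0.delta_ne] at s2 r2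
  rw [spin_kahanMap h0.delta_ne] at s1 r1 hd
  have e := ζ_three s0 s1 s2 r1 r2 hne
  have hz : (toPoint k ε (kahanMap k ε (kahanMap k ε (kahanMap k ε x)))).ζ
      = (toPoint k ε x).ζ := by
    simp only [toPoint, height]
    rw [sub_eq_zero.mp e0]
  rw [hz, sub_self, zero_mul, hd] at e
  refine mul_ne_zero (neg_ne_zero.mpr (sub_ne_zero.mpr hne)) ?_ e.symm
  exact_mod_cast h1.den_ne

end

end Kirchhoff

/-! ## Genericity of good points -/

namespace Kirchhoff

noncomputable section

variable (k : KirchhoffParams) (ε : ℝ)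

section rational

theorem isGenRat_spin : IsGenRat (spin k ε) := (IsGenRat.const _).mul (.coord 2)

theorem isGenRat_height : IsGenRat (height k ε) := (IsGenRat.const _).mul (.coord 5)

theorem isGenRat_realPart : IsGenRat (realPart k ε) :=
  (IsGenRat.const _).mul (((IsGenRat.coord 0).mul (.coord 3)).add ((IsGenRat.coord 1).mul (.coord 4)))

theorem isGenRat_areaPart : IsGenRat (areaPart k ε) :=
  (IsGenRat.const _).mul (((IsGenRat.coord 1).mul (.coord 3)).sub ((IsGenRat.coord 0).mul (.coord 4)))

theorem isGenRat_formH : IsGenRat (formH k ε) :=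
  (IsGenRat.const _).mul ((((IsGenRat.coord 0).pow 2).add ((IsGenRat.coord 1).pow 2)).add
    ((IsGenRat.const _).mul (((IsGenRat.coord 3).pow 2).add ((IsGenRat.coord 4).pow 2))))

theorem isGenRat_formE : IsGenRat (formE k ε) :=
  (IsGenRat.const _).mul (((IsGenRat.const _).mul
    (((IsGenRat.coord 0).pow 2).add ((IsGenRat.coord 1).pow 2))).add
    ((IsGenRat.const _).mul (((IsGenRat.coord 3).pow 2).add ((IsGenRat.coord 4).pow 2))))

theorem isGenRat_detR : IsGenRat (detR k ε) :=
  ((IsGenRat.const _).sub ((IsGenRat.const _).mul ((isGenRat_spin k ε).pow 2))).sub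
    ((IsGenRat.const _).mul ((isGenRat_height k ε).pow 2))

theorem isGenRat_realI : IsGenRat (realI k ε) :=
  ((IsGenRat.const _).add (isGenRat_formE k ε)).div (isGenRat_detR k ε)

theorem isGenRat_realσ : IsGenRat (realσ k ε) :=
  ((isGenRat_detR k ε).add (isGenRat_formH k ε)).add
    (((IsGenRat.const _).mul ((isGenRat_spin k ε).pow 2)).mul (isGenRat_realI k ε))

theorem isGenRat_polDet : IsGenRat fun x =>
    1 + parA k * (parA k - 1) * spin k ε x ^ 2 + parB k * height k ε x ^ 2 :=
  ((IsGenRat.const _).add ((IsGenRat.const _).mul ((isGenRat_spin k ε).pow 2))).add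
    ((IsGenRat.const _).mul ((isGenRat_height k ε).pow 2))

theorem isGenRat_slope : IsGenRat (slope k ε) :=
  (((isGenRat_spin k ε).mul (isGenRat_realPart k ε)).sub
    ((isGenRat_height k ε).mul (isGenRat_formH k ε))).add
    ((isGenRat_areaPart k ε).mul (isGenRat_polDet k ε))

theorem isGenRat_realV : IsGenRat (realV k ε) :=
  ((isGenRat_polDet k ε).mul (isGenRat_realσ k ε)).add
    (((IsGenRat.const _).mul (isGenRat_height k ε)).mul
      (((isGenRat_spin k ε).mul (isGenRat_realPart k ε)).sub
        ((isGenRat_height k ε).mul (isGenRat_formH k ε))))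

theorem isGenRat_numerJ : IsGenRat (numerJ k ε) :=
  (((IsGenRat.const _).add (((isGenRat_spin k ε).pow 2).mul ((isGenRat_realI k ε).pow 2))).add
    (isGenRat_formH k ε)).add ((IsGenRat.const _).mul ((isGenRat_areaPart k ε).pow 2))

theorem isGenRat_realJ : IsGenRat (realJ k ε) :=
  ((IsGenRat.const _).mul (isGenRat_numerJ k ε)).div (isGenRat_realV k ε)

theorem isGenRat_realN : IsGenRat (realN k ε) :=
  ((((isGenRat_realσ k ε).pow 2).sub (((IsGenRat.const _).mul ((isGenRat_height k ε).pow 2)).mul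
    ((isGenRat_areaPart k ε).pow 2))).div ((IsGenRat.const _).mul (isGenRat_realV k ε))).sub
    ((isGenRat_realJ k ε).mul (isGenRat_detR k ε))

theorem isGenRat_denJ₁ : IsGenRat (denJ₁ k ε) :=
  ((((isGenRat_realN k ε).pow 2).add ((IsGenRat.const _).mul (isGenRat_realN k ε))).add
    (((IsGenRat.const _).mul ((isGenRat_spin k ε).pow 2)).mul ((isGenRat_realJ k ε).pow 2))).sub
    ((((IsGenRat.const _).mul ((isGenRat_spin k ε).pow 2)).mul (isGenRat_realI k ε)).mul
      (isGenRat_realJ k ε))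

theorem isGenRat_numJ₁ : IsGenRat (numJ₁ k ε) :=
  ((isGenRat_realI k ε).mul (isGenRat_denJ₁ k ε)).add
    (((IsGenRat.const _).mul (isGenRat_realJ k ε)).mul
      (((isGenRat_realI k ε).mul ((isGenRat_realN k ε).add (.const _))).sub
        ((IsGenRat.const _).mul ((isGenRat_realN k ε).add (isGenRat_realJ k ε)))))

theorem isGenRat_realJ₁ : IsGenRat (realJ₁ k ε) := (isGenRat_numJ₁ k ε).div (isGenRat_denJ₁ k ε)

theorem isGenRat_sub : IsGenRat fun x =>
    realσ k ε x - 2 * parB k * height k ε x * areaPart k ε x :=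
  (isGenRat_realσ k ε).sub
    (((IsGenRat.const _).mul (isGenRat_height k ε)).mul (isGenRat_areaPart k ε))

theorem isGenRat_realCross : IsGenRat (realCross k ε) :=
  ((((isGenRat_areaPart k ε).pow 2).mul ((isGenRat_sub k ε).pow 2)).sub
    ((((IsGenRat.const _).mul (isGenRat_areaPart k ε)).mul (isGenRat_slope k ε)).mul
      (((IsGenRat.const _).mul (isGenRat_numerJ k ε)).sub (isGenRat_sub k ε)))).add
    (((isGenRat_slope k ε).pow 2).mul
      ((IsGenRat.const _).add (((isGenRat_spin k ε).pow 2).mul ((isGenRat_realI k ε).pow 2))))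

end rational

section smooth

@[fun_prop] theorem contDiff_spin : ContDiff ℝ 1 (spin k ε) := by unfold spin; fun_prop

@[fun_prop] theorem contDiff_height : ContDiff ℝ 1 (height k ε) := by unfold height; fun_prop

@[fun_prop] theorem contDiff_realPart : ContDiff ℝ 1 (realPart k ε) := by
  unfold realPart; fun_prop

@[fun_prop] theorem contDiff_areaPart : ContDiff ℝ 1 (areaPart k ε) := by
  unfold areaPart; fun_prop

@[fun_prop] theorem contDiff_formH : ContDiff ℝ 1 (formH k ε) := by unfold formH; fun_prop

@[fun_prop] theorem contDiff_formE : ContDiff ℝ 1 (formE k ε) := by unfold formE; fun_prop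

@[fun_prop] theorem contDiff_detR : ContDiff ℝ 1 (detR k ε) := by unfold detR; fun_prop

@[fun_prop] theorem contDiff_slope : ContDiff ℝ 1 (slope k ε) := by unfold slope; fun_prop

variable {k ε} {x : KState}

theorem contDiffAt_realI (h : detR k ε x ≠ 0) : ContDiffAt ℝ 1 (realI k ε) x := by
  unfold realI; fun_prop (disch := exact h)

theorem contDiffAt_realσ (h : detR k ε x ≠ 0) : ContDiffAt ℝ 1 (realσ k ε) x := by
  have := contDiffAt_realI h
  unfold realσ; fun_prop

theorem contDiffAt_realV (h : detR k ε x ≠ 0) : ContDiffAt ℝ 1 (realV k ε) x := by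
  have := contDiffAt_realσ h
  unfold realV; fun_prop

theorem contDiffAt_numerJ (h : detR k ε x ≠ 0) : ContDiffAt ℝ 1 (numerJ k ε) x := by
  have := contDiffAt_realI h
  unfold numerJ; fun_prop

theorem contDiffAt_realJ (h : detR k ε x ≠ 0) (hV : realV k ε x ≠ 0) :
    ContDiffAt ℝ 1 (realJ k ε) x := by
  have := contDiffAt_numerJ h
  have := contDiffAt_realV h
  unfold realJ; fun_prop (disch := exact hV)

theorem contDiffAt_realN (h : detR k ε x ≠ 0) (hV : realV k ε x ≠ 0) :
    ContDiffAt ℝ 1 (realN k ε) x := by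
  have := contDiffAt_realσ h
  have := contDiffAt_realV h
  have := contDiffAt_realJ h hV
  unfold realN; fun_prop (disch := exact mul_ne_zero two_ne_zero hV)

theorem contDiffAt_denJ₁ (h : detR k ε x ≠ 0) (hV : realV k ε x ≠ 0) :
    ContDiffAt ℝ 1 (denJ₁ k ε) x := by
  have := contDiffAt_realI h
  have := contDiffAt_realJ h hV
  have := contDiffAt_realN h hV
  unfold denJ₁; fun_prop

theorem contDiffAt_realJ₁ (h : detR k ε x ≠ 0) (hV : realV k ε x ≠ 0) (hd : denJ₁ k ε x ≠ 0) :
    ContDiffAt ℝ 1 (realJ₁ k ε) x := by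
  have := contDiffAt_realI h
  have := contDiffAt_realJ h hV
  have := contDiffAt_realN h hV
  have := contDiffAt_denJ₁ h hV
  unfold realJ₁ numJ₁; fun_prop (disch := exact hd)

theorem contDiffAt_realCross (h : detR k ε x ≠ 0) : ContDiffAt ℝ 1 (realCross k ε) x := by
  have := contDiffAt_realI h
  have := contDiffAt_realσ h
  have := contDiffAt_numerJ h
  unfold realCross; fun_prop

end smooth

/-! ### Values at points with `m₃ = p₃ = 0` -/

section slice

variable {k ε} {x : KState}

theorem detR_slice (h2 : x 2 = 0) (h5 : x 5 = 0) : detR k ε x = 1 := by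
  simp [detR, spin, height, h2, h5]

theorem realI_slice (h2 : x 2 = 0) (h5 : x 5 = 0) :
    realI k ε x = 2 * parA k - 1 + formE k ε x := by
  rw [realI, detR_slice h2 h5, div_one]

theorem realσ_slice (h2 : x 2 = 0) (h5 : x 5 = 0) : realσ k ε x = 1 + formH k ε x := by
  simp [realσ, detR_slice h2 h5, spin, h2]

theorem realV_slice (h2 : x 2 = 0) (h5 : x 5 = 0) : realV k ε x = 1 + formH k ε x := by
  simp [realV, realσ_slice h2 h5, spin, height, h2, h5]

theorem numerJ_slice (h2 : x 2 = 0) :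
    numerJ k ε x = 1 + formH k ε x + parB k * areaPart k ε x ^ 2 := by
  simp [numerJ, spin, h2]

theorem realJ_slice (h2 : x 2 = 0) (h5 : x 5 = 0) (h : 1 + formH k ε x ≠ 0) :
    realJ k ε x = 2 + 2 * parB k * areaPart k ε x ^ 2 / (1 + formH k ε x) := by
  rw [realJ, realV_slice h2 h5, numerJ_slice h2]
  field_simp

theorem realN_slice (h2 : x 2 = 0) (h5 : x 5 = 0) :
    realN k ε x = (1 + formH k ε x) / 2 - realJ k ε x := by
  rw [realN, realV_slice h2 h5, realσ_slice h2 h5, detR_slice h2 h5]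
  by_cases h : 1 + formH k ε x = 0
  · simp [h, height, h5]
  · simp [height, h5]
    field_simp

theorem denJ₁_slice (h2 : x 2 = 0) : denJ₁ k ε x = realN k ε x ^ 2 + 2 * realN k ε x := by
  simp [denJ₁, spin, h2]

theorem slope_slice (h2 : x 2 = 0) (h5 : x 5 = 0) : slope k ε x = areaPart k ε x := by
  simp [slope, spin, height, h2, h5]

theorem realCross_slice (h2 : x 2 = 0) (h5 : x 5 = 0) :
    realCross k ε x = areaPart k ε x ^ 2 * (formH k ε x ^ 2 - 4 * parB k * areaPart k ε x ^ 2) := by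
  rw [realCross, slope_slice h2 h5, numerJ_slice h2, realσ_slice h2 h5]
  simp [spin, height, h2, h5]
  ring

end slice

theorem formH_zero : formH k ε 0 = 0 := by simp [formH]

variable {k ε}

theorem generically_good (ha : k.a₁ ≠ 0) (hε : ε ≠ 0) : Generically (Good k ε) := by
  have hs := scale_ne ha hε
  have z2 : (0 : KState) 2 = 0 := rfl
  have z5 : (0 : KState) 5 = 0 := rfl
  have hR : detR k ε 0 = 1 := detR_slice z2 z5
  have hR' : detR k ε 0 ≠ 0 := by rw [hR]; exact one_ne_zero
  have hV : realV k ε 0 = 1 := by rw [realV_slice z2 z5, formH_zero, add_zero]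
  have hV' : realV k ε 0 ≠ 0 := by rw [hV]; exact one_ne_zero
  have hσ : realσ k ε 0 = 1 := by rw [realσ_slice z2 z5, formH_zero, add_zero]
  have hz : height k ε 0 = 0 := by simp [height]
  have hJ : realJ k ε 0 = 2 := by
    rw [realJ_slice z2 z5 (by rw [formH_zero]; norm_num)]; simp [areaPart]
  have hN : realN k ε 0 = -3 / 2 := by rw [realN_slice z2 z5, hJ, formH_zero]; norm_num
  have hd : denJ₁ k ε 0 ≠ 0 := by rw [denJ₁_slice z2, hN]; norm_num
  have g1 := generically_delta_ne (k := k) (ε := ε)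
  have g2 : Generically fun x => x 2 ≠ 0 := ⟨MvPolynomial.X 2, MvPolynomial.X_ne_zero 2, by simp⟩
  have g3 : Generically fun x => x 5 ≠ 0 := ⟨MvPolynomial.X 5, MvPolynomial.X_ne_zero 5, by simp⟩
  have g4 := (isGenRat_detR k ε).generically_ne (contDiff_detR k ε).continuous.continuousAt hR'
  have g5 := (isGenRat_realV k ε).generically_ne (contDiffAt_realV hR').continuousAt hV'
  have g6 := (isGenRat_sub k ε).generically_ne (x := 0)
    ((contDiffAt_realσ hR').continuousAt.sub (by unfold height areaPart; fun_prop))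
    (by rw [hσ, hz]; simp)
  have g7 := ((isGenRat_realσ k ε).add (((IsGenRat.const (2 * parB k)).mul
    (isGenRat_height k ε)).mul (isGenRat_areaPart k ε))).generically_ne (x := 0)
    ((contDiffAt_realσ hR').continuousAt.add (by unfold height areaPart; fun_prop))
    (by rw [hσ, hz]; simp)
  have g10 := (isGenRat_denJ₁ k ε).generically_ne (contDiffAt_denJ₁ hR' hV').continuousAt hd
  -- `slope` and `realCross` vanish at 0, so another point is required. At M = r, P = i, m₃ = p₃ = 0
  -- the latter equals r²(r² - β)², and r is chosen so that r² > |β|.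
  set r : ℝ := |parB k| + 2 with hr
  have hr0 : 0 < r := by positivity
  have hr1 : |parB k| < r ^ 2 := by nlinarith [abs_nonneg (parB k)]
  have hr2 := abs_lt.mp hr1
  let w : KState := ![r / scale k ε, 0, 0, 0, 1 / scale k ε, 0]
  have hw : areaPart k ε w = -r := by simp [areaPart, w]; field_simp
  have hwH : formH k ε w = r ^ 2 + parB k := by simp [formH, w]; field_simp
  have w2 : w 2 = 0 := rfl
  have w5 : w 5 = 0 := rfl
  have g8 := (isGenRat_slope k ε).generically_ne (x := w)
    (contDiff_slope k ε).continuous.continuousAt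
    (by rw [slope_slice w2 w5, hw]; exact neg_ne_zero.mpr hr0.ne')
  have g9 := (isGenRat_realCross k ε).generically_ne (x := w)
    (contDiffAt_realCross (by rw [detR_slice w2 w5]; exact one_ne_zero)).continuousAt
    (by
      rw [realCross_slice w2 w5, hw, hwH]
      refine mul_ne_zero (pow_ne_zero 2 (neg_ne_zero.mpr hr0.ne')) ?_
      have : r ^ 2 - parB k ≠ 0 := by linarith [hr2.2]
      have := pow_ne_zero 2 this
      contrapose! this
      linear_combination this)
  refine ((((((((((g1.and g2).and g3).and g4).and g5).and g6).and g7).and g8).and g9).and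
    g10)).mono ?_
  rintro x ⟨⟨⟨⟨⟨⟨⟨⟨⟨h1, h2⟩, h3⟩, h4⟩, h5⟩, h6⟩, h7⟩, h8⟩, h9⟩, h10⟩
  exact ⟨h1, h2, h3, h4, h5, h6, h7, h8, h9, h10⟩

theorem generically_good₃ (ha : k.a₁ ≠ 0) (hε : ε ≠ 0) : Generically (Good₃ k ε) := by
  have h := generically_good ha hε
  exact h.and (h.comp_kahanMap.and h.comp_kahanMap.comp_kahanMap)

end

end Kirchhoff

/-! ## Integrals of motion and null-spaces -/

namespace Kirchhoff

open MvPolynomial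

noncomputable section

variable {k : KirchhoffParams} {ε : ℝ} {x : KState}

theorem continuousAt_kahanMap_apply (h : delta k ε x ≠ 0) (i : Fin 6) :
    ContinuousAt (fun y => kahanMap k ε y i) x :=
  (continuous_apply i).continuousAt.comp (continuousAt_kahanMap h)

theorem continuousAt_J₀ (h : delta k ε x ≠ 0) (hC : C₁ k ε x ≠ 0) :
    ContinuousAt (J₀ k ε) x := by
  have hc := continuousAt_kahanMap_apply h
  have hx : ∀ i, ContinuousAt (fun y : KState => y i) x := fun i => (continuous_apply i).continuousAt
  refine ContinuousAt.div₀ ?_ ?_ hC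
  · exact (continuousAt_const.sub (continuousAt_const.mul
      (((hx 0).mul (hc 0)).add ((hx 1).mul (hc 1))))).sub (continuousAt_const.mul
      (((hx 3).mul (hc 3)).add ((hx 4).mul (hc 4))))
  · exact (continuousAt_const.sub (continuousAt_const.mul ((hx 2).pow 2))).sub
      (continuousAt_const.mul ((hx 5).mul (hc 5)))

theorem continuousAt_wronskian (h : ∀ i < 3, delta k ε ((kahanMap k ε)^[i] x) ≠ 0) (j : Fin 3) :
    ContinuousAt (wronskian k ε 3 j) x := by
  have hc : ∀ i, ContinuousAt (fun y => (kahanMap k ε)^[3] y i) x := fun i =>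
    (continuous_apply i).continuousAt.comp (continuousAt_iterate h)
  have hx : ∀ i, ContinuousAt (fun y : KState => y i) x := fun i => (continuous_apply i).continuousAt
  exact ((hc _).mul (hx _)).sub ((hx _).mul (hc _))

theorem continuousAt_ratFun {N D : MvPolynomial (Fin 6) ℝ} (h : eval x D ≠ 0) :
    ContinuousAt (ratFun N D) x :=
  ContinuousAt.div₀ (MvPolynomial.continuous_eval N).continuousAt
    (MvPolynomial.continuous_eval D).continuousAt h

/-- A generic invariance extends by continuity. -/
theorem isIntegral_of_generically {dom : Set KState} {F : KState → ℝ}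
    (hF : ∀ x ∈ dom, ContinuousAt F x) (h : Generically fun x => F (kahanMap k ε x) = F x) :
    IsIntegral k ε dom F := fun x hx hd hx' =>
  eq_of_generically (f := fun y => F (kahanMap k ε y))
    (ContinuousAt.comp (f := kahanMap k ε) (hF _ hx') (continuousAt_kahanMap hd)) (hF x hx) h

theorem isIntegral_I₀ (ha : k.a₁ ≠ 0) (hb : k.b₁ ≠ k.b₃) (hε : ε ≠ 0) :
    IsIntegral k ε {x | c₁ k ε x ≠ 0} (I₀ k ε) := by
  have hI : I₀ k ε = realI k ε := funext (I₀_eq ha)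
  rw [hI]
  refine isIntegral_of_generically (fun x hx => ?_) ?_
  · rw [Set.mem_ofPred_eq, c₁_eq ha] at hx
    exact (contDiffAt_realI hx).continuousAt
  · exact (generically_good₃ ha hε).mono fun x h => h.1.realI_eq ha hb hε h.2.1

theorem isIntegral_J₀ (ha : k.a₁ ≠ 0) (hb : k.b₁ ≠ k.b₃) (hε : ε ≠ 0) :
    IsIntegral k ε {x | delta k ε x ≠ 0 ∧ C₁ k ε x ≠ 0} (J₀ k ε) := by
  refine isIntegral_of_generically (fun x hx => continuousAt_J₀ hx.1 hx.2) ?_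
  refine (generically_good₃ ha hε).mono fun x h => ?_
  rw [h.2.1.J₀_eq ha hb hε h.2.2, h.1.J₀_eq ha hb hε h.2.1, h.1.realJ_eq ha hb hε h.2.1,
    h.1.realI_eq ha hb hε h.2.1]

theorem isIntegral_m₃ : IsIntegral k ε Set.univ m₃ := fun _ _ hd _ => kahanMap_apply_two hd

theorem isIntegral_ratFun (ha : k.a₁ ≠ 0) (hb : k.b₁ ≠ k.b₃) (hε : ε ≠ 0)
    {N D : MvPolynomial (Fin 6) ℝ} (hJ : Generically fun x => realJ₁ k ε x = ratFun N D x) :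
    IsIntegral k ε {x | eval x D ≠ 0} (ratFun N D) := by
  refine isIntegral_of_generically (fun x hx => continuousAt_ratFun hx) ?_
  refine (((generically_good₃ ha hε).and hJ).and (hJ.comp_kahanMap (k := k) (ε := ε))).mono ?_
  rintro x ⟨⟨h, h1⟩, h2⟩
  rw [← h1, ← h2, h.1.realJ₁_eq ha hb hε h.2.1]

theorem relation_ratFun (ha : k.a₁ ≠ 0) (hb : k.b₁ ≠ k.b₃) (hε : ε ≠ 0)
    {N D : MvPolynomial (Fin 6) ℝ} (hJ : Generically fun x => realJ₁ k ε x = ratFun N D x)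
    (hD : eval x D ≠ 0) (h : ∀ i < 3, delta k ε ((kahanMap k ε)^[i] x) ≠ 0) :
    wronskian k ε 3 0 x + wronskian k ε 3 1 x + ratFun N D x * wronskian k ε 3 2 x = 0 := by
  have hw := continuousAt_wronskian h
  refine eq_of_generically (f := fun x => wronskian k ε 3 0 x + wronskian k ε 3 1 x
    + ratFun N D x * wronskian k ε 3 2 x) (g := fun _ => 0)
    (((hw 0).add (hw 1)).add ((continuousAt_ratFun hD).mul (hw 2))) continuousAt_const ?_
  refine ((generically_good₃ ha hε).and hJ).mono ?_
  rintro x ⟨h, h1⟩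
  rw [← h1, h.relation ha hb hε]

/-! ### The null-spaces -/

theorem iter_natCast (hx : x ∈ orbitDomain k ε) (n : ℕ) :
    iter k ε n x = (kahanMap k ε)^[n] x := by
  have := iter_add_natCast hx 0 n
  rwa [zero_add, iter_zero] at this

theorem delta_iterate_ne (hx : x ∈ orbitDomain k ε) (n : ℕ) :
    delta k ε ((kahanMap k ε)^[n] x) ≠ 0 := iter_natCast hx n ▸ (hx n).1

theorem continuousAt_wronskian_iter (hx : x ∈ orbitDomain k ε) (i : ℤ) (j : Fin 3) :
    ContinuousAt (fun y => wronskian k ε 3 j (iter k ε i y)) x :=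
  ContinuousAt.comp (f := iter k ε i)
    (continuousAt_wronskian (fun n _ => delta_iterate_ne (iter_mem_orbitDomain hx i) n) j)
    (continuousAt_iter hx i)

/-- Constancy of J₁ along the orbit in cross-multiplied form. It needs no division, so it passes by
continuity from the dense set of good orbits to every point of `orbitDomain`. -/
theorem wronskian_proportional (ha : k.a₁ ≠ 0) (hb : k.b₁ ≠ k.b₃) (hε : ε ≠ 0)
    (hx : x ∈ orbitDomain k ε) (i j : ℤ) :
    (wronskian k ε 3 0 (iter k ε i x) + wronskian k ε 3 1 (iter k ε i x))
        * wronskian k ε 3 2 (iter k ε j x)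
      = (wronskian k ε 3 0 (iter k ε j x) + wronskian k ε 3 1 (iter k ε j x))
        * wronskian k ε 3 2 (iter k ε i x) := by
  have hc := continuousAt_wronskian_iter hx
  refine eq_of_dense (dense_orbitDomain_inter (k := k) (ε := ε) (generically_good₃ ha hε))
    (f := fun y => (wronskian k ε 3 0 (iter k ε i y) + wronskian k ε 3 1 (iter k ε i y))
        * wronskian k ε 3 2 (iter k ε j y))
    (g := fun y => (wronskian k ε 3 0 (iter k ε j y) + wronskian k ε 3 1 (iter k ε j y))
        * wronskian k ε 3 2 (iter k ε i y))
    (((hc i 0).add (hc i 1)).mul (hc j 2)) (((hc j 0).add (hc j 1)).mul (hc i 2)) ?_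
  rintro y ⟨hy, hg⟩
  have hstep : ∀ n, realJ₁ k ε (iter k ε (n + 1) y) = realJ₁ k ε (iter k ε n y) := fun n => by
    rw [iter_add_one hy]
    exact (hg n).1.realJ₁_eq ha hb hε (hg n).2.1
  have hconst : ∀ n, realJ₁ k ε (iter k ε n y) = realJ₁ k ε (iter k ε 0 y) := fun n => by
    induction n using Int.induction_on with
    | zero => rfl
    | succ n ih => rw [hstep, ih]
    | pred n ih => rw [← ih, ← hstep, sub_add_cancel]
  have hi := (hg i).relation ha hb hε
  have hj := (hg j).relation ha hb hε
  rw [hconst] at hi hj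
  linear_combination wronskian k ε 3 2 (iter k ε j y) * hi
    - wronskian k ε 3 2 (iter k ε i y) * hj

theorem mem_nullSpace {c : Fin 3 → ℝ} : c ∈ hkNullSpace (iter k ε) (wronskian k ε 3) x ↔
    ∀ i : ℤ, c 0 * wronskian k ε 3 0 (iter k ε i x) + c 1 * wronskian k ε 3 1 (iter k ε i x)
      + c 2 * wronskian k ε 3 2 (iter k ε i x) = 0 := by
  change (∀ i : ℤ, ∑ j, c j * wronskian k ε 3 j (iter k ε i x) = 0) ↔ _
  simp only [Fin.sum_univ_three]

theorem nullSpace_ne_bot (ha : k.a₁ ≠ 0) (hb : k.b₁ ≠ k.b₃) (hε : ε ≠ 0)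
    (hx : x ∈ orbitDomain k ε) : hkNullSpace (iter k ε) (wronskian k ε 3) x ≠ ⊥ := by
  rw [Submodule.ne_bot_iff]
  -- If W₃ vanishes along the whole orbit, (0, 0, 1) is a relation. Otherwise an index with W₃ ≠ 0
  -- provides the ratio.
  by_cases h : ∀ i, wronskian k ε 3 2 (iter k ε i x) = 0
  · refine ⟨![0, 0, 1], mem_nullSpace.mpr fun i => by simp [h i], fun e => ?_⟩
    have := congrFun e 2
    simp at this
  · push Not at h
    obtain ⟨j, hj⟩ := h
    refine ⟨![1, 1, -(wronskian k ε 3 0 (iter k ε j x) + wronskian k ε 3 1 (iter k ε j x))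
      / wronskian k ε 3 2 (iter k ε j x)], mem_nullSpace.mpr fun i => ?_, fun e => ?_⟩
    · have := wronskian_proportional ha hb hε hx i j
      simp
      field_simp
      linear_combination this
    · have := congrFun e 0
      simp at this

/-- The determinant that detects whether the null-space is one-dimensional. -/
def wronskianDet (k : KirchhoffParams) (ε : ℝ) (x : KState) : ℝ :=
  wronskian k ε 3 0 x * wronskian k ε 3 2 (kahanMap k ε x)
    - wronskian k ε 3 2 x * wronskian k ε 3 0 (kahanMap k ε x)

/-- After subtracting a multiple of (1, 1, J₁), a relation involves W₁ and W₃ only; its values at x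
and Φx form a system with determinant `wronskianDet`. -/
theorem nullSpace_eq_span (ha : k.a₁ ≠ 0) (hb : k.b₁ ≠ k.b₃) (hε : ε ≠ 0)
    (hx : x ∈ orbitDomain k ε) (h : Good₃ k ε x) (hdet : wronskianDet k ε x ≠ 0) :
    hkNullSpace (iter k ε) (wronskian k ε 3) x = Submodule.span ℝ {![1, 1, realJ₁ k ε x]} := by
  have hB := h.wronskian_ne ha hb hε
  have hrel := h.relation ha hb hε
  have hmem : ∀ i, wronskian k ε 3 0 (iter k ε i x) + wronskian k ε 3 1 (iter k ε i x)
      + realJ₁ k ε x * wronskian k ε 3 2 (iter k ε i x) = 0 := fun i => by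
    have := wronskian_proportional ha hb hε hx i 0
    rw [iter_zero] at this
    apply mul_right_cancel₀ hB
    linear_combination this + wronskian k ε 3 2 (iter k ε i x) * hrel
  refine le_antisymm (fun c hc => ?_) ?_
  · rw [mem_nullSpace] at hc
    have h0 := hc 0
    have h1 := hc 1
    have r1 := hmem 1
    rw [show (1 : ℤ) = 0 + 1 by norm_num, iter_add_one hx, iter_zero] at h1 r1
    rw [iter_zero] at h0
    have e1 : (c 0 - c 1) * wronskianDet k ε x = 0 := by
      rw [wronskianDet]
      linear_combination wronskian k ε 3 2 (kahanMap k ε x) * (h0 - c 1 * hrel)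
        - wronskian k ε 3 2 x * (h1 - c 1 * r1)
    have e1 := (mul_eq_zero.mp e1).resolve_right hdet
    have e2 : (c 2 - c 1 * realJ₁ k ε x) * wronskian k ε 3 2 x = 0 := by
      linear_combination h0 - c 1 * hrel - wronskian k ε 3 0 x * e1
    have e2 := (mul_eq_zero.mp e2).resolve_right hB
    refine Submodule.mem_span_singleton.mpr ⟨c 1, ?_⟩
    ext i
    fin_cases i <;> simp <;> linarith
  · rw [Submodule.span_singleton_le_iff_mem, mem_nullSpace]
    intro i
    simpa using hmem i

end

end Kirchhoff

/-! ## Generically the null-space is a line -/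

namespace Kirchhoff

open Filter Topology

noncomputable section

variable {k : KirchhoffParams} {ε : ℝ} {x y : KState}

theorem isGenRat_iterate (n : ℕ) (i : Fin 6) : IsGenRat fun x => (kahanMap k ε)^[n] x i := by
  induction n with
  | zero => simpa using IsGenRat.coord i
  | succ n ih => exact ih.comp_kahanMap (k := k) (ε := ε)

theorem isGenRat_wronskian (l : ℕ) (i : Fin 3) : IsGenRat (wronskian k ε l i) :=
  ((isGenRat_iterate l _).mul (.coord _)).sub ((IsGenRat.coord _).mul (isGenRat_iterate l _))

theorem isGenRat_wronskianDet : IsGenRat (wronskianDet k ε) :=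
  ((isGenRat_wronskian 3 0).mul ((isGenRat_wronskian 3 2).comp_kahanMap (k := k) (ε := ε))).sub
    ((isGenRat_wronskian 3 2).mul ((isGenRat_wronskian 3 0).comp_kahanMap (k := k) (ε := ε)))

/-- The reflection that conjugates the map to its inverse. -/
def reflect (x : KState) : KState := ![x 0, x 1, -x 2, x 3, x 4, -x 5]

theorem IsStep.reflect (h : IsStep k ε x y) :
    IsStep k (-ε) (Kirchhoff.reflect x) (Kirchhoff.reflect y) := by
  obtain ⟨h0, h1, h2, h3, h4, h5⟩ := h
  refine ⟨?_, ?_, ?_, ?_, ?_, ?_⟩ <;> simp [Kirchhoff.reflect] <;> linarith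

theorem kahanMap_reflect (h : delta k ε x ≠ 0) (h' : delta k (-ε) (reflect x) ≠ 0) :
    kahanMap k (-ε) (reflect x) = reflect (kahanMap k ε x) :=
  ((isStep_iff k (-ε) _ _ h').mp (isStep_kahanMap h).reflect).symm

/-- The expression `wronskianDet`, divided by `m₃`, in terms of five consecutive points. -/
def fivePoint (u v p q : KState) : ℝ :=
  (p 0 * u 3 - u 0 * p 3) * (v 5 - q 5) - (u 5 - p 5) * (q 0 * v 3 - v 0 * q 3)

theorem fivePoint_reflect (p q : KState) :
    fivePoint (reflect q) (reflect p) p q = 2 * (p 5 + q 5) * (q 0 * p 3 - p 0 * q 3) := by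
  simp [fivePoint, reflect]
  ring

theorem wronskianDet_eq {u v w p q : KState} (h0 : kahanMap k ε u = v) (h1 : kahanMap k ε v = w)
    (h2 : kahanMap k ε w = p) (h3 : kahanMap k ε p = q) (hu : delta k ε u ≠ 0)
    (hv : delta k ε v ≠ 0) (hw : delta k ε w ≠ 0) (hp : delta k ε p ≠ 0) :
    wronskianDet k ε u = u 2 * fivePoint u v p q := by
  have e0 := kahanMap_apply_two hu
  have e1 := kahanMap_apply_two hv
  have e2 := kahanMap_apply_two hw
  have e3 := kahanMap_apply_two hp
  rw [h0] at e0
  rw [h1] at e1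
  rw [h2] at e2
  rw [h3] at e3
  rw [wronskianDet, wronskian_three_zero, wronskian_three_two, wronskian_three_zero,
    wronskian_three_two, kahanMap_iterate_three, kahanMap_iterate_three, h0, h1, h2, h3, e3, e2, e1,
    e0, fivePoint]
  ring

/-- The five points are recentred at the middle one and the conserved factor m₃ is divided out
generically. Continuity then reaches points with m₃ = 0, where `wronskianDet` itself carries no
information. -/
theorem fivePoint_eq_zero (h : Generically fun x => wronskianDet k ε x = 0)
    (h1 : delta k ε y ≠ 0) (h2 : delta k ε (kahanMap k ε y) ≠ 0) (h3 : delta k (-ε) y ≠ 0)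
    (h4 : delta k (-ε) (kahanMap k (-ε) y) ≠ 0) :
    fivePoint (kahanMap k (-ε) (kahanMap k (-ε) y)) (kahanMap k (-ε) y) (kahanMap k ε y)
      (kahanMap k ε (kahanMap k ε y)) = 0 := by
  have c1 := continuousAt_kahanMap h1
  have c2 : ContinuousAt (fun y => kahanMap k ε (kahanMap k ε y)) y :=
    ContinuousAt.comp (f := kahanMap k ε) (continuousAt_kahanMap h2) c1
  have c3 := continuousAt_kahanMap h3
  have c4 : ContinuousAt (fun y => kahanMap k (-ε) (kahanMap k (-ε) y)) y :=
    ContinuousAt.comp (f := kahanMap k (-ε)) (continuousAt_kahanMap h4) c3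
  have d1 := fun i => (continuous_apply (A := fun _ : Fin 6 => ℝ) i).continuousAt.comp c1
  have d2 := fun i => (continuous_apply (A := fun _ : Fin 6 => ℝ) i).continuousAt.comp c2
  have d3 := fun i => (continuous_apply (A := fun _ : Fin 6 => ℝ) i).continuousAt.comp c3
  have d4 := fun i => (continuous_apply (A := fun _ : Fin 6 => ℝ) i).continuousAt.comp c4
  refine eq_of_generically (f := fun y => fivePoint (kahanMap k (-ε) (kahanMap k (-ε) y))
    (kahanMap k (-ε) y) (kahanMap k ε y) (kahanMap k ε (kahanMap k ε y))) (g := fun _ => 0)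
    ((((d1 0).mul (d4 3)).sub ((d4 0).mul (d1 3))).mul ((d3 5).sub (d2 5)) |>.sub
      (((d4 5).sub (d1 5)).mul (((d2 0).mul (d3 3)).sub ((d3 0).mul (d2 3)))))
    continuousAt_const ?_
  have gd := generically_delta_ne (k := k) (ε := ε)
  have gd' := generically_delta_ne (k := k) (ε := -ε)
  have g2 : Generically fun x => x 2 ≠ 0 := ⟨MvPolynomial.X 2, MvPolynomial.X_ne_zero 2, by simp⟩
  have gh := ((h.and gd).and g2)
  have k1 := (gh.comp_kahanMap (k := k) (ε := -ε)).comp_kahanMap (k := k) (ε := -ε)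
  have k2 := gd'.and ((gd'.and gd).comp_kahanMap (k := k) (ε := -ε))
  have k3 := gd.and (gd.comp_kahanMap (k := k) (ε := ε))
  refine ((k1.and k2).and k3).mono ?_
  rintro y ⟨⟨⟨⟨e0, e1⟩, e2⟩, e3, e4, e5⟩, e6, e7⟩
  have b1 := kahanMap_neg_kahanMap (ε := -ε) e3 (by rwa [neg_neg])
  have b2 := kahanMap_neg_kahanMap (ε := -ε) e4 (by rwa [neg_neg])
  rw [neg_neg] at b1 b2
  have := wronskianDet_eq b2 b1 rfl rfl e1 e5 e6 e7
  rw [e0] at this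
  exact (mul_eq_zero.mp this.symm).resolve_left e2

/-- Two steps from a special point with `m₃ = p₃ = 0`. -/
theorem two_steps (ha : k.a₁ ≠ 0) (hb : k.b₁ ≠ k.b₃) (hε : ε ≠ 0) {η : ℝ} (hη : η ≠ 0)
    {p q : KState} (h : IsStep k ε ![η, 0, 0, η, η, 0] p) (h' : IsStep k ε p q)
    (hs : |ε * (k.b₃ - k.b₁) * (ε * k.a₁) * p 5 ^ 2| < 1 / 2)
    (hL : |ε * k.a₁ * η ^ 2 * (2 * (ε * (k.b₃ - k.b₁)) + ε * k.a₁)| < 1 / 2) :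
    2 * (p 5 + q 5) * (q 0 * p 3 - p 0 * q 3) ≠ 0 := by
  obtain ⟨h0, h1, h2, h3, h4, h5⟩ := h
  obtain ⟨g0, g1, g2, g3, g4, g5⟩ := h'
  simp at h0 h1 h2 h3 h4 h5
  have g2' : q 2 = 0 := by linarith
  rw [h2, g2'] at g0 g1 g3 g4
  simp only [h2] at h0 h1 h3 h4
  have e1_ne : ε * (k.b₃ - k.b₁) ≠ 0 := mul_ne_zero hε (sub_ne_zero.mpr hb.symm)
  have e2_ne : ε * k.a₁ ≠ 0 := mul_ne_zero hε ha
  have hb' : k.b₁ - k.b₃ = -(k.b₃ - k.b₁) := by ring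
  rw [hb'] at h1 g1
  simp only [mul_neg, neg_mul] at h1 g1
  generalize ε * (k.b₃ - k.b₁) = e₁ at *
  generalize ε * k.a₁ = e₂ at *
  generalize p 0 = m0 at *
  generalize p 1 = m1 at *
  generalize p 3 = p3 at *
  generalize p 4 = p4 at *
  generalize p 5 = z at *
  generalize q 5 = z' at *
  rw [abs_lt] at hs hL
  have hm0 : m0 = η + e₁ * η * z := by linarith
  have hm1 : m1 = -(e₁ * η * z) := by linarith
  have hp3 : η = p3 := by linarith
  have hp4 : p4 = η + e₂ * η * z := by linarith
  subst hm0 hm1 hp3 hp4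
  -- With m₃ = 0 the second step splits into two 2 × 2 systems of determinant 1 - e₁e₂z², one for
  -- (m₁, p₂) and one for (m₂, p₁).
  have hb1 : 1 - e₁ * e₂ * z ^ 2 ≠ 0 := by linarith [hs.2]
  have s0 : q 0 * (1 - e₁ * e₂ * z ^ 2) = (η + e₁ * η * z) * (1 + e₁ * e₂ * z * z')
      + e₁ * (z + z') * (η + e₂ * η * z) := by
    linear_combination g0 + e₁ * z * g4
  have s4 : q 4 * (1 - e₁ * e₂ * z ^ 2) = (η + e₂ * η * z) * (1 + e₁ * e₂ * z * z')
      + e₂ * (z + z') * (η + e₁ * η * z) := by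
    linear_combination g4 + e₂ * z * g0
  have s1 : q 1 * (1 - e₁ * e₂ * z ^ 2) = -(e₁ * η * z) * (1 + e₁ * e₂ * z * z')
      - e₁ * (z + z') * η := by
    linear_combination g1 - e₁ * z * g3
  have s3 : q 3 * (1 - e₁ * e₂ * z ^ 2) = η * (1 + e₁ * e₂ * z * z')
      + e₂ * (z + z') * (e₁ * η * z) := by
    linear_combination g3 - e₂ * z * g1
  have hw : q 0 * η - (η + e₁ * η * z) * q 3 = e₁ * η ^ 2 * (z + z') := by
    apply mul_right_cancel₀ hb1
    linear_combination η * s0 - (η + e₁ * η * z) * s3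
  -- If z' = -z, the second step leaves M and P unchanged. The two equations for p₃ then make a
  -- product of two factors, each below 3/2, equal to 4.
  have hz : z + z' ≠ 0 := fun e => by
    obtain rfl : z' = -z := by linarith
    have t0 : q 0 = η + e₁ * η * z := by
      apply mul_right_cancel₀ hb1; linear_combination s0
    have t1 : q 1 = -(e₁ * η * z) := by
      apply mul_right_cancel₀ hb1; linear_combination s1
    have t3 : q 3 = η := by
      apply mul_right_cancel₀ hb1; linear_combination s3
    have t4 : q 4 = η + e₂ * η * z := by
      apply mul_right_cancel₀ hb1; linear_combination s4
    rw [t0, t1, t3, t4] at g5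
    have key : (e₂ * η ^ 2) * ((1 - e₁ * e₂ * z ^ 2)
        * (1 + e₂ * η ^ 2 * (2 * e₁ + e₂)) - 4) = 0 := by
      linear_combination (1 + e₂ * η ^ 2 * (2 * e₁ + e₂)) * (h5 - g5 / 2) - 2 * h5
    have := (mul_eq_zero.mp key).resolve_left (mul_ne_zero e2_ne (pow_ne_zero 2 hη))
    nlinarith [hs.1, hs.2, hL.1, hL.2]
  rw [hw]
  exact mul_ne_zero (mul_ne_zero two_ne_zero hz)
    (mul_ne_zero (mul_ne_zero e1_ne (pow_ne_zero 2 hη)) hz)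

theorem generically_wronskianDet_ne (ha : k.a₁ ≠ 0) (hb : k.b₁ ≠ k.b₃) (hε : ε ≠ 0) :
    Generically fun x => wronskianDet k ε x ≠ 0 := by
  refine (isGenRat_wronskianDet (k := k) (ε := ε)).generically_eq_zero_or_ne.resolve_left
    fun h => ?_
  -- Points fixed by `reflect`, tending to the fixed point 0: their backward orbit is the reflection
  -- of the forward one, and near 0 all the required values of Δ are non-zero.
  let w : ℝ → KState := fun η => ![η, 0, 0, η, η, 0]
  have hw : Tendsto w (𝓝[≠] 0) (𝓝 0) := by
    have hc : Continuous w := by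
      refine continuous_pi fun i => ?_
      fin_cases i <;> simp [w] <;> fun_prop
    have : w 0 = 0 := by
      funext i; fin_cases i <;> rfl
    exact this ▸ (hc.tendsto 0).mono_left nhdsWithin_le_nhds
  have hcomp : ∀ ε', ContinuousAt (fun y => delta k ε' (kahanMap k ε' y)) 0 := fun ε' =>
    ContinuousAt.comp (f := kahanMap k ε') (continuous_delta k ε').continuousAt
      continuousAt_kahanMap_zero
  have E : ∀ ε', ∀ᶠ y in 𝓝 (0 : KState),
      delta k ε' y ≠ 0 ∧ delta k ε' (kahanMap k ε' y) ≠ 0 := fun ε' =>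
    ((continuous_delta k ε').continuousAt.eventually_ne (by simp)).and
      ((hcomp ε').eventually_ne (by simp))
  have E5 : ∀ᶠ y in 𝓝 (0 : KState),
      |ε * (k.b₃ - k.b₁) * (ε * k.a₁) * kahanMap k ε y 5 ^ 2| < 1 / 2 := by
    have hc : ContinuousAt (fun y => |ε * (k.b₃ - k.b₁) * (ε * k.a₁) * kahanMap k ε y 5 ^ 2|) 0 :=
      (continuousAt_const.mul ((continuousAt_kahanMap_apply (by simp) 5).pow 2)).abs
    exact hc.eventually_lt continuousAt_const (by simp)
  have E6 : ∀ᶠ η in 𝓝[≠] (0 : ℝ),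
      |ε * k.a₁ * η ^ 2 * (2 * (ε * (k.b₃ - k.b₁)) + ε * k.a₁)| < 1 / 2 := by
    have hc : ContinuousAt
        (fun η : ℝ => |ε * k.a₁ * η ^ 2 * (2 * (ε * (k.b₃ - k.b₁)) + ε * k.a₁)|) 0 := by fun_prop
    exact (hc.eventually_lt continuousAt_const (by simp)).filter_mono nhdsWithin_le_nhds
  obtain ⟨η, ⟨⟨⟨⟨h1, h2⟩, h3, h4⟩, h5⟩, h6⟩, hη⟩ :=
    ((((hw.eventually (E ε)).and (hw.eventually (E (-ε)))).and (hw.eventually E5)).and E6).and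
      self_mem_nhdsWithin |>.exists
  have hr : reflect (w η) = w η := by
    funext i; fin_cases i <;> simp [reflect, w]
  have r1 : kahanMap k (-ε) (w η) = reflect (kahanMap k ε (w η)) := by
    have := kahanMap_reflect h1 (by rwa [hr])
    rwa [hr] at this
  have r2 : kahanMap k (-ε) (reflect (kahanMap k ε (w η)))
      = reflect (kahanMap k ε (kahanMap k ε (w η))) := kahanMap_reflect h2 (by rwa [← r1])
  have h0 := fivePoint_eq_zero h h1 h2 h3 h4
  rw [r1, r2, fivePoint_reflect] at h0
  exact two_steps ha hb hε hη (isStep_kahanMap h1) (isStep_kahanMap h2) h5 h6 h0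

end

end Kirchhoff

/-! ## Linear independence of the Wronskians -/

namespace Kirchhoff

noncomputable section

variable {k : KirchhoffParams} {ε : ℝ} {x : KState}

theorem realJ₁_slice (h2 : x 2 = 0) (h5 : x 5 = 0) (ht : areaPart k ε x = 0)
    (h : 1 + formH k ε x ≠ 0) (h' : formH k ε x - 3 ≠ 0) :
    realJ₁ k ε x = 2 * parA k - 1
      + formE k ε x * (formH k ε x + 13) / (formH k ε x - 3) := by
  have hJ : realJ k ε x = 2 := by rw [realJ_slice h2 h5 h, ht]; simp
  have hN := realN_slice (k := k) (ε := ε) h2 h5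
  rw [hJ] at hN
  have hd : denJ₁ k ε x = (1 + formH k ε x) * (formH k ε x - 3) / 4 := by
    rw [denJ₁_slice h2, hN]; ring
  rw [realJ₁, numJ₁, hd, hJ, hN, realI_slice h2 h5]
  field_simp
  ring

/-- A point at which the formula of `realJ₁_slice` gives a value different from that at `0`. -/
theorem exists_slice_point (ha : k.a₁ ≠ 0) (hb : k.b₁ ≠ k.b₃) (hε : ε ≠ 0) :
    ∃ w : KState, w 2 = 0 ∧ w 5 = 0 ∧ areaPart k ε w = 0 ∧ formE k ε w ≠ 0 ∧
      1 + formH k ε w ≠ 0 ∧ formH k ε w - 3 ≠ 0 ∧ formH k ε w + 13 ≠ 0 := by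
  have hs := scale_ne ha hε
  have hB := parB_ne ha hb
  by_cases hA : parA k = 1
  -- For a₃ = a₁ the form `formE` ignores M, so P is used, small enough that |`formH`| < 1.
  -- Otherwise M alone suffices.
  · have hpos : 0 < 1 + |parB k| := by positivity
    let w : KState := ![0, 0, 0, 1 / (scale k ε * (1 + |parB k|)), 0, 0]
    have hH : formH k ε w = parB k / (1 + |parB k|) ^ 2 := by
      simp [formH, w]; field_simp
    have hE : formE k ε w = parB k / (1 + |parB k|) ^ 2 := by
      simp [formE, w, hA]; field_simp
    have habs : |formH k ε w| < 1 := by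
      rw [hH, abs_div, abs_of_pos (pow_pos hpos 2), div_lt_one (pow_pos hpos 2)]
      nlinarith [abs_nonneg (parB k)]
    rw [abs_lt] at habs
    refine ⟨w, rfl, rfl, by simp [areaPart, w], ?_, ?_, ?_, ?_⟩
    · rw [hE]; exact div_ne_zero hB (pow_pos hpos 2).ne'
    all_goals intro e; linarith [habs.1, habs.2]
  · let w : KState := ![1 / scale k ε, 0, 0, 0, 0, 0]
    have hH : formH k ε w = 1 := by simp [formH, w]; field_simp
    have hE : formE k ε w = parA k - 1 := by simp [formE, w]; field_simp
    refine ⟨w, rfl, rfl, by simp [areaPart, w], ?_, ?_, ?_, ?_⟩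
    · rw [hE]; exact sub_ne_zero.mpr hA
    all_goals rw [hH]; norm_num

theorem continuousAt_realJ₁_slice (h2 : x 2 = 0) (h5 : x 5 = 0) (ht : areaPart k ε x = 0)
    (h : 1 + formH k ε x ≠ 0) (h' : formH k ε x - 3 ≠ 0) : ContinuousAt (realJ₁ k ε) x := by
  refine (contDiffAt_realJ₁ ?_ ?_ ?_).continuousAt
  · rw [detR_slice h2 h5]; exact one_ne_zero
  · rwa [realV_slice h2 h5]
  · have hJ : realJ k ε x = 2 := by rw [realJ_slice h2 h5 h, ht]; simp
    rw [denJ₁_slice h2, realN_slice h2 h5, hJ]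
    have := mul_ne_zero h h'
    contrapose! this
    linear_combination 4 * this

/-- A relation lies in every null-space, hence is a multiple of (1, 1, J₁(x)) on a dense set. Unless
it is zero, J₁ is constant there, and continuity contradicts its different values at 0 and at the
point of `exists_slice_point`. -/
theorem linearIndependent_wronskian (ha : k.a₁ ≠ 0) (hb : k.b₁ ≠ k.b₃) (hε : ε ≠ 0) :
    LinearIndependent ℝ (fun j => (orbitDomain k ε).domRestrict (wronskian k ε 3 j)) := by
  rw [Fintype.linearIndependent_iff]
  intro g hg
  have hK : ∀ x ∈ orbitDomain k ε, g ∈ hkNullSpace (iter k ε) (wronskian k ε 3) x := by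
    intro x hx i
    have := congrFun hg ⟨iter k ε i x, iter_mem_orbitDomain hx i⟩
    simpa using this
  have hd := dense_orbitDomain_inter (k := k) (ε := ε)
    ((generically_good₃ ha hε).and (generically_wronskianDet_ne ha hb hε))
  have hg1 : ∀ x ∈ {x | x ∈ orbitDomain k ε ∧ ∀ i, Good₃ k ε (iter k ε i x) ∧
      wronskianDet k ε (iter k ε i x) ≠ 0}, g 1 = g 0 ∧ g 2 = g 0 * realJ₁ k ε x := by
    rintro x ⟨hx, h⟩
    have h0 := h 0
    rw [iter_zero] at h0
    have hm := hK x hx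
    rw [nullSpace_eq_span ha hb hε hx h0.1 h0.2, Submodule.mem_span_singleton] at hm
    obtain ⟨r, rfl⟩ := hm
    simp
  have hg0 : g 0 = 0 := by
    by_contra h0
    obtain ⟨w, w2, w5, wt, wE, w1, w3, w13⟩ := exists_slice_point ha hb hε
    have z2 : (0 : KState) 2 = 0 := rfl
    have z5 : (0 : KState) 5 = 0 := rfl
    have zH := formH_zero k ε
    have zt : areaPart k ε 0 = 0 := by simp [areaPart]
    have zE : formE k ε 0 = 0 := by simp [formE]
    have z1 : 1 + formH k ε 0 ≠ 0 := by rw [zH]; norm_num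
    have z3 : formH k ε 0 - 3 ≠ 0 := by rw [zH]; norm_num
    have hval : ∀ x ∈ {x | x ∈ orbitDomain k ε ∧ ∀ i, Good₃ k ε (iter k ε i x) ∧
        wronskianDet k ε (iter k ε i x) ≠ 0}, realJ₁ k ε x = g 2 / g 0 := fun x hx => by
      rw [(hg1 x hx).2, mul_div_cancel_left₀ _ h0]
    have e1 := eq_of_dense hd (continuousAt_realJ₁_slice w2 w5 wt w1 w3)
      (continuousAt_const (y := g 2 / g 0)) hval
    have e2 := eq_of_dense hd (continuousAt_realJ₁_slice z2 z5 zt z1 z3)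
      (continuousAt_const (y := g 2 / g 0)) hval
    rw [realJ₁_slice w2 w5 wt w1 w3] at e1
    rw [realJ₁_slice z2 z5 zt z1 z3, zE, zero_mul, zero_div, add_zero] at e2
    have := div_ne_zero (mul_ne_zero wE w13) w3
    exact this (by linarith)
  obtain ⟨x, hx⟩ := hd.nonempty
  obtain ⟨h1, h2⟩ := hg1 x hx
  rw [hg0] at h1 h2
  rw [zero_mul] at h2
  intro i
  fin_cases i
  exacts [hg0, h1, h2]

end

end Kirchhoff

/-! ## Functional independence -/

namespace Kirchhoff

open Filter Topology

noncomputable section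

theorem Generically.eventually {P : KState → Prop} (h : Generically P) :
    Generically fun x => ∀ᶠ y in 𝓝 x, P y := by
  obtain ⟨q, hq, h⟩ := h
  exact ⟨q, hq, fun x hx => by filter_upwards [(isOpen_eval_ne q).mem_nhds hx] with y hy using h y hy⟩

theorem hasDerivAt_line {F : KState → ℝ} {x : KState} (hF : DifferentiableAt ℝ F x) (V : KState) :
    HasDerivAt (fun t : ℝ => F (x + t • V)) (fderiv ℝ F x V) 0 :=
  hF.hasFDerivAt.hasLineDerivAt V

theorem fderiv_eq_of_line {F : KState → ℝ} {x V : KState} (hF : ContDiffAt ℝ 1 F x) {g : ℝ → ℝ}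
    {g' : ℝ} (hg : HasDerivAt g g' 0) (h : ∀ᶠ s in 𝓝 (0 : ℝ), F (x + s • V) = g s) :
    fderiv ℝ F x V = g' :=
  (hasDerivAt_line (hF.differentiableAt one_ne_zero) V).unique
    (hg.congr_of_eventuallyEq h)

variable {k : KirchhoffParams} {ε : ℝ} {x : KState}

theorem isGenRat_m₃ : IsGenRat m₃ := .coord 2

theorem contDiff_m₃ : ContDiff ℝ 1 m₃ := by unfold m₃; fun_prop

/-- For m₃ = p₃ = 0, I and J + N are affine in |M|², |P|², while J also involves `areaPart`. To
first order V₀ rotates P, V₁ scales M, V₂ scales P and V₃ moves m₃. -/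
theorem functionallyIndependent_aux (ha : k.a₁ ≠ 0) (hb : k.b₁ ≠ k.b₃) (hε : ε ≠ 0) :
    FunctionallyIndependent ![realI k ε, realJ k ε, realN k ε, m₃] := by
  have hs := scale_ne ha hε
  have hB := parB_ne ha hb
  set r : ℝ := |parB k| + 2 with hr
  have hr0 : 0 < r := by positivity
  have hσ : 1 + (r ^ 2 + 2 * parB k) ≠ 0 := by
    nlinarith [abs_nonneg (parB k), neg_abs_le (parB k)]
  let w : KState := ![r / scale k ε, 0, 0, 1 / scale k ε, 1 / scale k ε, 0]
  let V₀ : KState := ![0, 0, 0, -1 / scale k ε, 1 / scale k ε, 0]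
  let V₁ : KState := ![1 / scale k ε, 0, 0, 0, 0, 0]
  let V₂ : KState := ![0, 0, 0, 1 / scale k ε, 1 / scale k ε, 0]
  let V₃ : KState := ![0, 0, 1, 0, 0, 0]
  have w2 : w 2 = 0 := rfl
  have w5 : w 5 = 0 := rfl
  have hR : detR k ε w ≠ 0 := by rw [detR_slice w2 w5]; exact one_ne_zero
  have wH : formH k ε w = r ^ 2 + 2 * parB k := by simp [formH, w]; field_simp; ring
  have hV : realV k ε w ≠ 0 := by rwa [realV_slice w2 w5, wH]
  have cI := contDiffAt_realI hR
  have cJ := contDiffAt_realJ hR hV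
  have cN := contDiffAt_realN hR hV
  have cm := contDiff_m₃.contDiffAt (x := w)
  have l02 : ∀ s : ℝ, (w + s • V₀) 2 = 0 := fun s => by simp [w, V₀]
  have l05 : ∀ s : ℝ, (w + s • V₀) 5 = 0 := fun s => by simp [w, V₀]
  have l12 : ∀ s : ℝ, (w + s • V₁) 2 = 0 := fun s => by simp [w, V₁]
  have l15 : ∀ s : ℝ, (w + s • V₁) 5 = 0 := fun s => by simp [w, V₁]
  have l22 : ∀ s : ℝ, (w + s • V₂) 2 = 0 := fun s => by simp [w, V₂]
  have l25 : ∀ s : ℝ, (w + s • V₂) 5 = 0 := fun s => by simp [w, V₂]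
  have H0 : ∀ s : ℝ, formH k ε (w + s • V₀) = r ^ 2 + parB k * (2 + 2 * s ^ 2) := fun s => by
    simp [formH, w, V₀]; field_simp; ring
  have H1 : ∀ s : ℝ, formH k ε (w + s • V₁) = (r + s) ^ 2 + parB k * 2 := fun s => by
    simp [formH, w, V₁]; field_simp; ring
  have H2 : ∀ s : ℝ, formH k ε (w + s • V₂) = r ^ 2 + parB k * (2 * (1 + s) ^ 2) := fun s => by
    simp [formH, w, V₂]; field_simp; ring
  have E0 : ∀ s : ℝ, formE k ε (w + s • V₀)
      = (parA k - 1) * r ^ 2 + parA k * parB k * (2 + 2 * s ^ 2) := fun s => by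
    simp [formE, w, V₀]; field_simp; ring
  have E1 : ∀ s : ℝ, formE k ε (w + s • V₁)
      = (parA k - 1) * (r + s) ^ 2 + parA k * parB k * 2 := fun s => by
    simp [formE, w, V₁]; field_simp; ring
  have E2 : ∀ s : ℝ, formE k ε (w + s • V₂)
      = (parA k - 1) * r ^ 2 + parA k * parB k * (2 * (1 + s) ^ 2) := fun s => by
    simp [formE, w, V₂]; field_simp; ring
  have T0 : ∀ s : ℝ, areaPart k ε (w + s • V₀) = -r * (1 + s) := fun s => by
    simp [areaPart, w, V₀]; field_simp
  have hid := hasDerivAt_id (0 : ℝ)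
  have sq1 : HasDerivAt (fun s : ℝ => s ^ 2) 0 0 := by simpa using hasDerivAt_pow 2 (0 : ℝ)
  have sq2 : HasDerivAt (fun s : ℝ => (1 + s) ^ 2) 2 0 := by
    have := (hid.const_add 1).pow 2
    simp at this
    exact this
  have sq3 : HasDerivAt (fun s : ℝ => (r + s) ^ 2) (2 * r) 0 := by
    have := (hid.const_add r).pow 2
    simp at this
    exact this
  have dI0 : fderiv ℝ (realI k ε) w V₀ = 0 := by
    refine fderiv_eq_of_line cI (g := fun s => 2 * parA k - 1 + ((parA k - 1) * r ^ 2
      + parA k * parB k * (2 + 2 * s ^ 2))) ?_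
      (Eventually.of_forall fun s => by rw [realI_slice (l02 s) (l05 s), E0])
    simpa using ((((sq1.const_mul 2).const_add 2).const_mul (parA k * parB k)).const_add
      ((parA k - 1) * r ^ 2)).const_add (2 * parA k - 1)
  have dI1 : fderiv ℝ (realI k ε) w V₁ = (parA k - 1) * (2 * r) := by
    refine fderiv_eq_of_line cI (g := fun s => 2 * parA k - 1 + ((parA k - 1) * (r + s) ^ 2
      + parA k * parB k * 2)) ?_
      (Eventually.of_forall fun s => by rw [realI_slice (l12 s) (l15 s), E1])
    exact ((sq3.const_mul (parA k - 1)).add_const _).const_add (2 * parA k - 1)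
  have dI2 : fderiv ℝ (realI k ε) w V₂ = parA k * parB k * (2 * 2) := by
    refine fderiv_eq_of_line cI (g := fun s => 2 * parA k - 1 + ((parA k - 1) * r ^ 2
      + parA k * parB k * (2 * (1 + s) ^ 2))) ?_
      (Eventually.of_forall fun s => by rw [realI_slice (l22 s) (l25 s), E2])
    exact (((sq2.const_mul 2).const_mul (parA k * parB k)).const_add _).const_add (2 * parA k - 1)
  have hadd : ∀ V, fderiv ℝ (fun y => realJ k ε y + realN k ε y) w V
      = fderiv ℝ (realJ k ε) w V + fderiv ℝ (realN k ε) w V := fun V => by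
    rw [fderiv_fun_add (cJ.differentiableAt one_ne_zero) (cN.differentiableAt one_ne_zero)]
    rfl
  have hsum : ∀ y : KState, y 2 = 0 → y 5 = 0 →
      realJ k ε y + realN k ε y = (1 + formH k ε y) / 2 := fun y h2 h5 => by
    rw [realN_slice h2 h5]; ring
  have dS0 : fderiv ℝ (realJ k ε) w V₀ + fderiv ℝ (realN k ε) w V₀ = 0 := by
    rw [← hadd]
    refine fderiv_eq_of_line (cJ.add cN) (g := fun s => (1 + (r ^ 2
      + parB k * (2 + 2 * s ^ 2))) / 2) ?_
      (Eventually.of_forall fun s => by rw [hsum _ (l02 s) (l05 s), H0])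
    simpa using (((((sq1.const_mul 2).const_add 2).const_mul (parB k)).const_add
      (r ^ 2)).const_add 1).div_const 2
  have dS1 : fderiv ℝ (realJ k ε) w V₁ + fderiv ℝ (realN k ε) w V₁ = r := by
    rw [← hadd]
    refine fderiv_eq_of_line (cJ.add cN) (g := fun s => (1 + ((r + s) ^ 2 + parB k * 2)) / 2) ?_
      (Eventually.of_forall fun s => by rw [hsum _ (l12 s) (l15 s), H1])
    exact (((sq3.add_const (parB k * 2)).const_add 1).div_const 2).congr_deriv (by ring)
  have dS2 : fderiv ℝ (realJ k ε) w V₂ + fderiv ℝ (realN k ε) w V₂ = 2 * parB k := by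
    rw [← hadd]
    refine fderiv_eq_of_line (cJ.add cN) (g := fun s => (1 + (r ^ 2
      + parB k * (2 * (1 + s) ^ 2))) / 2) ?_
      (Eventually.of_forall fun s => by rw [hsum _ (l22 s) (l25 s), H2])
    exact (((((sq2.const_mul 2).const_mul (parB k)).const_add (r ^ 2)).const_add 1).div_const
      2).congr_deriv (by ring)
  have dJ0 : fderiv ℝ (realJ k ε) w V₀ ≠ 0 := by
    have hden : HasDerivAt (fun s : ℝ => 1 + (r ^ 2 + parB k * (2 + 2 * s ^ 2))) 0 0 := by
      simpa using ((((sq1.const_mul 2).const_add 2).const_mul (parB k)).const_add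
        (r ^ 2)).const_add 1
    have h0 : 1 + (r ^ 2 + parB k * (2 + 2 * (0 : ℝ) ^ 2)) ≠ 0 := by
      rwa [zero_pow two_ne_zero, mul_zero, add_zero, mul_comm]
    have hJ : HasDerivAt (fun s : ℝ => 2 + 2 * parB k * (-r * (1 + s)) ^ 2
        / (1 + (r ^ 2 + parB k * (2 + 2 * s ^ 2)))) _ 0 :=
      (((((hid.const_add 1).const_mul (-r)).pow 2).const_mul (2 * parB k)).div hden h0).const_add 2
    rw [fderiv_eq_of_line cJ hJ ?_]
    · simp
      exact ⟨⟨hB, hr0.ne'⟩, by rwa [mul_comm]⟩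
    · filter_upwards [hden.continuousAt.eventually_ne h0] with s hs'
      rw [realJ_slice (l02 s) (l05 s) (by rwa [H0]), T0, H0]
  have dm : ∀ V : KState, fderiv ℝ m₃ w V = V 2 := fun V => by
    refine fderiv_eq_of_line cm (g := fun s => w 2 + s * V 2) ?_ (Eventually.of_forall fun s => rfl)
    simpa using (hid.mul_const (V 2)).const_add (w 2)
  refine functionallyIndependent_of_point (x := w) ?_ ?_ ![V₀, V₁, V₂, V₃] ?_
  · intro i
    fin_cases i
    exacts [isGenRat_realI k ε, isGenRat_realJ k ε, isGenRat_realN k ε, isGenRat_m₃]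
  · intro i
    fin_cases i
    exacts [cI, cJ, cN, cm]
  · intro c hc
    have q0 := hc 0
    have q1 := hc 1
    have q2 := hc 2
    have q3 := hc 3
    simp only [Fin.sum_univ_four] at q0 q1 q2 q3
    change c 0 * fderiv ℝ (realI k ε) w V₀ + c 1 * fderiv ℝ (realJ k ε) w V₀
      + c 2 * fderiv ℝ (realN k ε) w V₀ + c 3 * fderiv ℝ m₃ w V₀ = 0 at q0
    change c 0 * fderiv ℝ (realI k ε) w V₁ + c 1 * fderiv ℝ (realJ k ε) w V₁
      + c 2 * fderiv ℝ (realN k ε) w V₁ + c 3 * fderiv ℝ m₃ w V₁ = 0 at q1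
    change c 0 * fderiv ℝ (realI k ε) w V₂ + c 1 * fderiv ℝ (realJ k ε) w V₂
      + c 2 * fderiv ℝ (realN k ε) w V₂ + c 3 * fderiv ℝ m₃ w V₂ = 0 at q2
    change c 0 * fderiv ℝ (realI k ε) w V₃ + c 1 * fderiv ℝ (realJ k ε) w V₃
      + c 2 * fderiv ℝ (realN k ε) w V₃ + c 3 * fderiv ℝ m₃ w V₃ = 0 at q3
    rw [dm, show V₀ 2 = 0 from rfl] at q0
    rw [dm, show V₁ 2 = 0 from rfl] at q1
    rw [dm, show V₂ 2 = 0 from rfl] at q2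
    rw [dm, show V₃ 2 = 1 from rfl] at q3
    -- Along V₀ both I and J + N are stationary, but J is not.
    have h12 : c 1 = c 2 := by
      refine sub_eq_zero.mp ((mul_eq_zero.mp ?_).resolve_right dJ0)
      linear_combination q0 - c 0 * dI0 - c 2 * dS0
    have h1 : c 0 * ((parA k - 1) * 2) + c 2 = 0 := by
      refine (mul_eq_zero.mp ?_).resolve_right hr0.ne'
      linear_combination q1 - c 0 * dI1 - c 2 * dS1 - fderiv ℝ (realJ k ε) w V₁ * h12
    have h2 : c 0 * (parA k * 2) + c 2 = 0 := by
      refine (mul_eq_zero.mp ?_).resolve_right (mul_ne_zero two_ne_zero hB)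
      linear_combination q2 - c 0 * dI2 - c 2 * dS2 - fderiv ℝ (realJ k ε) w V₂ * h12
    have e0 : c 0 = 0 := by linear_combination (h2 - h1) / 2
    have e2 : c 2 = 0 := by rw [e0] at h2; linarith
    have e1 : c 1 = 0 := by rw [h12, e2]
    have e3 : c 3 = 0 := by rw [e0, e1, e2] at q3; linarith
    funext i
    fin_cases i
    exacts [e0, e1, e2, e3]

/-- Up to a non-zero factor, the partial derivative of `J₁` with respect to `realN`. -/
def critN (k : KirchhoffParams) (ε : ℝ) (x : KState) : ℝ :=
  (realI k ε x - (2 * parA k - 1)) * denJ₁ k ε x - (realI k ε x * (realN k ε x + 2)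
    - (2 * parA k - 1) * (realN k ε x + realJ k ε x)) * (2 * realN k ε x + 2)

theorem generically_critN_ne (ha : k.a₁ ≠ 0) (hb : k.b₁ ≠ k.b₃) (hε : ε ≠ 0) :
    Generically fun x => realJ k ε x * critN k ε x ≠ 0 := by
  obtain ⟨w, w2, w5, wt, wE, w1, w3, -⟩ := exists_slice_point ha hb hε
  have hR : detR k ε w ≠ 0 := by rw [detR_slice w2 w5]; exact one_ne_zero
  have hV : realV k ε w ≠ 0 := by rwa [realV_slice w2 w5]
  have hJ : realJ k ε w = 2 := by rw [realJ_slice w2 w5 w1, wt]; simp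
  have cI := (contDiffAt_realI hR).continuousAt
  have cJ := (contDiffAt_realJ hR hV).continuousAt
  have cN := (contDiffAt_realN hR hV).continuousAt
  have cd := (contDiffAt_denJ₁ hR hV).continuousAt
  refine IsGenRat.generically_ne (x := w) ((isGenRat_realJ k ε).mul
    ((((isGenRat_realI k ε).sub (.const _)).mul (isGenRat_denJ₁ k ε)).sub
      ((((isGenRat_realI k ε).mul ((isGenRat_realN k ε).add (.const _))).sub
        ((IsGenRat.const _).mul ((isGenRat_realN k ε).add (isGenRat_realJ k ε)))).mul
        (((IsGenRat.const _).mul (isGenRat_realN k ε)).add (.const _)))))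
    (by unfold critN; fun_prop) ?_
  rw [critN, denJ₁_slice w2, realN_slice w2 w5, hJ, realI_slice w2 w5]
  -- Here J = 2 and N = (H - 3)/2, so the product is -E(1 + H)²/2, with E, H the values of `formE`,
  -- `formH`.
  have := mul_ne_zero wE (pow_ne_zero 2 w1)
  contrapose! this
  linear_combination (-2) * this

/-- The chain rule for J₁ as a function of I, J, N and the rescaled m₃. Only the coefficient of n'
is used later; the others merely have to be independent of the direction. -/
theorem hasDerivAt_quotient {b : ℝ} {i j n m : ℝ → ℝ} {i' j' n' m' : ℝ}
    (hi : HasDerivAt i i' 0) (hj : HasDerivAt j j' 0) (hn : HasDerivAt n n' 0)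
    (hm : HasDerivAt m m' 0) {I J N μ d G : ℝ} (eI : i 0 = I) (eJ : j 0 = J) (eN : n 0 = N)
    (eμ : m 0 = μ) (ed : d = N ^ 2 + 2 * N + b ^ 2 * μ ^ 2 * J ^ 2 - 2 * b * μ ^ 2 * I * J)
    (eG : G = I * (N + 2) - b * (N + J)) (hd : d ≠ 0) :
    HasDerivAt (fun t =>
      (i t * (n t ^ 2 + 2 * n t + b ^ 2 * m t ^ 2 * j t ^ 2 - 2 * b * m t ^ 2 * i t * j t)
        + 4 * j t * (i t * (n t + 2) - b * (n t + j t)))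
        / (n t ^ 2 + 2 * n t + b ^ 2 * m t ^ 2 * j t ^ 2 - 2 * b * m t ^ 2 * i t * j t))
      ((1 + 4 * J * ((N + 2) * d + G * (2 * b * μ ^ 2 * J)) / d ^ 2) * i'
        + (4 * G / d + 4 * J * (-b * d - G * (2 * b ^ 2 * μ ^ 2 * J - 2 * b * μ ^ 2 * I)) / d ^ 2)
          * j'
        + 4 * (J * ((I - b) * d - G * (2 * N + 2))) / d ^ 2 * n'
        + -(4 * J * (G * (2 * b ^ 2 * μ * J ^ 2 - 4 * b * μ * I * J))) / d ^ 2 * m') 0 := by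
  subst eI eJ eN eμ
  have hden : HasDerivAt (fun t =>
      n t ^ 2 + 2 * n t + b ^ 2 * m t ^ 2 * j t ^ 2 - 2 * b * m t ^ 2 * i t * j t) _ 0 :=
    (((hn.pow 2).add (hn.const_mul 2)).add (((hm.pow 2).const_mul (b ^ 2)).mul (hj.pow 2))).sub
      ((((hm.pow 2).const_mul (2 * b)).mul hi).mul hj)
  have hnum : HasDerivAt (fun t => 4 * j t * (i t * (n t + 2) - b * (n t + j t))) _ 0 :=
    (hj.const_mul 4).mul ((hi.mul (hn.add_const 2)).sub ((hn.add hj).const_mul b))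
  refine HasDerivAt.congr_deriv (((hi.mul hden).add hnum).div hden (ed ▸ hd)) ?_
  simp only [Pi.add_apply, Pi.mul_apply, Pi.pow_apply]
  rw [← ed, ← eG]
  field_simp
  ring

theorem exists_fderiv_realJ₁ (hI : DifferentiableAt ℝ (realI k ε) x)
    (hJ : DifferentiableAt ℝ (realJ k ε) x) (hN : DifferentiableAt ℝ (realN k ε) x)
    (hd : denJ₁ k ε x ≠ 0) :
    DifferentiableAt ℝ (realJ₁ k ε) x ∧ ∃ A B D : ℝ, ∀ V, fderiv ℝ (realJ₁ k ε) x V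
      = A * fderiv ℝ (realI k ε) x V + B * fderiv ℝ (realJ k ε) x V
        + 4 * (realJ k ε x * critN k ε x) / denJ₁ k ε x ^ 2 * fderiv ℝ (realN k ε) x V
        + D * fderiv ℝ m₃ x V := by
  have hm : DifferentiableAt ℝ m₃ x := contDiff_m₃.contDiffAt.differentiableAt one_ne_zero
  have hden : DifferentiableAt ℝ (denJ₁ k ε) x := by
    unfold denJ₁ spin
    fun_prop
  have hdiff : DifferentiableAt ℝ (realJ₁ k ε) x := by
    unfold realJ₁ numJ₁
    fun_prop (disch := exact hd)
  set b := 2 * parA k - 1 with hb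
  set I := realI k ε x
  set J := realJ k ε x
  set N := realN k ε x
  set μ := spin k ε x with hμ
  set G := I * (N + 2) - b * (N + J) with hG
  set d := denJ₁ k ε x with hd'
  refine ⟨hdiff, 1 + 4 * J * ((N + 2) * d + G * (2 * b * μ ^ 2 * J)) / d ^ 2,
    4 * G / d + 4 * J * (-b * d - G * (2 * b ^ 2 * μ ^ 2 * J - 2 * b * μ ^ 2 * I)) / d ^ 2,
    -scale k ε * (4 * J * (G * (2 * b ^ 2 * μ * J ^ 2 - 4 * b * μ * I * J))) / d ^ 2, fun V => ?_⟩
  have hq := hasDerivAt_quotient (b := b) (hasDerivAt_line hI V) (hasDerivAt_line hJ V)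
    (hasDerivAt_line hN V) ((hasDerivAt_line hm V).const_mul (scale k ε)) (I := I) (J := J) (N := N)
    (μ := μ) (d := d) (by simp [I]) (by simp [J]) (by simp [N]) (by simp [hμ, spin, m₃])
    (by rw [hd', denJ₁]) hG hd
  refine ((hasDerivAt_line hdiff V).unique hq).trans ?_
  rw [critN]
  ring

end

end Kirchhoff

/-! ### Independence of I₀, J₀, J₁, m₃ and the main theorem. -/

namespace Kirchhoff

open Filter Topology MvPolynomial

noncomputable section

variable {k : KirchhoffParams} {ε : ℝ}

/-- The differentials of I₀, J₀, J₁, m₃ are obtained from those of I, J, N, m₃ by an invertible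
matrix: J₀ contributes the factor 2a - 1, non-zero since a₁ ≠ 2a₃, and J₁ a non-zero multiple of
`critN` times J. -/
theorem functionallyIndependent_integrals (ha : k.a₁ ≠ 0) (hb : k.b₁ ≠ k.b₃) (hε : ε ≠ 0)
    (h2 : k.a₁ ≠ 2 * k.a₃) {N D : MvPolynomial (Fin 6) ℝ}
    (hJ : Generically fun x => realJ₁ k ε x = ratFun N D x) :
    FunctionallyIndependent ![I₀ k ε, J₀ k ε, ratFun N D, m₃] := by
  have hbne : 2 * parA k - 1 ≠ 0 := fun e => h2 <| by
    rw [parA] at e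
    field_simp at e
    linarith
  have gJ₀ : Generically fun x =>
      J₀ k ε x = (2 * parA k - 1) * realJ k ε x - realI k ε x :=
    (generically_good₃ ha hε).mono fun x h => h.1.J₀_eq ha hb hε h.2.1
  refine (((((functionallyIndependent_aux ha hb hε).and gJ₀.eventually).and hJ.eventually).and
    (generically_good ha hε)).and (generically_critN_ne ha hb hε)).mono ?_
  rintro x ⟨⟨⟨⟨⟨hdiff, hli⟩, e2⟩, e3⟩, hgood⟩, hcrit⟩
  have dI : DifferentiableAt ℝ (realI k ε) x := hdiff 0
  have dJ : DifferentiableAt ℝ (realJ k ε) x := hdiff 1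
  have dN : DifferentiableAt ℝ (realN k ε) x := hdiff 2
  have dm : DifferentiableAt ℝ m₃ x := hdiff 3
  have e1 : I₀ k ε = realI k ε := funext (I₀_eq ha)
  have e2 : J₀ k ε =ᶠ[𝓝 x] fun y => (2 * parA k - 1) * realJ k ε y - realI k ε y := e2
  have e3 : ratFun N D =ᶠ[𝓝 x] realJ₁ k ε := EventuallyEq.symm e3
  obtain ⟨d1, A, B, C, hfd⟩ := exists_fderiv_realJ₁ dI dJ dN hgood.den_ne
  have dJ₀ : DifferentiableAt ℝ (J₀ k ε) x :=
    ((dJ.const_mul _).sub dI).congr_of_eventuallyEq e2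
  have f2 : ∀ V, fderiv ℝ (J₀ k ε) x V
      = (2 * parA k - 1) * fderiv ℝ (realJ k ε) x V - fderiv ℝ (realI k ε) x V := fun V => by
    rw [e2.fderiv_eq, fderiv_fun_sub (dJ.const_mul _) dI, fderiv_const_mul dJ]
    rfl
  have f3 : fderiv ℝ (ratFun N D) x = fderiv ℝ (realJ₁ k ε) x := e3.fderiv_eq
  refine ⟨fun j => ?_, ?_⟩
  · fin_cases j
    exacts [e1 ▸ dI, dJ₀, d1.congr_of_eventuallyEq e3, dm]
  · rw [Fintype.linearIndependent_iff] at hli ⊢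
    intro g hg
    have hg' : ∀ V, g 0 * fderiv ℝ (realI k ε) x V + g 1 * fderiv ℝ (J₀ k ε) x V
        + g 2 * fderiv ℝ (realJ₁ k ε) x V + g 3 * fderiv ℝ m₃ x V = 0 := fun V => by
      have := congrArg (fun L => L V) hg
      simp only [Fin.sum_univ_four] at this
      rw [← f3, ← e1]
      exact this
    set q := 4 * (realJ k ε x * critN k ε x) / denJ₁ k ε x ^ 2 with hq
    have hq0 : q ≠ 0 := div_ne_zero (mul_ne_zero four_ne_zero hcrit) (pow_ne_zero 2 hgood.den_ne)
    have key := hli ![g 0 - g 1 + g 2 * A, g 1 * (2 * parA k - 1) + g 2 * B, g 2 * q,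
      g 3 + g 2 * C] (by
        ext V
        have := hg' V
        rw [f2, hfd] at this
        simp only [Fin.sum_univ_four]
        change (g 0 - g 1 + g 2 * A) * fderiv ℝ (realI k ε) x V
          + (g 1 * (2 * parA k - 1) + g 2 * B) * fderiv ℝ (realJ k ε) x V
          + g 2 * q * fderiv ℝ (realN k ε) x V + (g 3 + g 2 * C) * fderiv ℝ m₃ x V = 0
        linear_combination this)
    have k0 : g 0 - g 1 + g 2 * A = 0 := key 0
    have k1 : g 1 * (2 * parA k - 1) + g 2 * B = 0 := key 1
    have k2 : g 2 * q = 0 := key 2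
    have k3 : g 3 + g 2 * C = 0 := key 3
    have g2 : g 2 = 0 := (mul_eq_zero.mp k2).resolve_right hq0
    rw [g2, zero_mul, add_zero] at k0 k1 k3
    have g1 : g 1 = 0 := (mul_eq_zero.mp k1).resolve_right hbne
    rw [g1, sub_zero] at k0
    intro i
    fin_cases i
    exacts [k0, g1, g2, k3]

end

end Kirchhoff

theorem mainTheorem9 (k : KirchhoffParams) (ε : ℝ)
    (ha : k.a₁ ≠ 0) (hb : k.b₁ ≠ k.b₃) (hε : ε ≠ 0) :
    -- the third order Wronskians form an HK basis
    Dense (Kirchhoff.orbitDomain k ε) ∧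
    IsHKBasis (Kirchhoff.iter k ε) (Kirchhoff.orbitDomain k ε) (Kirchhoff.wronskian k ε 3) ∧
    -- the rational function `J₁ = N / D`
    ∃ N D : MvPolynomial (Fin 6) ℝ, D ≠ 0 ∧
      -- generically the null-space is one-dimensional, spanned by `(1, 1, J₁)`
      Kirchhoff.Generically (fun x => MvPolynomial.eval x D ≠ 0 ∧
        (x ∈ Kirchhoff.orbitDomain k ε →
          Module.finrank ℝ
            (hkNullSpace (Kirchhoff.iter k ε) (Kirchhoff.wronskian k ε 3) x) = 1 ∧
          hkNullSpace (Kirchhoff.iter k ε) (Kirchhoff.wronskian k ε 3) x =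
            Submodule.span ℝ {![1, 1, Kirchhoff.ratFun N D x]})) ∧
      -- the relation with coefficients `1, 1, J₁`, wherever it is defined
      (∀ x : KState, MvPolynomial.eval x D ≠ 0 →
        (∀ i < 3, Kirchhoff.delta k ε ((Kirchhoff.kahanMap k ε)^[i] x) ≠ 0) →
          Kirchhoff.wronskian k ε 3 0 x + Kirchhoff.wronskian k ε 3 1 x
            + Kirchhoff.ratFun N D x * Kirchhoff.wronskian k ε 3 2 x = 0) ∧
      -- `I₀`, `J₀`, `J₁`, `m₃` are integrals of motion
      Kirchhoff.IsIntegral k ε {x | Kirchhoff.c₁ k ε x ≠ 0} (Kirchhoff.I₀ k ε) ∧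
      Kirchhoff.IsIntegral k ε {x | Kirchhoff.delta k ε x ≠ 0 ∧ Kirchhoff.C₁ k ε x ≠ 0}
        (Kirchhoff.J₀ k ε) ∧
      Kirchhoff.IsIntegral k ε {x | MvPolynomial.eval x D ≠ 0} (Kirchhoff.ratFun N D) ∧
      Kirchhoff.IsIntegral k ε Set.univ Kirchhoff.m₃ ∧
      -- they are functionally independent
      (k.a₁ ≠ 2 * k.a₃ →
        Kirchhoff.FunctionallyIndependent
          ![Kirchhoff.I₀ k ε, Kirchhoff.J₀ k ε, Kirchhoff.ratFun N D, Kirchhoff.m₃]) := by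
  -- Some quotient N / D representing `realJ₁` generically. The claims at every point with D ≠ 0
  -- follow by continuity, so the choice of the representation is immaterial.
  obtain ⟨N, D, hD, h⟩ := Kirchhoff.isGenRat_realJ₁ k ε
  have hJ : Kirchhoff.Generically fun x =>
      Kirchhoff.realJ₁ k ε x = Kirchhoff.ratFun N D x := ⟨D, hD, h⟩
  refine ⟨Kirchhoff.dense_orbitDomain, ⟨Kirchhoff.linearIndependent_wronskian ha hb hε,
    fun x hx => Kirchhoff.nullSpace_ne_bot ha hb hε hx⟩, N, D, hD, ?_,
    fun x hx hd => Kirchhoff.relation_ratFun ha hb hε hJ hx hd,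
    Kirchhoff.isIntegral_I₀ ha hb hε, Kirchhoff.isIntegral_J₀ ha hb hε,
    Kirchhoff.isIntegral_ratFun ha hb hε hJ, Kirchhoff.isIntegral_m₃,
    fun h2 => Kirchhoff.functionallyIndependent_integrals ha hb hε h2 hJ⟩
  have hD' : Kirchhoff.Generically fun x => MvPolynomial.eval x D ≠ 0 := ⟨D, hD, fun _ hx => hx⟩
  refine (((Kirchhoff.generically_good₃ ha hε).and
    (Kirchhoff.generically_wronskianDet_ne ha hb hε)).and (hJ.and hD')).mono ?_
  rintro x ⟨⟨hg, hdet⟩, hx, hxD⟩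
  refine ⟨hxD, fun hU => ?_⟩
  rw [← hx, Kirchhoff.nullSpace_eq_span ha hb hε hU hg hdet]
  refine ⟨finrank_span_singleton fun e => ?_, rfl⟩
  have := congrFun e 0
  simp at this
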